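/- **Conventions.** Exact categories are Quillen exact (additive, with a class of admissible short exact sequences $x \rightarrowtail y \twoheadrightarrow z$). For an exact category $\mathcal E$, $\mathrm{Ch}_b(\mathcal E)$ is the category of bounded complexes with the degreewise exact structure, $\mathcal H_b(\mathcal E)$ its homotopy category, and $\mathcal D_b(\mathcal E)$ the Verdier quotient of $\mathcal H_b(\mathcal E)$ by the complexes which are homotopy equivalent to a complex spliced from admissible short exact sequences; $j_{\mathcal E}\colon \mathcal E\to \mathrm{Ch}_b(\mathcal E)$ sends an object to the complex concentrated in degree $0$. A *relative exact category* $\mathbf E=(\mathcal E,w)$ is an exact category $\mathcal E$ with a specified zero object $0$ and a class $w$ of morphisms which contains the identities and is closed under composition. $\mathcal E^w$ is the full subcategory of the objects $x$ such that $0\to x$ is in $w$. $\mathbf E$ is *strict* if $\mathcal E^w$ is itself an exact category such that the inclusion $\mathcal E^w\hookrightarrow\mathcal E$ preserves and reflects admissible short exact sequences. Let $\mathcal D_b(\mathbf E)=\mathcal D_b(\mathcal E,w)$ be the cokernel of $\mathcal D_b(\mathcal E^w)\to\mathcal D_b(\mathcal E)$, i.e. the Verdier quotient of $\mathcal D_b(\mathcal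 E)$ by the triangulated subcategory generated by the bounded complexes with terms in $\mathcal E^w$. Let $qw$ be the class of morphisms of $\mathrm{Ch}_b(\mathcal E)$ which become isomorphisms in $\mathcal D_b(\mathbf E)$, and $\mathrm{Ch}_b(\mathbf E)=(\mathrm{Ch}_b(\mathcal E),qw)$. A *bicomplicial category* is an exact category $\mathcal E$ with an exact endofunctor $C$, natural transformations $\iota\colon \mathrm{id}\to C$, $r\colon CC\to C$ and a natural isomorphism $\sigma\colon CC\cong CC$ such that $r\,C(\iota)=r\,\iota_C=\mathrm{id}_C$, $\sigma\, C(\iota)=\iota_C$, $\sigma\sigma=\mathrm{id}$, each $\iota_x\colon x\to Cx$ is an admissible monomorphism, and the suspension $T=C/\mathrm{id}$ is an equivalence of categories. Morphisms $f,g\colon x\to y$ are *homotopic* if $f-g=H\iota_x$ for some $H\colon Cx\to y$; this defines the homotopy category $\pi_0(\mathcal E)$ and homotopy equivalences. $\pi_0(\mathcal E)$ is triangulated with suspension $T$, the exact triangles being those isomorphic to $x\xrightarrow{f}y\to \mathrm{Cone} f\to Tx$ with $\mathrm{Cone} f=y\sqcup_x Cx$. $\mathrm{Ch}_b(\mathcal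 E)$ has a standard bicomplicial structure with $Cx=\mathrm{Cone}(\mathrm{id}_x)$ and the usual $\iota$, $r$, $\sigma$. A *bicomplicial pair* $(\mathcal E,w)$ is a bicomplicial category with a class $w$ of morphisms (making it a relative exact category) which satisfies two-out-of-three, contains all homotopy equivalences, and is closed under extensions: if in a morphism of admissible short exact sequences the two outer components are in $w$, so is the middle one. It is *thick* if $w$ is closed under retracts. Put $\mathcal T(\mathcal E,w)=\pi_0(\mathcal E)/\pi_0(\mathcal E^w)$ (Verdier quotient). **Theorem.** (1) Let $\mathbf E=(\mathcal E,w)$ be a thick bicomplicial pair. Then $j_{\mathcal E}$ induces an equivalence of triangulated categories $$\mathcal T(\mathcal E,w)\;\xrightarrow{\ \sim\ }\;\mathcal T(\mathrm{Ch}_b(\mathcal E),qw),$$ and the projection $\mathrm{Ch}_b(\mathcal E)\to\mathcal D_b(\mathcal E,w)$ induces an equivalence of triangulated categories $\mathcal T(\mathrm{Ch}_b(\mathcal E),qw)\simeq\mathcal D_b(\mathcal E,w)$. (2) (Derived Gillet–Waldhausen theorem.) Let $\mathbf F=(\mathcal F,v)$ be a strict relative exact category (for example a consistent one, i.e. a strict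 one with $j_{\mathcal F}(v)\subset qv$). Then $j_{\mathcal F}$ is a derived equivalence $\mathbf F\to\mathrm{Ch}_b(\mathbf F)$: it induces an equivalence of triangulated categories $$\mathcal D_b(\mathbf F)\;\xrightarrow{\ \sim\ }\;\mathcal D_b(\mathrm{Ch}_b(\mathbf F))=\mathcal D_b(\mathrm{Ch}_b(\mathcal F),qv).$$ -/

import Mathlib

open CategoryTheory Limits Pretriangulated ZeroObject

universe v u

namespace DerivedGW

section ExactCategories

variable {C : Type u} [Category.{v} C] [Preadditive C]

/-- The admissible monomorphisms attached to a class of short complexes. -/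
def inflations (P : ObjectProperty (ShortComplex C)) : MorphismProperty C :=
  fun _ Y f => ∃ (Z : C) (g : Y ⟶ Z) (w : f ≫ g = 0), P (ShortComplex.mk f g w)

/-- The admissible epimorphisms attached to a class of short complexes. -/
def deflations (P : ObjectProperty (ShortComplex C)) : MorphismProperty C :=
  fun Y _ g => ∃ (X : C) (f : X ⟶ Y) (w : f ≫ g = 0), P (ShortComplex.mk f g w)

variable (C) in
/-- A Quillen exact structure on an additive category: a class of kernel-cokernel pairs
(the admissible short exact sequences, or conflations), closed under isomorphisms, such that
identities are admissible monomorphisms and epimorphisms, these two classes are closed under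
composition, and admissible monomorphisms (resp. epimorphisms) have pushouts (resp. pullbacks)
along arbitrary morphisms, which are again admissible. -/
structure ExactStructure where
  conflation : ObjectProperty (ShortComplex C)
  of_iso : ∀ {S S' : ShortComplex C}, (S ≅ S') → conflation S → conflation S'
  kernel : ∀ S, conflation S → Nonempty (IsLimit (KernelFork.ofι S.f S.zero))
  cokernel : ∀ S, conflation S → Nonempty (IsColimit (CokernelCofork.ofπ S.g S.zero))
  id_inflation : ∀ X : C, inflations conflation (𝟙 X)
  id_deflation : ∀ X : C, deflations conflation (𝟙 X)
  comp_inflation : ∀ {X Y Z : C} (f : X ⟶ Y) (g : Y ⟶ Z),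
    inflations conflation f → inflations conflation g → inflations conflation (f ≫ g)
  comp_deflation : ∀ {X Y Z : C} (f : X ⟶ Y) (g : Y ⟶ Z),
    deflations conflation f → deflations conflation g → deflations conflation (f ≫ g)
  pushout : ∀ {X Y X' : C} (i : X ⟶ Y) (f : X ⟶ X'), inflations conflation i →
    ∃ (Y' : C) (f' : Y ⟶ Y') (i' : X' ⟶ Y'),
      IsPushout i f f' i' ∧ inflations conflation i'
  pullback : ∀ {Y Z Z' : C} (p : Y ⟶ Z) (g : Z' ⟶ Z), deflations conflation p →
    ∃ (Y' : C) (g' : Y' ⟶ Y) (p' : Y' ⟶ Z'),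
      IsPullback g' p' p g ∧ deflations conflation p'

lemma ExactStructure.epi_g (E : ExactStructure C) {S : ShortComplex C} (h : E.conflation S) :
    Epi S.g :=
  ⟨fun _ _ e => Cofork.IsColimit.hom_ext (E.cokernel S h).some e⟩

lemma ExactStructure.mono_f (E : ExactStructure C) {S : ShortComplex C} (h : E.conflation S) :
    Mono S.f :=
  ⟨fun _ _ e => Fork.IsLimit.hom_ext (E.kernel S h).some e⟩

lemma ExactStructure.inflation_comp_iso {E : ExactStructure C} {X Y Y' : C} {f : X ⟶ Y} (hf : inflations E.conflation f)
    (e : Y ≅ Y') : inflations E.conflation (f ≫ e.hom) := by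
  obtain ⟨Z, g, w, h⟩ := hf
  exact ⟨Z, e.inv ≫ g, by simp [w],
    E.of_iso (ShortComplex.isoMk (S₁ := ShortComplex.mk f g w) (Iso.refl _) e (Iso.refl _)
      (by simp) (by simp)) h⟩

lemma ExactStructure.inflation_of_isPushout {E : ExactStructure C} {X Y X' Y' : C} {i : X ⟶ Y} {f : X ⟶ X'} {f' : Y ⟶ Y'}
    {i' : X' ⟶ Y'} (hi : inflations E.conflation i) (h : IsPushout i f f' i') :
    inflations E.conflation i' := by
  obtain ⟨Y'', f'', i'', h', h''⟩ := E.pushout i f hi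
  have := ExactStructure.inflation_comp_iso h'' (h'.isoIsPushout _ _ h)
  rwa [IsPushout.inr_isoIsPushout_hom] at this

lemma ExactStructure.conflation_of_isColimit {E : ExactStructure C} {X Y Z : C} {f : X ⟶ Y} {g : Y ⟶ Z}
    (hf : inflations E.conflation f) (w : f ≫ g = 0)
    (h : Nonempty (IsColimit (CokernelCofork.ofπ g w))) :
    E.conflation (ShortComplex.mk f g w) := by
  obtain ⟨Z', g', w', h'⟩ := hf
  obtain ⟨hg⟩ := h
  obtain ⟨hg'⟩ := E.cokernel _ h'
  refine E.of_iso (ShortComplex.isoMk (S₁ := ShortComplex.mk f g' w') (Iso.refl _) (Iso.refl _)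
    (hg'.coconePointUniqueUpToIso hg) (by simp) ?_) h'
  have := hg'.comp_coconePointUniqueUpToIso_hom hg WalkingParallelPair.one
  exact (Category.id_comp _).trans this.symm

end ExactCategories

section BoundedComplexes

variable (C : Type u) [Category.{v} C] [Preadditive C]

/-- Bounded complexes. Complexes are indexed cohomologically: the term `x_n` of a chain
complex is the term `X^{-n}` of the cochain complex. -/
def bounded : ObjectProperty (CochainComplex C ℤ) :=
  fun K => ∃ a b : ℤ, ∀ n : ℤ, (n < a ∨ b < n) → IsZero (K.X n)

/-- The category `Ch_b(C)` of bounded complexes. -/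
abbrev ChB := (bounded C).FullSubcategory

variable {C}

lemma bounded_of_two {K L M : CochainComplex C ℤ} (hK : bounded C K) (hL : bounded C L)
    (h : ∀ n, IsZero (K.X n) → IsZero (L.X n) → IsZero (M.X n)) : bounded C M := by
  obtain ⟨a, b, hK⟩ := hK
  obtain ⟨a', b', hL⟩ := hL
  refine ⟨min a a', max b b', fun n hn => h n (hK n ?_) (hL n ?_)⟩ <;> grind

instance : (bounded C).IsClosedUnderIsomorphisms where
  of_iso e := by
    rintro ⟨a, b, h⟩
    exact ⟨a, b, fun n hn => (h n hn).of_iso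
      ((HomologicalComplex.eval C (ComplexShape.up ℤ) n).mapIso e.symm)⟩

instance : (bounded C).IsStableUnderShift ℤ where
  isStableUnderShiftBy n :=
    { le_shift := by
        rintro K ⟨a, b, h⟩
        exact ⟨a - n, b - n, fun i hi => h (i + n) (by omega)⟩ }

instance [HasZeroObject C] : (bounded C).ContainsZero where
  exists_zero := ⟨0, isZero_zero _, 0, 0, fun n _ =>
    (HomologicalComplex.eval C (ComplexShape.up ℤ) n).map_isZero (isZero_zero _)⟩

instance [HasBinaryBiproducts C] : HasBinaryBiproducts (ChB C) where
  has_binary_biproduct K L := by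
    have h : bounded C (K.obj ⊞ L.obj) := by
      refine bounded_of_two K.property L.property fun n hK hL => ?_
      refine IsZero.of_iso ?_ ((HomologicalComplex.eval C (ComplexShape.up ℤ) n).mapBiprod _ _)
      rw [IsZero.iff_id_eq_zero]
      ext
      · exact hK.eq_of_src _ _
      · exact hK.eq_of_src _ _
      · exact hL.eq_of_src _ _
      · exact hL.eq_of_src _ _
    let b : BinaryBicone K L :=
      { pt := ⟨K.obj ⊞ L.obj, h⟩
        fst := ObjectProperty.homMk biprod.fst
        snd := ObjectProperty.homMk biprod.snd
        inl := ObjectProperty.homMk biprod.inl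
        inr := ObjectProperty.homMk biprod.inr
        inl_fst := by ext : 1; simp
        inl_snd := by ext : 1; simp
        inr_fst := by ext : 1; simp
        inr_snd := by ext : 1; simp }
    exact hasBinaryBiproduct_of_total b (by ext : 1; exact biprod.total)

/-- The `n`-th term, as a functor on bounded complexes. -/
abbrev evalB (n : ℤ) : ChB C ⥤ C :=
  (bounded C).ι ⋙ HomologicalComplex.eval C (ComplexShape.up ℤ) n

instance (n : ℤ) : (evalB (C := C) n).Additive where

end BoundedComplexes

section ExactStructureOnComplexes

variable {C : Type u} [Category.{v} C] [Preadditive C] (E : ExactStructure C)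

/-- The class of degreewise admissible short exact sequences of bounded complexes. -/
def degreewise : ObjectProperty (ShortComplex (ChB C)) :=
  fun S => ∀ n : ℤ, E.conflation (S.map (evalB n))

variable {E}

lemma ChB.comm {K L : ChB C} (f : K ⟶ L) (i j : ℤ) :
    f.hom.f i ≫ L.obj.d i j = K.obj.d i j ≫ f.hom.f j := f.hom.comm i j

lemma ChB.hom_ext' {K L : ChB C} {f g : K ⟶ L} (h : ∀ n, f.hom.f n = g.hom.f n) : f = g := by
  ext n
  exact h n

lemma degreewise.zero {K L M : ChB C} {f : K ⟶ L} {g : L ⟶ M} (w : f ≫ g = 0) (n : ℤ) :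
    f.hom.f n ≫ g.hom.f n = 0 :=
  congrArg (fun φ => φ.hom.f n) w

lemma inflations_degreewise_iff {K L : ChB C} (f : K ⟶ L) :
    inflations (degreewise E) f ↔ ∀ n, inflations E.conflation (f.hom.f n) := by
  constructor
  · rintro ⟨M, g, w, h⟩ n
    exact ⟨_, _, _, h n⟩
  · intro h
    choose Z g w hZ using h
    have hc (n : ℤ) := (E.cokernel _ (hZ n)).some
    have hd (i j : ℤ) : ∃ δ : Z i ⟶ Z j, g i ≫ δ = L.obj.d i j ≫ g j :=
      ⟨_, (CokernelCofork.IsColimit.desc' (hc i) (L.obj.d i j ≫ g j) (by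
        dsimp
        rw [← Category.assoc, ChB.comm, Category.assoc, w, comp_zero])).2⟩
    choose δ hδ using hd
    have hepi (n : ℤ) : Epi (g n) := E.epi_g (hZ n)
    let M : CochainComplex C ℤ :=
      { X := Z
        d := δ
        shape := fun i j hij => by
          rw [← cancel_epi (g i), hδ, L.obj.shape i j hij, zero_comp, comp_zero]
        d_comp_d' := fun i j k _ _ => by
          rw [← cancel_epi (g i), ← Category.assoc, hδ, Category.assoc, hδ, ← Category.assoc,
            L.obj.d_comp_d, zero_comp, comp_zero] }
    have hM : bounded C M := bounded_of_two L.property L.property fun n hL _ => by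
      rw [IsZero.iff_id_eq_zero, ← cancel_epi (g n)]
      exact hL.eq_of_src _ _
    let q : L ⟶ (⟨M, hM⟩ : ChB C) := ObjectProperty.homMk
      { f := g, comm' := fun i j _ => hδ i j }
    exact ⟨⟨M, hM⟩, q, ChB.hom_ext' fun n => w n, hZ⟩

lemma deflations_degreewise_iff {K L : ChB C} (f : K ⟶ L) :
    deflations (degreewise E) f ↔ ∀ n, deflations E.conflation (f.hom.f n) := by
  constructor
  · rintro ⟨M, g, w, h⟩ n
    exact ⟨_, _, _, h n⟩
  · intro h
    choose Z g w hZ using h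
    have hc (n : ℤ) := (E.kernel _ (hZ n)).some
    have hd (i j : ℤ) : ∃ δ : Z i ⟶ Z j, δ ≫ g j = g i ≫ K.obj.d i j :=
      ⟨_, (KernelFork.IsLimit.lift' (hc j) (g i ≫ K.obj.d i j) (by
        dsimp
        rw [Category.assoc, ← ChB.comm, ← Category.assoc, w, zero_comp])).2⟩
    choose δ hδ using hd
    have hmono (n : ℤ) : Mono (g n) := E.mono_f (hZ n)
    let M : CochainComplex C ℤ :=
      { X := Z
        d := δ
        shape := fun i j hij => by
          rw [← cancel_mono (g j), hδ, K.obj.shape i j hij, zero_comp, comp_zero]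
        d_comp_d' := fun i j k _ _ => by
          rw [← cancel_mono (g k), Category.assoc, hδ, ← Category.assoc, hδ, Category.assoc,
            K.obj.d_comp_d, zero_comp, comp_zero] }
    have hM : bounded C M := bounded_of_two K.property K.property fun n hL _ => by
      rw [IsZero.iff_id_eq_zero, ← cancel_mono (g n)]
      exact hL.eq_of_tgt _ _
    let q : (⟨M, hM⟩ : ChB C) ⟶ K := ObjectProperty.homMk
      { f := g, comm' := fun i j _ => (hδ i j).symm }
    exact ⟨⟨M, hM⟩, q, ChB.hom_ext' fun n => w n, hZ⟩

lemma exists_pushout_chb {K L K' : ChB C} (i : K ⟶ L) (f : K ⟶ K')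
    (h : ∀ n, ∃ (Y : C) (f' : L.obj.X n ⟶ Y) (i' : K'.obj.X n ⟶ Y),
      IsPushout (i.hom.f n) (f.hom.f n) f' i' ∧ inflations E.conflation i') :
    ∃ (L' : ChB C) (f' : L ⟶ L') (i' : K' ⟶ L'),
      IsPushout i f f' i' ∧ ∀ n, inflations E.conflation (i'.hom.f n) := by
  choose Y f' i' hP hi' using h
  have hd (a b : ℤ) : ∃ δ : Y a ⟶ Y b,
      f' a ≫ δ = L.obj.d a b ≫ f' b ∧ i' a ≫ δ = K'.obj.d a b ≫ i' b := by
    have hw : i.hom.f a ≫ L.obj.d a b ≫ f' b = f.hom.f a ≫ K'.obj.d a b ≫ i' b := by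
      rw [← Category.assoc, ← Category.assoc, ChB.comm, ChB.comm, Category.assoc,
        Category.assoc, (hP b).w]
    exact ⟨(hP a).desc _ _ hw, (hP a).inl_desc _ _ hw, (hP a).inr_desc _ _ hw⟩
  choose δ hδ₁ hδ₂ using hd
  let M : CochainComplex C ℤ :=
    { X := Y
      d := δ
      shape := fun a b hab => (hP a).hom_ext
        (by rw [hδ₁, L.obj.shape a b hab, zero_comp, comp_zero])
        (by rw [hδ₂, K'.obj.shape a b hab, zero_comp, comp_zero])
      d_comp_d' := fun a b c _ _ => (hP a).hom_ext
        (by rw [← Category.assoc, hδ₁, Category.assoc, hδ₁, ← Category.assoc,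
            L.obj.d_comp_d, zero_comp, comp_zero])
        (by rw [← Category.assoc, hδ₂, Category.assoc, hδ₂, ← Category.assoc,
            K'.obj.d_comp_d, zero_comp, comp_zero]) }
  have hM : bounded C M := bounded_of_two L.property K'.property fun n hL hK => by
    rw [IsZero.iff_id_eq_zero]
    exact (hP n).hom_ext (hL.eq_of_src _ _) (hK.eq_of_src _ _)
  let F : L ⟶ (⟨M, hM⟩ : ChB C) := ObjectProperty.homMk
    { f := f', comm' := fun a b _ => hδ₁ a b }
  let I : K' ⟶ (⟨M, hM⟩ : ChB C) := ObjectProperty.homMk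
    { f := i', comm' := fun a b _ => hδ₂ a b }
  have hw : i ≫ F = f ≫ I := ChB.hom_ext' fun n => (hP n).w
  have key {T : ChB C} (α : L ⟶ T) (β : K' ⟶ T) (w : i ≫ α = f ≫ β) :
      ∃ l : (⟨M, hM⟩ : ChB C) ⟶ T, F ≫ l = α ∧ I ≫ l = β := by
    have hwn (n : ℤ) : i.hom.f n ≫ α.hom.f n = f.hom.f n ≫ β.hom.f n :=
      congrArg (fun φ => φ.hom.f n) w
    have (n : ℤ) : ∃ l : Y n ⟶ T.obj.X n, f' n ≫ l = α.hom.f n ∧ i' n ≫ l = β.hom.f n :=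
      ⟨(hP n).desc _ _ (hwn n), (hP n).inl_desc _ _ _, (hP n).inr_desc _ _ _⟩
    choose l hl₁ hl₂ using this
    refine ⟨ObjectProperty.homMk { f := l, comm' := fun a b _ => (hP a).hom_ext ?_ ?_ },
      ChB.hom_ext' hl₁, ChB.hom_ext' hl₂⟩
    · rw [← Category.assoc, hl₁, ChB.comm, ← hl₁ b, ← Category.assoc, ← hδ₁ a b, Category.assoc]
    · rw [← Category.assoc, hl₂, ChB.comm, ← hl₂ b, ← Category.assoc, ← hδ₂ a b, Category.assoc]
  refine ⟨⟨M, hM⟩, F, I, ⟨⟨hw⟩, ⟨PushoutCocone.IsColimit.mk _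
    (fun s => (key _ _ s.condition).choose) (fun s => (key _ _ s.condition).choose_spec.1)
    (fun s => (key _ _ s.condition).choose_spec.2) ?_⟩⟩, hi'⟩
  intro s m h₁ h₂
  refine ChB.hom_ext' fun n => (hP n).hom_ext ?_ ?_
  · exact congrArg (fun φ => φ.hom.f n) (h₁.trans (key _ _ s.condition).choose_spec.1.symm)
  · exact congrArg (fun φ => φ.hom.f n) (h₂.trans (key _ _ s.condition).choose_spec.2.symm)

lemma exists_pullback_chb {L M M' : ChB C} (p : L ⟶ M) (g : M' ⟶ M)
    (h : ∀ n, ∃ (Y : C) (g' : Y ⟶ L.obj.X n) (p' : Y ⟶ M'.obj.X n),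
      IsPullback g' p' (p.hom.f n) (g.hom.f n) ∧ deflations E.conflation p') :
    ∃ (L' : ChB C) (g' : L' ⟶ L) (p' : L' ⟶ M'),
      IsPullback g' p' p g ∧ ∀ n, deflations E.conflation (p'.hom.f n) := by
  choose Y g' p' hP hp' using h
  have hd (a b : ℤ) : ∃ δ : Y a ⟶ Y b,
      δ ≫ g' b = g' a ≫ L.obj.d a b ∧ δ ≫ p' b = p' a ≫ M'.obj.d a b := by
    have hw : (g' a ≫ L.obj.d a b) ≫ p.hom.f b = (p' a ≫ M'.obj.d a b) ≫ g.hom.f b := by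
      rw [Category.assoc, Category.assoc, ← ChB.comm, ← ChB.comm, ← Category.assoc,
        ← Category.assoc, (hP a).w]
    exact ⟨(hP b).lift _ _ hw, (hP b).lift_fst _ _ hw, (hP b).lift_snd _ _ hw⟩
  choose δ hδ₁ hδ₂ using hd
  let N : CochainComplex C ℤ :=
    { X := Y
      d := δ
      shape := fun a b hab => (hP b).hom_ext
        (by rw [hδ₁, L.obj.shape a b hab, zero_comp, comp_zero])
        (by rw [hδ₂, M'.obj.shape a b hab, zero_comp, comp_zero])
      d_comp_d' := fun a b c _ _ => (hP c).hom_ext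
        (by rw [Category.assoc, hδ₁, ← Category.assoc, hδ₁, Category.assoc,
            L.obj.d_comp_d, zero_comp, comp_zero])
        (by rw [Category.assoc, hδ₂, ← Category.assoc, hδ₂, Category.assoc,
            M'.obj.d_comp_d, zero_comp, comp_zero]) }
  have hN : bounded C N := bounded_of_two L.property M'.property fun n hL hK => by
    rw [IsZero.iff_id_eq_zero]
    exact (hP n).hom_ext (hL.eq_of_tgt _ _) (hK.eq_of_tgt _ _)
  let G : (⟨N, hN⟩ : ChB C) ⟶ L := ObjectProperty.homMk
    { f := g', comm' := fun a b _ => (hδ₁ a b).symm }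
  let Q : (⟨N, hN⟩ : ChB C) ⟶ M' := ObjectProperty.homMk
    { f := p', comm' := fun a b _ => (hδ₂ a b).symm }
  have hw : G ≫ p = Q ≫ g := ChB.hom_ext' fun n => (hP n).w
  have key {T : ChB C} (α : T ⟶ L) (β : T ⟶ M') (w : α ≫ p = β ≫ g) :
      ∃ l : T ⟶ (⟨N, hN⟩ : ChB C), l ≫ G = α ∧ l ≫ Q = β := by
    have hwn (n : ℤ) : α.hom.f n ≫ p.hom.f n = β.hom.f n ≫ g.hom.f n :=
      congrArg (fun φ => φ.hom.f n) w
    have (n : ℤ) : ∃ l : T.obj.X n ⟶ Y n, l ≫ g' n = α.hom.f n ∧ l ≫ p' n = β.hom.f n :=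
      ⟨(hP n).lift _ _ (hwn n), (hP n).lift_fst _ _ _, (hP n).lift_snd _ _ _⟩
    choose l hl₁ hl₂ using this
    refine ⟨ObjectProperty.homMk { f := l, comm' := fun a b _ => (hP b).hom_ext ?_ ?_ },
      ChB.hom_ext' hl₁, ChB.hom_ext' hl₂⟩
    · rw [Category.assoc, Category.assoc, hl₁, ← ChB.comm, ← hl₁ a, Category.assoc, ← hδ₁ a b]
    · rw [Category.assoc, Category.assoc, hl₂, ← ChB.comm, ← hl₂ a, Category.assoc, ← hδ₂ a b]
  refine ⟨⟨N, hN⟩, G, Q, ⟨⟨hw⟩, ⟨PullbackCone.IsLimit.mk _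
    (fun s => (key _ _ s.condition).choose) (fun s => (key _ _ s.condition).choose_spec.1)
    (fun s => (key _ _ s.condition).choose_spec.2) ?_⟩⟩, hp'⟩
  intro s m h₁ h₂
  refine ChB.hom_ext' fun n => (hP n).hom_ext ?_ ?_
  · exact congrArg (fun φ => φ.hom.f n) (h₁.trans (key _ _ s.condition).choose_spec.1.symm)
  · exact congrArg (fun φ => φ.hom.f n) (h₂.trans (key _ _ s.condition).choose_spec.2.symm)

lemma degreewise_kernel (S : ShortComplex (ChB C)) (hS : degreewise E S) :
    Nonempty (IsLimit (KernelFork.ofι S.f S.zero)) := by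
  have hk (n : ℤ) := (E.kernel _ (hS n)).some
  have hm (n : ℤ) : Mono (S.f.hom.f n) := E.mono_f (hS n)
  have key {K : ChB C} (g : K ⟶ S.X₂) (w : g ≫ S.g = 0) :
      ∃ l : K ⟶ S.X₁, l ≫ S.f = g := by
    have (n : ℤ) : ∃ l : K.obj.X n ⟶ S.X₁.obj.X n, l ≫ S.f.hom.f n = g.hom.f n :=
      ⟨_, (KernelFork.IsLimit.lift' (hk n) (g.hom.f n) (degreewise.zero w n)).2⟩
    choose l hl using this
    refine ⟨ObjectProperty.homMk { f := l, comm' := fun i j _ => ?_ }, ChB.hom_ext' hl⟩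
    rw [← cancel_mono (S.f.hom.f j), Category.assoc, Category.assoc, hl, ← ChB.comm,
      ← Category.assoc, hl, ChB.comm]
  have hmono : Mono S.f := ⟨fun a b e => ChB.hom_ext' fun n => by
    rw [← cancel_mono (S.f.hom.f n)]
    exact congrArg (fun φ => φ.hom.f n) e⟩
  exact ⟨KernelFork.IsLimit.ofι _ _ (fun g w => (key g w).choose)
    (fun g w => (key g w).choose_spec)
    (fun g w m hm => by rw [← cancel_mono S.f, hm, (key g w).choose_spec])⟩

lemma degreewise_cokernel (S : ShortComplex (ChB C)) (hS : degreewise E S) :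
    Nonempty (IsColimit (CokernelCofork.ofπ S.g S.zero)) := by
  have hk (n : ℤ) := (E.cokernel _ (hS n)).some
  have he (n : ℤ) : Epi (S.g.hom.f n) := E.epi_g (hS n)
  have key {K : ChB C} (g : S.X₂ ⟶ K) (w : S.f ≫ g = 0) :
      ∃ l : S.X₃ ⟶ K, S.g ≫ l = g := by
    have (n : ℤ) : ∃ l : S.X₃.obj.X n ⟶ K.obj.X n, S.g.hom.f n ≫ l = g.hom.f n :=
      ⟨_, (CokernelCofork.IsColimit.desc' (hk n) (g.hom.f n) (degreewise.zero w n)).2⟩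
    choose l hl using this
    refine ⟨ObjectProperty.homMk { f := l, comm' := fun i j _ => ?_ }, ChB.hom_ext' hl⟩
    rw [← cancel_epi (S.g.hom.f i), ← Category.assoc, ← Category.assoc, hl, ChB.comm, ChB.comm,
      Category.assoc, hl]
  have hepi : Epi S.g := ⟨fun a b e => ChB.hom_ext' fun n => by
    rw [← cancel_epi (S.g.hom.f n)]
    exact congrArg (fun φ => φ.hom.f n) e⟩
  exact ⟨CokernelCofork.IsColimit.ofπ _ _ (fun g w => (key g w).choose)
    (fun g w => (key g w).choose_spec)
    (fun g w m hm => by rw [← cancel_epi S.g, hm, (key g w).choose_spec])⟩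

variable (E) in
/-- The exact category `Ch_b(C)`, with the degreewise exact structure. -/
def ExactStructure.chB : ExactStructure (ChB C) where
  conflation := degreewise E
  of_iso e h n := E.of_iso ((evalB n).mapShortComplex.mapIso e) (h n)
  kernel := degreewise_kernel
  cokernel := degreewise_cokernel
  id_inflation K := (inflations_degreewise_iff _).2 fun n => E.id_inflation (K.obj.X n)
  id_deflation K := (deflations_degreewise_iff _).2 fun n => E.id_deflation (K.obj.X n)
  comp_inflation f g hf hg := (inflations_degreewise_iff _).2 fun n =>
    E.comp_inflation (f.hom.f n) (g.hom.f n) ((inflations_degreewise_iff f).1 hf n)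
      ((inflations_degreewise_iff g).1 hg n)
  comp_deflation f g hf hg := (deflations_degreewise_iff _).2 fun n =>
    E.comp_deflation (f.hom.f n) (g.hom.f n) ((deflations_degreewise_iff f).1 hf n)
      ((deflations_degreewise_iff g).1 hg n)
  pushout i f hi := by
    obtain ⟨L', f', i', h, h'⟩ := exists_pushout_chb i f
      (fun n => E.pushout _ (f.hom.f n) ((inflations_degreewise_iff i).1 hi n))
    exact ⟨L', f', i', h, (inflations_degreewise_iff i').2 h'⟩
  pullback p g hp := by
    obtain ⟨L', g', p', h, h'⟩ := exists_pullback_chb p g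
      (fun n => E.pullback _ (g.hom.f n) ((deflations_degreewise_iff p).1 hp n))
    exact ⟨L', g', p', h, (deflations_degreewise_iff p').2 h'⟩

end ExactStructureOnComplexes

section VerdierQuotients

variable {T : Type u} [Category.{v} T] [HasZeroObject T] [HasShift T ℤ] [Preadditive T]
  [∀ n : ℤ, (shiftFunctor T n).Additive] [Pretriangulated T]

/-- The smallest strictly full triangulated subcategory containing `P`. -/
def triClosure (P : ObjectProperty T) : ObjectProperty T :=
  fun X => ∀ Q : ObjectProperty T, Q.IsTriangulated → Q.IsClosedUnderIsomorphisms → P ≤ Q → Q X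

instance (P : ObjectProperty T) : (triClosure P).IsClosedUnderIsomorphisms where
  of_iso e h Q hQ hQ' hP := Q.prop_of_iso e (h Q hQ hQ' hP)

instance (P : ObjectProperty T) : (triClosure P).IsTriangulated where
  exists_zero := ⟨0, isZero_zero T, fun Q _ _ _ => Q.prop_zero⟩
  isStableUnderShiftBy n := { le_shift := fun X h Q hQ hQ' hP => Q.le_shift n X (h Q hQ hQ' hP) }
  toIsTriangulatedClosed₂ := .mk' fun A hA h₁ h₃ Q hQ hQ' hP =>
    Q.ext_of_isTriangulatedClosed₂ A hA (h₁ Q hQ hQ' hP) (h₃ Q hQ hQ' hP)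

variable [IsTriangulated T] (P : ObjectProperty T)

/-- The Verdier quotient of a triangulated category by (the triangulated subcategory generated by)
a full subcategory. -/
def VerdierQuotient := (triClosure P).trW.Localization

noncomputable instance : Category (VerdierQuotient P) :=
  inferInstanceAs (Category (triClosure P).trW.Localization)

noncomputable instance : HasShift (VerdierQuotient P) ℤ :=
  inferInstanceAs (HasShift (triClosure P).trW.Localization ℤ)

noncomputable instance : Preadditive (VerdierQuotient P) :=
  inferInstanceAs (Preadditive (triClosure P).trW.Localization)

instance : HasZeroObject (VerdierQuotient P) :=
  inferInstanceAs (HasZeroObject (triClosure P).trW.Localization)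

instance (n : ℤ) : (shiftFunctor (VerdierQuotient P) n).Additive :=
  inferInstanceAs ((shiftFunctor (triClosure P).trW.Localization n).Additive)

noncomputable instance : Pretriangulated (VerdierQuotient P) :=
  inferInstanceAs (Pretriangulated (triClosure P).trW.Localization)

instance : IsTriangulated (VerdierQuotient P) :=
  inferInstanceAs (IsTriangulated (triClosure P).trW.Localization)

/-- The projection onto the Verdier quotient. -/
noncomputable def VerdierQuotient.proj : T ⥤ VerdierQuotient P := (triClosure P).trW.Q

noncomputable instance : (VerdierQuotient.proj P).CommShift ℤ :=
  inferInstanceAs ((triClosure P).trW.Q.CommShift ℤ)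

instance : (VerdierQuotient.proj P).IsTriangulated :=
  inferInstanceAs ((triClosure P).trW.Q.IsTriangulated)

instance : (VerdierQuotient.proj P).IsLocalization (triClosure P).trW :=
  inferInstanceAs ((triClosure P).trW.Q.IsLocalization (triClosure P).trW)

end VerdierQuotients

section BoundedHomotopyCategory

variable (C : Type u) [Category.{v} C] [Preadditive C]

/-- The objects of the homotopy category which are bounded complexes. -/
def boundedHo : ObjectProperty (HomotopyCategory C (ComplexShape.up ℤ)) :=
  (bounded C).strictMap (HomotopyCategory.quotient _ _)

variable {C} in
lemma boundedHo_quotient_obj_iff (K : CochainComplex C ℤ) :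
    boundedHo C ((HomotopyCategory.quotient _ _).obj K) ↔ bounded C K := by
  refine ⟨?_, fun h => ⟨_, h⟩⟩
  simp only [boundedHo, ObjectProperty.strictMap_iff]
  rintro ⟨L, h, hL⟩
  obtain rfl : L = K := congr_arg Quotient.as hL
  exact h

instance [HasZeroObject C] : (boundedHo C).ContainsZero where
  exists_zero := by
    obtain ⟨K, hK, hK'⟩ := (bounded C).exists_prop_of_containsZero
    exact ⟨(HomotopyCategory.quotient _ _).obj K, Functor.map_isZero _ hK,
      (boundedHo_quotient_obj_iff K).2 hK'⟩

instance : (boundedHo C).IsStableUnderShift ℤ where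
  isStableUnderShiftBy n :=
    { le_shift := fun X hX => by
        obtain ⟨K : CochainComplex _ _, rfl⟩ := X.quotient_obj_surjective
        rw [ObjectProperty.prop_shift_iff, HomotopyCategory.shift_quotient_obj,
          boundedHo_quotient_obj_iff]
        exact (bounded C).le_shift n K ((boundedHo_quotient_obj_iff K).1 hX) }

instance [HasZeroObject C] [HasBinaryBiproducts C] : (boundedHo C).IsTriangulatedClosed₃ where
  ext₃' T hT h₁ h₂ := by
    obtain ⟨X, Y, Z, f, g, h⟩ := T
    obtain ⟨K : CochainComplex _ _, rfl⟩ := X.quotient_obj_surjective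
    obtain ⟨L : CochainComplex _ _, rfl⟩ := Y.quotient_obj_surjective
    obtain ⟨f, rfl⟩ := (HomotopyCategory.quotient _ _).map_surjective f
    refine ⟨(HomotopyCategory.quotient _ _).obj (CochainComplex.mappingCone f), ?_,
      ⟨Triangle.π₃.mapIso (isoTriangleOfIso₁₂ _ _ hT
        (HomotopyCategory.mappingCone_triangleh_distinguished f)
        (Iso.refl _) (Iso.refl _) ?_)⟩⟩
    · rw [boundedHo_quotient_obj_iff]
      obtain ⟨a, b, h₁⟩ := (boundedHo_quotient_obj_iff K).1 h₁
      obtain ⟨a', b', h₂⟩ := (boundedHo_quotient_obj_iff L).1 h₂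
      refine ⟨min (a - 1) a', max b b', fun n hn => ?_⟩
      rw [CochainComplex.mappingCone.isZero_X_iff]
      exact ⟨h₁ _ (by grind), h₂ _ (by grind)⟩
    · exact (Category.comp_id _).trans (Category.id_comp _).symm

instance [HasZeroObject C] [HasBinaryBiproducts C] : (boundedHo C).IsTriangulated where
  toIsTriangulatedClosed₂ := .of_isTriangulatedClosed₃

/-- The bounded homotopy category `H_b(C)`. -/
abbrev Hb := (boundedHo C).FullSubcategory

/-- The projection `Ch_b(C) ⥤ H_b(C)`. -/
def toHb : ChB C ⥤ Hb C :=
  (boundedHo C).lift ((bounded C).ι ⋙ HomotopyCategory.quotient C (ComplexShape.up ℤ))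
    fun K => (boundedHo_quotient_obj_iff K.obj).2 K.property

variable {C} in
/-- The functor `H_b(C) ⥤ H_b(D)` induced by an additive functor `C ⥤ D`. -/
noncomputable def mapHb {D : Type*} [Category D] [Preadditive D] (F : C ⥤ D) [F.Additive] :
    Hb C ⥤ Hb D :=
  (boundedHo D).lift ((boundedHo C).ι ⋙ F.mapHomotopyCategory (ComplexShape.up ℤ)) (by
    rintro ⟨X, hX⟩
    obtain ⟨K : CochainComplex _ _, rfl⟩ := X.quotient_obj_surjective
    obtain ⟨a, b, h⟩ := (boundedHo_quotient_obj_iff K).1 hX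
    exact (boundedHo_quotient_obj_iff ((F.mapHomologicalComplex _).obj K)).2
      ⟨a, b, fun n hn => F.map_isZero (h n hn)⟩)

variable {C} in
noncomputable instance {D : Type*} [Category D] [Preadditive D] (F : C ⥤ D) [F.Additive] :
    (mapHb F).CommShift ℤ :=
  inferInstanceAs (((boundedHo D).lift ((boundedHo C).ι ⋙
    F.mapHomotopyCategory (ComplexShape.up ℤ)) _).CommShift ℤ)

variable {C} in
instance [HasZeroObject C] [HasBinaryBiproducts C] {D : Type*} [Category D] [Preadditive D]
    [HasZeroObject D] [HasBinaryBiproducts D] (F : C ⥤ D) [F.Additive] :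
    (mapHb F).IsTriangulated :=
  inferInstanceAs (((boundedHo D).lift ((boundedHo C).ι ⋙
    F.mapHomotopyCategory (ComplexShape.up ℤ)) _).IsTriangulated)

end BoundedHomotopyCategory

section RelativeExactCategories

variable {C : Type u} [Category.{v} C] [Preadditive C]

/-- A complex is strictly acyclic if it is spliced from admissible short exact sequences
`Z^n ↣ X^n ↠ Z^{n+1}`. -/
def StrictlyAcyclic (E : ExactStructure C) (K : CochainComplex C ℤ) : Prop :=
  ∃ (Z : ℤ → C) (i : ∀ n, Z n ⟶ K.X n) (p : ∀ n, K.X n ⟶ Z (n + 1))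
    (w : ∀ n, i n ≫ p n = 0),
    (∀ n, E.conflation (ShortComplex.mk (i n) (p n) (w n))) ∧
      ∀ n, K.d n (n + 1) = p n ≫ i (n + 1)

/-- The bounded acyclic complexes, as objects of `H_b(C)`: those which are homotopy equivalent to
a strictly acyclic complex. -/
def acyclicHb (E : ExactStructure C) : ObjectProperty (Hb C) :=
  fun X => ∃ K : CochainComplex C ℤ, StrictlyAcyclic E K ∧
    Nonempty (X.obj ≅ (HomotopyCategory.quotient C (ComplexShape.up ℤ)).obj K)

variable [HasZeroObject C] [HasBinaryBiproducts C]

/-- The bounded derived category of an exact category. -/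
abbrev DbExact (E : ExactStructure C) := VerdierQuotient (acyclicHb E)

variable (C) in
/-- A relative exact category: an exact category with a specified zero object and a class `w`
of morphisms containing the identities and closed under composition. -/
structure RelExact where
  exact : ExactStructure C
  zero : C
  isZero_zero : IsZero zero
  w : MorphismProperty C
  isMultiplicative : w.IsMultiplicative

/-- The full subcategory `C^w` of objects `x` such that `0 ⟶ x` is in `w`. -/
def RelExact.trivial (R : RelExact C) : ObjectProperty C :=
  fun X => R.w (R.isZero_zero.to_ X)

/-- A relative exact category `(C, w)` is strict if `C^w` is an additive category which has an
exact structure for which the inclusion `C^w ⥤ C` preserves and reflects admissible short exact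
sequences. -/
def RelExact.IsStrict (R : RelExact C) : Prop :=
  HasBinaryBiproducts R.trivial.FullSubcategory ∧
    ∃ F : ExactStructure R.trivial.FullSubcategory,
      ∀ S, F.conflation S ↔ R.exact.conflation (S.map R.trivial.ι)

/-- The objects in the image of `D_b(C^w) ⥤ D_b(C)`, i.e. those given by bounded complexes with
terms in `C^w`. -/
def RelExact.image (R : RelExact C) : ObjectProperty (DbExact R.exact) :=
  fun X => ∃ K : ChB C, (∀ n, R.trivial (K.obj.X n)) ∧
    Nonempty (X ≅ (toHb C ⋙ VerdierQuotient.proj (acyclicHb R.exact)).obj K)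

/-- The bounded derived category `D_b(C, w)`: the triangulated cokernel of
`D_b(C^w) ⥤ D_b(C)`, i.e. the Verdier quotient of `D_b(C)` by the triangulated subcategory
generated by the image of this functor. -/
abbrev RelExact.Db (R : RelExact C) := VerdierQuotient R.image

/-- The projection `H_b(C) ⥤ D_b(C, w)`. -/
noncomputable def RelExact.projHb (R : RelExact C) : Hb C ⥤ R.Db :=
  VerdierQuotient.proj (acyclicHb R.exact) ⋙ VerdierQuotient.proj R.image

noncomputable instance (R : RelExact C) : R.projHb.CommShift ℤ :=
  inferInstanceAs ((VerdierQuotient.proj (acyclicHb R.exact) ⋙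
    VerdierQuotient.proj R.image).CommShift ℤ)

instance (R : RelExact C) : R.projHb.IsTriangulated :=
  inferInstanceAs ((VerdierQuotient.proj (acyclicHb R.exact) ⋙
    VerdierQuotient.proj R.image).IsTriangulated)

/-- The projection `Ch_b(C) ⥤ D_b(C, w)`. -/
noncomputable def RelExact.proj (R : RelExact C) : ChB C ⥤ R.Db := toHb C ⋙ R.projHb

/-- The quasi-weak equivalences: the morphisms of bounded complexes which become isomorphisms
in `D_b(C, w)`. -/
def RelExact.qw (R : RelExact C) : MorphismProperty (ChB C) :=
  (MorphismProperty.isomorphisms R.Db).inverseImage R.proj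

/-- The relative exact category `Ch_b(C, w) = (Ch_b(C), qw)`. -/
noncomputable def RelExact.chB (R : RelExact C) : RelExact (ChB C) where
  exact := R.exact.chB
  zero := 0
  isZero_zero := Limits.isZero_zero _
  w := R.qw
  isMultiplicative := by
    unfold RelExact.qw
    infer_instance

/-- The functor `j : C ⥤ Ch_b(C)` which sends an object to the complex concentrated in
degree `0`. -/
noncomputable def singleB : C ⥤ ChB C :=
  (bounded C).lift (HomologicalComplex.single C (ComplexShape.up ℤ) 0) fun X =>
    ⟨0, 0, fun n hn => HomologicalComplex.isZero_single_obj_X _ _ _ _ (by omega)⟩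

instance : (singleB (C := C)).Additive where
  map_add {X Y f g} := by
    ext : 1
    exact (HomologicalComplex.single C (ComplexShape.up ℤ) 0).map_add

end RelativeExactCategories

section TriangleData

/-- A suspension functor together with a class of exact triangles. -/
structure TriangleData (T : Type u) [Category.{v} T] where
  susp : T ⥤ T
  exact : ∀ {x y z : T}, (x ⟶ y) → (y ⟶ z) → (z ⟶ susp.obj x) → Prop

/-- The suspension functor and the exact triangles of a triangulated category. -/
def TriangleData.ofPretriangulated (T : Type u) [Category.{v} T] [HasZeroObject T] [HasShift T ℤ]
    [Preadditive T] [∀ n : ℤ, (shiftFunctor T n).Additive] [Pretriangulated T] :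
    TriangleData T where
  susp := shiftFunctor T (1 : ℤ)
  exact u v w := Triangle.mk u v w ∈ distTriang T

/-- `F` is an equivalence of categories which underlies a triangle functor: there is a natural
isomorphism `α : FΣ ≅ Σ'F` such that a triangle is exact if and only if its image under `(F, α)`
is exact. -/
def IsTriangleEquivalence {T : Type*} [Category T] {T' : Type*} [Category T']
    (D : TriangleData T) (D' : TriangleData T') (F : T ⥤ T') : Prop :=
  F.IsEquivalence ∧ ∃ α : D.susp ⋙ F ≅ F ⋙ D'.susp,
    ∀ {x y z : T} (f : x ⟶ y) (g : y ⟶ z) (h : z ⟶ D.susp.obj x),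
      D.exact f g h ↔ D'.exact (F.map f) (F.map g) (F.map h ≫ α.hom.app x)

variable {T : Type u} [Category.{v} T] (D : TriangleData T)

/-- A strictly full triangulated subcategory. -/
structure TriangleData.IsTriangulatedSubcategory (Q : ObjectProperty T) : Prop where
  of_iso : ∀ {x y : T}, (x ≅ y) → Q x → Q y
  susp_iff : ∀ x : T, Q (D.susp.obj x) ↔ Q x
  cone : ∀ {x y z : T} (f : x ⟶ y) (g : y ⟶ z) (h : z ⟶ D.susp.obj x),
    D.exact f g h → Q x → Q y → Q z

/-- The smallest strictly full triangulated subcategory containing `N`. -/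
def TriangleData.closure (N : ObjectProperty T) : ObjectProperty T :=
  fun x => ∀ Q : ObjectProperty T, D.IsTriangulatedSubcategory Q → N ≤ Q → Q x

/-- The class of morphisms whose cone belongs to the triangulated subcategory generated by `N`. -/
def TriangleData.verdierW (N : ObjectProperty T) : MorphismProperty T :=
  fun x _ f => ∃ (z : T) (g : _ ⟶ z) (h : z ⟶ D.susp.obj x), D.exact f g h ∧ D.closure N z

/-- The suspension of a morphism with cone `z` has cone `Σz`. -/
def TriangleData.SuspCompat : Prop :=
  ∀ {x y z : T} (f : x ⟶ y) (g : y ⟶ z) (h : z ⟶ D.susp.obj x), D.exact f g h →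
    ∃ h' : D.susp.obj z ⟶ D.susp.obj (D.susp.obj x), D.exact (D.susp.map f) (D.susp.map g) h'

variable {D} in
lemma TriangleData.SuspCompat.isInvertedBy (hD : D.SuspCompat) (N : ObjectProperty T) :
    (D.verdierW N).IsInvertedBy (D.susp ⋙ (D.verdierW N).Q) := by
  rintro x y f ⟨z, g, h, hf, hz⟩
  obtain ⟨h', hf'⟩ := hD f g h hf
  exact Localization.inverts (D.verdierW N).Q (D.verdierW N) _
    ⟨_, _, _, hf', fun Q hQ hN => (hQ.susp_iff z).2 (hz Q hQ hN)⟩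

variable {D} in
/-- The suspension functor of the Verdier quotient. -/
noncomputable def TriangleData.quotientSusp (hD : D.SuspCompat) (N : ObjectProperty T) :
    (D.verdierW N).Localization ⥤ (D.verdierW N).Localization :=
  Localization.lift (D.susp ⋙ (D.verdierW N).Q) (hD.isInvertedBy N) (D.verdierW N).Q

variable {D} in
/-- The projection to the Verdier quotient commutes with the suspensions. -/
noncomputable def TriangleData.quotientSuspIso (hD : D.SuspCompat) (N : ObjectProperty T) :
    (D.verdierW N).Q ⋙ D.quotientSusp hD N ≅ D.susp ⋙ (D.verdierW N).Q :=
  Localization.fac _ (hD.isInvertedBy N) (D.verdierW N).Q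

variable {D} in
/-- The suspension and the exact triangles of the Verdier quotient by the triangulated subcategory
generated by `N`: a triangle is exact if it is isomorphic to the image of an exact triangle. -/
noncomputable def TriangleData.quotient (hD : D.SuspCompat) (N : ObjectProperty T) :
    TriangleData (D.verdierW N).Localization where
  susp := D.quotientSusp hD N
  exact {x y z} u v w := ∃ (x' y' z' : T) (f : x' ⟶ y') (g : y' ⟶ z') (h : z' ⟶ D.susp.obj x')
    (a : x ≅ (D.verdierW N).Q.obj x') (b : y ≅ (D.verdierW N).Q.obj y')
    (c : z ≅ (D.verdierW N).Q.obj z'),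
    D.exact f g h ∧ u ≫ b.hom = a.hom ≫ (D.verdierW N).Q.map f ∧
      v ≫ c.hom = b.hom ≫ (D.verdierW N).Q.map g ∧
      w ≫ (D.quotientSusp hD N).map a.hom =
        c.hom ≫ (D.verdierW N).Q.map h ≫ (D.quotientSuspIso hD N).inv.app x'

end TriangleData

section BicomplicialCategories

variable {A : Type u} [Category.{v} A] [Preadditive A]

/-- A bicomplicial structure on an exact category: an exact endofunctor `C` with natural
transformations `ι : id ⟶ C`, `r : CC ⟶ C` and `σ : CC ≅ CC` such that
`r C(ι) = r ι_C = id`, `σ C(ι) = ι_C`, `σσ = id`, such that each `ι_x : x ⟶ C x` is an admissible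
monomorphism, and such that the quotient functor `T = C / id` is an equivalence. -/
structure Bicomplicial (E : ExactStructure A) where
  C : A ⥤ A
  additive : C.Additive
  map_conflation : ∀ S : ShortComplex A, E.conflation S → E.conflation (S.map C)
  ι : 𝟭 A ⟶ C
  r : C ⋙ C ⟶ C
  σ : C ⋙ C ≅ C ⋙ C
  map_ι_r : ∀ x : A, C.map (ι.app x) ≫ r.app x = 𝟙 (C.obj x)
  ι_r : ∀ x : A, ι.app (C.obj x) ≫ r.app x = 𝟙 (C.obj x)
  map_ι_σ : ∀ x : A, C.map (ι.app x) ≫ σ.hom.app x = ι.app (C.obj x)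
  σ_σ : ∀ x : A, σ.hom.app x ≫ σ.hom.app x = 𝟙 (C.obj (C.obj x))
  T : A ⥤ A
  π : C ⟶ T
  ι_π : ∀ x : A, ι.app x ≫ π.app x = 0
  conflation_ι_π : ∀ x : A, E.conflation (ShortComplex.mk (ι.app x) (π.app x) (ι_π x))
  isEquivalence : T.IsEquivalence

namespace Bicomplicial

attribute [instance] Bicomplicial.additive Bicomplicial.isEquivalence

variable {E : ExactStructure A} (B : Bicomplicial E)

/-- `C`-homotopic morphisms. -/
def homotopic : HomRel A :=
  fun x _ f g => ∃ H : B.C.obj x ⟶ _, f - g = B.ι.app x ≫ H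

/-- `C`-homotopy equivalences. -/
def IsHomotopyEquiv {x y : A} (f : x ⟶ y) : Prop :=
  ∃ g : y ⟶ x, B.homotopic (f ≫ g) (𝟙 x) ∧ B.homotopic (g ≫ f) (𝟙 y)

/-- The homotopy category `π₀` of a bicomplicial category. -/
abbrev Ho := CategoryTheory.Quotient B.homotopic

/-- The projection to the homotopy category. -/
abbrev toHo : A ⥤ B.Ho := CategoryTheory.Quotient.functor B.homotopic

lemma epi_π (x : A) : Epi (B.π.app x) := E.epi_g (B.conflation_ι_π x)

lemma ι_σ (x : A) : B.ι.app (B.C.obj x) ≫ B.σ.hom.app x = B.C.map (B.ι.app x) := by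
  have h := congrArg (· ≫ B.σ.hom.app x) (B.map_ι_σ x)
  exact h.symm.trans ((Category.assoc _ _ _).trans
    ((congrArg (B.C.map (B.ι.app x) ≫ ·) (B.σ_σ x)).trans (Category.comp_id _)))

lemma σ_σ_comp {x y : A} (f : B.C.obj (B.C.obj x) ⟶ y) :
    B.σ.hom.app x ≫ B.σ.hom.app x ≫ f = f :=
  (Category.assoc _ _ _).symm.trans
    ((congrArg (· ≫ f) (B.σ_σ x)).trans (Category.id_comp _))

lemma exists_θ (x : A) : ∃ θ : B.C.obj (B.T.obj x) ⟶ B.T.obj (B.C.obj x),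
    B.C.map (B.π.app x) ≫ θ = B.σ.hom.app x ≫ B.π.app (B.C.obj x) := by
  have h : B.C.map (B.ι.app x) ≫ B.σ.hom.app x ≫ B.π.app (B.C.obj x) = 0 :=
    (Category.assoc _ _ _).symm.trans
      ((congrArg (· ≫ B.π.app (B.C.obj x)) (B.map_ι_σ x)).trans (B.ι_π (B.C.obj x)))
  exact ⟨_, (CokernelCofork.IsColimit.desc' (E.cokernel _
    (B.map_conflation _ (B.conflation_ι_π x))).some _ h).2⟩

lemma ι_θ {x : A} {θ : B.C.obj (B.T.obj x) ⟶ B.T.obj (B.C.obj x)}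
    (hθ : B.C.map (B.π.app x) ≫ θ = B.σ.hom.app x ≫ B.π.app (B.C.obj x)) :
    B.ι.app (B.T.obj x) ≫ θ = B.T.map (B.ι.app x) := by
  have := B.epi_π x
  have h₁ : B.π.app x ≫ B.ι.app (B.T.obj x) = B.ι.app (B.C.obj x) ≫ B.C.map (B.π.app x) :=
    B.ι.naturality (B.π.app x)
  have h₂ : B.C.map (B.ι.app x) ≫ B.π.app (B.C.obj x) = B.π.app x ≫ B.T.map (B.ι.app x) :=
    B.π.naturality (B.ι.app x)
  have h₃ : B.ι.app (B.C.obj x) ≫ B.σ.hom.app x ≫ B.π.app (B.C.obj x) =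
      B.C.map (B.ι.app x) ≫ B.π.app (B.C.obj x) :=
    (Category.assoc _ _ _).symm.trans (congrArg (· ≫ B.π.app (B.C.obj x)) (B.ι_σ x))
  rw [← cancel_epi (B.π.app x), ← Category.assoc, h₁, Category.assoc, hθ, ← h₂, h₃]

lemma isIso_θ {x : A} {θ : B.C.obj (B.T.obj x) ⟶ B.T.obj (B.C.obj x)}
    (hθ : B.C.map (B.π.app x) ≫ θ = B.σ.hom.app x ≫ B.π.app (B.C.obj x)) : IsIso θ := by
  have := B.epi_π (B.C.obj x)
  have : Epi (B.C.map (B.π.app x)) := E.epi_g (B.map_conflation _ (B.conflation_ι_π x))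
  have h : B.ι.app (B.C.obj x) ≫ B.σ.hom.app x ≫ B.C.map (B.π.app x) = 0 := by
    refine (Category.assoc _ _ _).symm.trans
      ((congrArg (· ≫ B.C.map (B.π.app x)) (B.ι_σ x)).trans ?_)
    rw [← B.C.map_comp, B.ι_π, B.C.map_zero]
  obtain ⟨η, hη⟩ : ∃ η : B.T.obj (B.C.obj x) ⟶ B.C.obj (B.T.obj x),
      B.π.app (B.C.obj x) ≫ η = B.σ.hom.app x ≫ B.C.map (B.π.app x) :=
    ⟨_, (CokernelCofork.IsColimit.desc' (E.cokernel _
      (B.conflation_ι_π (B.C.obj x))).some _ h).2⟩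
  refine ⟨η, ?_, ?_⟩
  · rw [← cancel_epi (B.C.map (B.π.app x)), ← Category.assoc, hθ, Category.comp_id]
    exact (Category.assoc _ _ _).trans
      ((congrArg (B.σ.hom.app x ≫ ·) hη).trans (B.σ_σ_comp _))
  · rw [← cancel_epi (B.π.app (B.C.obj x)), ← Category.assoc, hη, Category.comp_id]
    exact (Category.assoc _ _ _).trans
      ((congrArg (B.σ.hom.app x ≫ ·) hθ).trans (B.σ_σ_comp _))

lemma map_T_sub {x y : A} (f g : x ⟶ y) : B.T.map (f - g) = B.T.map f - B.T.map g := by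
  have := B.epi_π x
  rw [← cancel_epi (B.π.app x), Preadditive.comp_sub, ← B.π.naturality, ← B.π.naturality,
    ← B.π.naturality, B.C.map_sub, Preadditive.sub_comp]

lemma homotopic_map_T {x y : A} {f g : x ⟶ y} (h : B.homotopic f g) :
    B.homotopic (B.T.map f) (B.T.map g) := by
  obtain ⟨H, hH⟩ := h
  obtain ⟨θ, hθ⟩ := B.exists_θ x
  refine ⟨θ ≫ B.T.map H, ?_⟩
  rw [← B.map_T_sub, hH, ← Category.assoc, B.ι_θ hθ, B.T.map_comp]

/-- The suspension functor of the homotopy category. -/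
def suspHo : B.Ho ⥤ B.Ho :=
  CategoryTheory.Quotient.lift B.homotopic (B.T ⋙ B.toHo) fun _ _ _ _ h =>
    CategoryTheory.Quotient.sound B.homotopic (B.homotopic_map_T h)

/-- The mapping cone sequence `x ⟶ y ⟶ Cone f ⟶ T x` of a morphism `f`, where `Cone f` is a
pushout of `f` and `ι : x ⟶ C x`. -/
def IsConeSequence {x y z : A} (f : x ⟶ y) (κ : y ⟶ z) (ψ : z ⟶ B.T.obj x) : Prop :=
  ∃ μ : B.C.obj x ⟶ z, IsPushout f (B.ι.app x) κ μ ∧ κ ≫ ψ = 0 ∧ μ ≫ ψ = B.π.app x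

/-- The suspension functor and the exact triangles of the homotopy category: a triangle is exact if
it is isomorphic to the image of a mapping cone sequence. -/
def triangleData : TriangleData B.Ho where
  susp := B.suspHo
  exact {x y z} u v w := ∃ (x' y' z' : A) (f : x' ⟶ y') (κ : y' ⟶ z') (ψ : z' ⟶ B.T.obj x')
    (a : x ≅ B.toHo.obj x') (b : y ≅ B.toHo.obj y') (c : z ≅ B.toHo.obj z'),
    B.IsConeSequence f κ ψ ∧ u ≫ b.hom = a.hom ≫ B.toHo.map f ∧
      v ≫ c.hom = b.hom ≫ B.toHo.map κ ∧ w ≫ B.suspHo.map a.hom = c.hom ≫ B.toHo.map ψ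

lemma IsConeSequence.map_T {x y z : A} {f : x ⟶ y} {κ : y ⟶ z} {ψ : z ⟶ B.T.obj x}
    (h : B.IsConeSequence f κ ψ) :
    ∃ ψ', B.IsConeSequence (B.T.map f) (B.T.map κ) ψ' := by
  obtain ⟨μ, hμ, -, -⟩ := h
  obtain ⟨θ, hθ⟩ := B.exists_θ x
  have := B.isIso_θ hθ
  have hp : IsPushout (B.T.map f) (B.ι.app (B.T.obj x)) (B.T.map κ) (θ ≫ B.T.map μ) :=
    IsPushout.of_iso (hμ.map B.T) (Iso.refl _) (Iso.refl _) (asIso θ).symm (Iso.refl _)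
      (by simp) (by simp [← B.ι_θ hθ]) (by simp) (by simp)
  exact ⟨hp.desc 0 (B.π.app (B.T.obj x)) (by rw [B.ι_π, comp_zero]), _, hp,
    hp.inl_desc _ _ _, hp.inr_desc _ _ _⟩

lemma comp_map_map_inv_hom {T : Type*} [Category T] (S : T ⥤ T) {x x' y z : T} (a : x ≅ x')
    (p : y ⟶ z) (q : z ⟶ S.obj (S.obj x')) :
    (p ≫ q ≫ S.map (S.map a.inv)) ≫ S.map (S.map a.hom) = p ≫ q := by
  rw [Category.assoc, Category.assoc, ← S.map_comp, ← S.map_comp, Iso.inv_hom_id, S.map_id,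
    S.map_id, Category.comp_id]

lemma suspCompat : B.triangleData.SuspCompat := by
  rintro x y z u v w ⟨x', y', z', f, κ, ψ, a, b, c, h, hu, hv, -⟩
  obtain ⟨ψ', h'⟩ := h.map_T
  refine ⟨B.suspHo.map c.hom ≫ B.toHo.map ψ' ≫ B.suspHo.map (B.suspHo.map a.inv),
    B.T.obj x', B.T.obj y', B.T.obj z', _, _, ψ', B.suspHo.mapIso a, B.suspHo.mapIso b,
    B.suspHo.mapIso c, h', ?_, ?_, ?_⟩
  · exact (B.suspHo.map_comp _ _).symm.trans
      ((congrArg B.suspHo.map hu).trans (B.suspHo.map_comp _ _))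
  · exact (B.suspHo.map_comp _ _).symm.trans
      ((congrArg B.suspHo.map hv).trans (B.suspHo.map_comp _ _))
  · exact comp_map_map_inv_hom B.suspHo a (B.suspHo.map c.hom) (B.toHo.map ψ')

end Bicomplicial

variable [HasZeroObject A] [HasBinaryBiproducts A]

/-- A bicomplicial pair: `w` is a class of complicial weak equivalences, i.e. it satisfies the
saturation axiom (two out of three) and the extension axiom, and it contains the `C`-homotopy
equivalences. -/
structure RelExact.IsBicomplicialPair (R : RelExact A) (B : Bicomplicial R.exact) : Prop where
  saturated : R.w.HasTwoOutOfThreeProperty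
  extensional : ∀ {S S' : ShortComplex A} (φ : S ⟶ S'), R.exact.conflation S →
    R.exact.conflation S' → R.w φ.τ₁ → R.w φ.τ₃ → R.w φ.τ₂
  of_homotopyEquiv : ∀ {x y : A} (f : x ⟶ y), B.IsHomotopyEquiv f → R.w f

/-- The retraction axiom: `w` is closed under retracts in the category of morphisms. -/
def RelExact.IsThick (R : RelExact A) : Prop := R.w.IsStableUnderRetracts

/-- The full subcategory `π₀(A^w)` of `π₀(A)`. -/
def RelExact.trivialHo (R : RelExact A) (B : Bicomplicial R.exact) : ObjectProperty B.Ho :=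
  fun X => R.trivial X.as

/-- The Verdier quotient `𝒯(A, w) = π₀(A) / π₀(A^w)`. -/
abbrev RelExact.T (R : RelExact A) (B : Bicomplicial R.exact) :=
  (B.triangleData.verdierW (R.trivialHo B)).Localization

/-- The suspension functor and the exact triangles of `𝒯(A, w)`. -/
noncomputable def RelExact.triangleDataT (R : RelExact A) (B : Bicomplicial R.exact) :
    TriangleData (R.T B) :=
  TriangleData.quotient B.suspCompat (R.trivialHo B)

/-- The projection `A ⥤ 𝒯(A, w)`. -/
noncomputable def RelExact.projT (R : RelExact A) (B : Bicomplicial R.exact) : A ⥤ R.T B :=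
  B.toHo ⋙ (B.triangleData.verdierW (R.trivialHo B)).Q

end BicomplicialCategories

section ConeOfComplexes

variable {C : Type u} [Category.{v} C] [Preadditive C]

/-- The morphism `K^n ⟶ K^m` which is the identity if `n = m`, and zero otherwise. -/
noncomputable def idOrZero (K : CochainComplex C ℤ) (n m : ℤ) : K.X n ⟶ K.X m :=
  if h : n = m then (K.XIsoOfEq h).hom else 0

lemma idOrZero_self (K : CochainComplex C ℤ) (n : ℤ) : idOrZero K n n = 𝟙 _ := by
  simp [idOrZero]

lemma idOrZero_of_ne (K : CochainComplex C ℤ) {n m : ℤ} (h : n ≠ m) : idOrZero K n m = 0 :=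
  dif_neg h

lemma idOrZero_comm {K L : CochainComplex C ℤ} (f : K ⟶ L) (n m : ℤ) :
    f.f n ≫ idOrZero L n m = idOrZero K n m ≫ f.f m := by
  by_cases h : n = m
  · subst h
    rw [idOrZero_self, idOrZero_self, Category.comp_id, Category.id_comp]
  · rw [idOrZero_of_ne _ h, idOrZero_of_ne _ h, comp_zero, zero_comp]

variable [HasBinaryBiproducts C]

/-- The morphism `(a, b) ↦ (f a, s a + g b)`. -/
noncomputable abbrev triMap {X Y X' Y' : C} (f : X ⟶ X') (s : X ⟶ Y') (g : Y ⟶ Y') :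
    X ⊞ Y ⟶ X' ⊞ Y' :=
  biprod.desc (biprod.lift f s) (biprod.lift 0 g)

/-- The morphism `((a, b), (c, e)) ↦ (b + c, e)`. -/
noncomputable def rMap (X Y Z : C) : (X ⊞ Y) ⊞ (Y ⊞ Z) ⟶ Y ⊞ Z :=
  biprod.desc (biprod.desc 0 biprod.inl) (𝟙 _)

/-- The morphism `((a, b), (c, e)) ↦ ((-a, c), (b, e))`. -/
noncomputable def σMap (X Y Z : C) : (X ⊞ Y) ⊞ (Y ⊞ Z) ⟶ (X ⊞ Y) ⊞ (Y ⊞ Z) :=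
  biprod.desc (biprod.desc (-(biprod.inl ≫ biprod.inl)) (biprod.inl ≫ biprod.inr))
    (biprod.desc (biprod.inr ≫ biprod.inl) (biprod.inr ≫ biprod.inr))

lemma rMap_triMap {X Y Z W : C} (f : X ⟶ W) (g : Y ⟶ X) (h : Z ⟶ Y) :
    rMap X Y Z ≫ triMap (-g) (-𝟙 Y) h =
      triMap (-triMap (-f) (-𝟙 X) g) (-𝟙 (X ⊞ Y)) (triMap (-g) (-𝟙 Y) h) ≫ rMap W X Y := by
  dsimp only [rMap]
  ext <;> simp

lemma σMap_triMap {X Y Z W : C} (f : X ⟶ W) (g : Y ⟶ X) (h : Z ⟶ Y) :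
    σMap X Y Z ≫ triMap (-triMap (-f) (-𝟙 X) g) (-𝟙 (X ⊞ Y)) (triMap (-g) (-𝟙 Y) h) =
      triMap (-triMap (-f) (-𝟙 X) g) (-𝟙 (X ⊞ Y)) (triMap (-g) (-𝟙 Y) h) ≫ σMap W X Y := by
  dsimp only [σMap]
  ext <;> simp

lemma rMap_map {X Y Z X' Y' Z' : C} (f : X ⟶ X') (g : Y ⟶ Y') (h : Z ⟶ Z') :
    biprod.map (biprod.map f g) (biprod.map g h) ≫ rMap X' Y' Z' =
      rMap X Y Z ≫ biprod.map g h := by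
  dsimp only [rMap]
  ext <;> simp

lemma σMap_map {X Y Z X' Y' Z' : C} (f : X ⟶ X') (g : Y ⟶ Y') (h : Z ⟶ Z') :
    biprod.map (biprod.map f g) (biprod.map g h) ≫ σMap X' Y' Z' =
      σMap X Y Z ≫ biprod.map (biprod.map f g) (biprod.map g h) := by
  dsimp only [σMap]
  ext <;> simp

lemma σMap_σMap (X Y Z : C) : σMap X Y Z ≫ σMap X Y Z = 𝟙 _ := by
  dsimp only [σMap]
  ext <;> simp

lemma map_inr_rMap (X Y Z : C) :
    biprod.map biprod.inr biprod.inr ≫ rMap X Y Z = 𝟙 _ := by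
  dsimp only [rMap]
  ext <;> simp

lemma inr_rMap (X Y Z : C) : biprod.inr ≫ rMap X Y Z = 𝟙 _ := by
  dsimp only [rMap]
  ext <;> simp

lemma map_inr_σMap (X Y Z : C) :
    biprod.map biprod.inr biprod.inr ≫ σMap X Y Z = biprod.inr := by
  dsimp only [σMap]
  ext <;> simp

lemma inr_triMap {X Y X' Y' : C} (f : X ⟶ X') (s : X ⟶ Y') (g : Y ⟶ Y') :
    biprod.inr ≫ triMap f s g = g ≫ biprod.inr := by
  ext <;> simp

lemma triMap_fst {X Y X' Y' : C} (f : X ⟶ X') (s : X ⟶ Y') (g : Y ⟶ Y') :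
    triMap f s g ≫ biprod.fst = biprod.fst ≫ f := by
  ext <;> simp

lemma biprod_map_id (X Y : C) : biprod.map (𝟙 X) (𝟙 Y) = 𝟙 _ := by
  ext <;> simp

lemma biprod_map_comp {X Y X' Y' X'' Y'' : C} (f : X ⟶ X') (g : Y ⟶ Y') (f' : X' ⟶ X'')
    (g' : Y' ⟶ Y'') :
    biprod.map (f ≫ f') (g ≫ g') = biprod.map f g ≫ biprod.map f' g' := by
  ext <;> simp

/-- The cone of a complex: `(CK)^n = K^{n+1} ⊞ K^n`, with differential
`(a, b) ↦ (-d a, -a + d b)`. -/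
noncomputable def cone (K : CochainComplex C ℤ) : CochainComplex C ℤ where
  X n := K.X (n + 1) ⊞ K.X n
  d n m := triMap (-K.d (n + 1) (m + 1)) (-idOrZero K (n + 1) m) (K.d n m)
  shape n m h := by
    have h' : n + 1 ≠ m := h
    have h'' : ¬ (ComplexShape.up ℤ).Rel (n + 1) (m + 1) := fun e => h' (by
      have : n + 1 + 1 = m + 1 := e
      omega)
    rw [K.shape _ _ h, K.shape _ _ h'', idOrZero_of_ne _ h']
    ext <;> simp
  d_comp_d' n m k h h' := by
    obtain rfl : n + 1 = m := h
    obtain rfl : n + 1 + 1 = k := h'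
    rw [idOrZero_self, idOrZero_self]
    ext <;> simp

/-- The cone of a morphism of complexes. -/
noncomputable def coneMap {K L : CochainComplex C ℤ} (f : K ⟶ L) : cone K ⟶ cone L where
  f n := biprod.map (f.f (n + 1)) (f.f n)
  comm' n m _ := by
    have := idOrZero_comm f (n + 1) m
    dsimp only [cone]
    ext <;> simp [this]

lemma bounded_cone {K : CochainComplex C ℤ} (h : bounded C K) : bounded C (cone K) := by
  obtain ⟨a, b, h⟩ := h
  refine ⟨a - 1, b, fun n hn => ?_⟩
  rw [IsZero.iff_id_eq_zero]
  refine biprod.hom_ext' _ _ ?_ ?_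
  · exact (h (n + 1) (by omega)).eq_of_src _ _
  · exact (h n (by omega)).eq_of_src _ _

namespace ExactStructure

variable (E : ExactStructure C)

lemma inflation_inr [HasZeroObject C] (X Y : C) :
    inflations E.conflation (biprod.inr : Y ⟶ X ⊞ Y) := by
  obtain ⟨Z, f, w, h⟩ := E.id_deflation X
  have hf : f = 0 := by simpa using w
  subst hf
  have := E.mono_f h
  have hZ : IsZero Z := by
    rw [IsZero.iff_id_eq_zero, ← cancel_mono (0 : Z ⟶ X)]
    simp
  refine inflation_of_isPushout (f := 0) (f' := biprod.inl) ⟨_, _, _, h⟩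
    (IsPushout.of_iso (IsPushout.of_has_biproduct X Y) (isZero_zero C |>.iso hZ)
      (Iso.refl _) (Iso.refl _) (Iso.refl _) ?_ ?_ ?_ ?_)
  all_goals simp

lemma conflation_inr_fst [HasZeroObject C] (X Y : C) :
    E.conflation (ShortComplex.mk (biprod.inr : Y ⟶ X ⊞ Y) biprod.fst biprod.inr_fst) :=
  conflation_of_isColimit (E.inflation_inr X Y) _
    ⟨CokernelCofork.IsColimit.ofπ _ _ (fun k _ => biprod.inl ≫ k)
      (fun k hk => by ext <;> simp [hk]) (fun k _ m hm => by simp [← hm])⟩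

variable {E} in
lemma conflation_biprod_map {X Y Z X' Y' Z' : C} {f : X ⟶ Y} {g : Y ⟶ Z} {w : f ≫ g = 0}
    {f' : X' ⟶ Y'} {g' : Y' ⟶ Z'} {w' : f' ≫ g' = 0}
    (h : E.conflation (ShortComplex.mk f g w)) (h' : E.conflation (ShortComplex.mk f' g' w')) :
    E.conflation (ShortComplex.mk (biprod.map f f') (biprod.map g g')
      (by rw [← biprod_map_comp, w, w']; ext <;> simp)) := by
  refine conflation_of_isColimit ?_ _ ?_
  · have h₁ : IsPushout f biprod.inl biprod.inl (biprod.map f (𝟙 X')) :=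
      ⟨⟨by simp⟩, ⟨PushoutCocone.IsColimit.mk _ (fun s => biprod.desc s.inl (biprod.inr ≫ s.inr))
        (fun s => by simp) (fun s => by ext <;> simp [s.condition])
        (fun s m hm₁ hm₂ => by ext <;> simp [← hm₁, ← hm₂])⟩⟩
    have h₂ : IsPushout f' biprod.inr biprod.inr (biprod.map (𝟙 Y) f') :=
      ⟨⟨by simp⟩, ⟨PushoutCocone.IsColimit.mk _ (fun s => biprod.desc (biprod.inl ≫ s.inr) s.inl)
        (fun s => by simp) (fun s => by ext <;> simp [s.condition])
        (fun s m hm₁ hm₂ => by ext <;> simp [← hm₁, ← hm₂])⟩⟩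
    have h₃ := E.comp_inflation _ _ (inflation_of_isPushout ⟨_, _, _, h⟩ h₁)
      (inflation_of_isPushout ⟨_, _, _, h'⟩ h₂)
    rwa [← biprod_map_comp, Category.comp_id, Category.id_comp] at h₃
  · have hg := (E.cokernel _ h).some
    have hg' := (E.cokernel _ h').some
    have := E.epi_g h
    have := E.epi_g h'
    have key {T : C} (k : Y ⊞ Y' ⟶ T) (hk : biprod.map f f' ≫ k = 0) :
        ∃ l : Z ⊞ Z' ⟶ T, biprod.map g g' ≫ l = k := by
      obtain ⟨a, ha⟩ := CokernelCofork.IsColimit.desc' hg (biprod.inl ≫ k)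
        (by simpa using congrArg (biprod.inl ≫ ·) hk)
      obtain ⟨b, hb⟩ := CokernelCofork.IsColimit.desc' hg' (biprod.inr ≫ k)
        (by simpa using congrArg (biprod.inr ≫ ·) hk)
      exact ⟨biprod.desc a b, biprod.hom_ext' _ _ (by simpa using ha) (by simpa using hb)⟩
    have : Epi (biprod.map g g') := inferInstance
    exact ⟨CokernelCofork.IsColimit.ofπ _ _ (fun k hk => (key k hk).choose)
      (fun k hk => (key k hk).choose_spec)
      (fun k hk m hm => by rw [← cancel_epi (biprod.map g g'), hm, (key k hk).choose_spec])⟩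

end ExactStructure

variable (C) in
/-- The cone functor of `Ch_b(C)`. -/
noncomputable def coneB : ChB C ⥤ ChB C where
  obj K := ⟨cone K.obj, bounded_cone K.property⟩
  map f := ObjectProperty.homMk (coneMap f.hom)
  map_id _ := ChB.hom_ext' fun _ => biprod_map_id _ _
  map_comp _ _ := ChB.hom_ext' fun _ => biprod_map_comp _ _ _ _

/-- The suspension `(TK)^n = K^{n+1}`, with differential `-d`, on `Ch_b(C)`. -/
noncomputable def suspB : ChB C ⥤ ChB C :=
  (bounded C).lift ((bounded C).ι ⋙ shiftFunctor (CochainComplex C ℤ) (1 : ℤ))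
    fun K => (bounded C).le_shift (1 : ℤ) _ K.property

/-- The natural transformation `ι : K ⟶ CK`, `b ↦ (0, b)`. -/
noncomputable def coneι : 𝟭 (ChB C) ⟶ coneB C where
  app K := ObjectProperty.homMk
    { f := fun n => (biprod.inr : K.obj.X n ⟶ K.obj.X (n + 1) ⊞ K.obj.X n)
      comm' := fun n m _ => by
        exact inr_triMap _ _ _ }
  naturality K L f := ChB.hom_ext' fun n => (biprod.inr_map _ _).symm

/-- The natural transformation `π : CK ⟶ TK`, `(a, b) ↦ a`. -/
noncomputable def coneπ : coneB C ⟶ suspB where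
  app K := ObjectProperty.homMk
    { f := fun n => (biprod.fst : K.obj.X (n + 1) ⊞ K.obj.X n ⟶ K.obj.X (n + 1))
      comm' := fun n m _ => by
        refine Eq.trans ?_ (triMap_fst _ _ _).symm
        exact congrArg (biprod.fst ≫ ·)
          ((CochainComplex.shiftFunctor_obj_d' K.obj 1 n m).trans (by simp)) }
  naturality K L f := ChB.hom_ext' fun n => biprod.map_fst _ _

/-- The natural transformation `r : CCK ⟶ CK`, `((a, b), (c, e)) ↦ (b + c, e)`. -/
noncomputable def coner : coneB C ⋙ coneB C ⟶ coneB C where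
  app K := ObjectProperty.homMk
    { f := fun n => rMap (K.obj.X (n + 1 + 1)) (K.obj.X (n + 1)) (K.obj.X n)
      comm' := fun n m h => by
        obtain rfl : n + 1 = m := h
        dsimp only [coneB, cone, Functor.comp_obj]
        rw [idOrZero_self, idOrZero_self, idOrZero_self]
        exact rMap_triMap _ _ _ }
  naturality K L f := ChB.hom_ext' fun n => rMap_map _ _ _

/-- The natural transformation `σ : CCK ⟶ CCK`, `((a, b), (c, e)) ↦ ((-a, c), (b, e))`. -/
noncomputable def coneσ : coneB C ⋙ coneB C ⟶ coneB C ⋙ coneB C where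
  app K := ObjectProperty.homMk
    { f := fun n => σMap (K.obj.X (n + 1 + 1)) (K.obj.X (n + 1)) (K.obj.X n)
      comm' := fun n m h => by
        obtain rfl : n + 1 = m := h
        dsimp only [coneB, cone, Functor.comp_obj]
        rw [idOrZero_self, idOrZero_self, idOrZero_self]
        exact σMap_triMap _ _ _ }
  naturality K L f := ChB.hom_ext' fun n => σMap_map _ _ _

lemma coneσ_coneσ (K : ChB C) : coneσ.app K ≫ coneσ.app K = 𝟙 _ :=
  ChB.hom_ext' fun _ => σMap_σMap _ _ _

instance : (suspB (C := C)).Full where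
  map_surjective f := by
    obtain ⟨g, hg⟩ := (shiftFunctor (CochainComplex C ℤ) (1 : ℤ)).map_surjective f.hom
    exact ⟨ObjectProperty.homMk g, by ext : 1; exact hg⟩

instance : (suspB (C := C)).Faithful where
  map_injective {_ _ f g} h := by
    ext : 1
    exact (shiftFunctor (CochainComplex C ℤ) (1 : ℤ)).map_injective
      (congrArg (fun φ => φ.hom) h)

instance : (suspB (C := C)).EssSurj where
  mem_essImage K := by
    refine ⟨⟨K.obj⟦(-1 : ℤ)⟧, (bounded C).le_shift (-1 : ℤ) _ K.property⟩, ⟨?_⟩⟩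
    exact (bounded C).isoMk ((shiftEquiv (CochainComplex C ℤ) (1 : ℤ)).counitIso.app K.obj)

variable [HasZeroObject C]

/-- The standard bicomplicial structure on `Ch_b(C)`. -/
noncomputable def bicomplicialChB (E : ExactStructure C) : Bicomplicial E.chB where
  C := coneB C
  additive := ⟨fun {K L f g} => ChB.hom_ext' fun n =>
    show biprod.map (f.hom.f (n + 1) + g.hom.f (n + 1)) (f.hom.f n + g.hom.f n) =
      biprod.map (f.hom.f (n + 1)) (f.hom.f n) + biprod.map (g.hom.f (n + 1)) (g.hom.f n) by
      ext <;> simp⟩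
  map_conflation S h n := ExactStructure.conflation_biprod_map (h (n + 1)) (h n)
  ι := coneι
  r := coner
  σ := ⟨coneσ, coneσ, by ext K : 2; exact coneσ_coneσ K, by ext K : 2; exact coneσ_coneσ K⟩
  map_ι_r K := ChB.hom_ext' fun n => map_inr_rMap _ _ _
  ι_r K := ChB.hom_ext' fun n => inr_rMap _ _ _
  map_ι_σ K := ChB.hom_ext' fun n => map_inr_σMap _ _ _
  σ_σ K := coneσ_coneσ K
  T := suspB
  π := coneπ
  ι_π K := ChB.hom_ext' fun n => biprod.inr_fst
  conflation_ι_π K n := E.conflation_inr_fst _ _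
  isEquivalence := { }

end ConeOfComplexes

end DerivedGW

open CategoryTheory Limits Pretriangulated ZeroObject

set_option linter.unusedSectionVars false

/-! Part (1). Using the cylinder `x ⊞ Cx`, the homotopy category of a bicomplicial category is a
localization of it. The extension axiom shows that `w` consists exactly of the morphisms with
trivial mapping cone, and that it has a calculus of left fractions up to homotopy. Hence `𝒯(ℰ, w)`
is the localization of `ℰ` at `w` (`isLocalization_projT`). In the same way `D_b(ℰ, w)` is the
localization of `Ch_b(ℰ)` at `qw`. Since `(Ch_b(ℰ), qw)` is itself a thick bicomplicial pair,
`𝒯(Ch_b(ℰ), qw)` and `D_b(ℰ, w)` are localizations at the same class, which is the second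
equivalence. For the first one it suffices that `j` induces `𝒯(ℰ, w) ≃ D_b(ℰ, w)`, and two facts
carry this.

Detection (`trivial_of_isZero_proj`): if `j x` vanishes in `D_b(ℰ, w)`, then `x` is trivial. An
iterated mapping cone turns every truncation of a bounded complex into an object of `ℰ`. The
complexes whose large truncations have trivial total objects satisfy two-out-of-three for
conflations, are closed under retracts, and contain the acyclic complexes and the complexes with
trivial terms; every class with these properties contains all complexes that vanish in `D_b(ℰ, w)`
(`RelExact.IsAcyclicClass.of_isZero_proj`). Thickness is needed because a complex which is only
homotopy equivalent to a spliced one has a total object that is merely a retract of a trivial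
object.

Reduction (`RelExact.IsBicomplicialPair.reducible`): every bounded complex `K` becomes isomorphic in
`D_b(ℰ, w)` to some `j z`, in such a way that morphisms of complexes `j x ⟶ K` become morphisms `x ⟶
z`. The lowest term in negative degree, or the highest in positive degree, is made trivial by gluing
in a two-term contractible complex built from the functor `C`, and is then truncated away. A
fraction in `D_b(ℰ, w)` between `j x` and `j y` therefore comes from a fraction in `ℰ`, whose
denominator lies in `w` by detection. This gives fullness, and faithfulness follows by applying it
to the cone of a difference.

Triangles are compared through natural connecting morphisms: the mapping cone of an admissible
monomorphism is derived isomorphic to the cokernel, because the total complex of a degreewise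
conflation is spliced. A functor with such connecting morphisms which kills the objects `Cx` sends
cone sequences to distinguished triangles.

Part (2). Applying the results of part (1) to `(Ch_b(ℱ), qv)` gives `D_b(ℱ, v) ≃ 𝒯(Ch_b(ℱ), qv) ≃
D_b(Ch_b(ℱ), qv)`. This places a complex as one column of a double complex, whereas `j` applied
termwise places it as one row. The exchange of the two directions (`swap`) sends `qw`-equivalences
to isomorphisms of the derived category, so it induces a self-inverse equivalence of `D_b(Ch_b(ℱ),
qv)`, and the functor induced by `j` differs from the equivalence above only by it. -/

namespace DerivedGW

/-! ### Diagram lemmas for conflations in a Quillen exact category. -/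

namespace ExactStructure

section

variable {C : Type u} [Category.{v} C] [Preadditive C] {E : ExactStructure C}

lemma iso_comp_deflation {Y Y' Z : C} {g : Y ⟶ Z} (hg : deflations E.conflation g)
    (e : Y' ≅ Y) : deflations E.conflation (e.hom ≫ g) := by
  obtain ⟨X, f, w, h⟩ := hg
  exact ⟨X, f ≫ e.inv, by simp [w],
    E.of_iso (ShortComplex.isoMk (S₁ := ShortComplex.mk f g w) (Iso.refl _) e.symm (Iso.refl _)
      (by simp) (by simp)) h⟩

lemma deflation_comp_iso {Y Z Z' : C} {g : Y ⟶ Z} (hg : deflations E.conflation g)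
    (e : Z ≅ Z') : deflations E.conflation (g ≫ e.hom) := by
  obtain ⟨X, f, w, h⟩ := hg
  exact ⟨X, f, by rw [← Category.assoc, w, zero_comp],
    E.of_iso (ShortComplex.isoMk (S₁ := ShortComplex.mk f g w) (Iso.refl _) (Iso.refl _) e
      (by simp) (by simp)) h⟩

lemma deflation_of_isIso {X Y : C} (f : X ⟶ Y) [IsIso f] : deflations E.conflation f := by
  simpa using iso_comp_deflation (E.id_deflation Y) (asIso f)

lemma inflation_of_isIso {X Y : C} (f : X ⟶ Y) [IsIso f] : inflations E.conflation f := by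
  simpa using inflation_comp_iso (E.id_inflation X) (asIso f)

lemma deflation_of_isPullback {Y' Y Z' Z : C} {g' : Y' ⟶ Y} {p' : Y' ⟶ Z'} {p : Y ⟶ Z}
    {g : Z' ⟶ Z} (hp : deflations E.conflation p) (h : IsPullback g' p' p g) :
    deflations E.conflation p' := by
  obtain ⟨Y'', g'', p'', h', h''⟩ := E.pullback p g hp
  have := iso_comp_deflation h'' (h.isoIsPullback _ _ h')
  rwa [IsPullback.isoIsPullback_hom_snd] at this

lemma conflation_of_isLimit {X Y Z : C} {f : X ⟶ Y} {g : Y ⟶ Z}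
    (hg : deflations E.conflation g) (w : f ≫ g = 0)
    (h : Nonempty (IsLimit (KernelFork.ofι f w))) :
    E.conflation (ShortComplex.mk f g w) := by
  obtain ⟨X', f', w', h'⟩ := hg
  obtain ⟨hf⟩ := h
  obtain ⟨hf'⟩ := E.kernel _ h'
  refine E.of_iso (ShortComplex.isoMk (S₁ := ShortComplex.mk f' g w')
    (hf'.conePointUniqueUpToIso hf) (Iso.refl _) (Iso.refl _) ?_ (by simp)) h'
  have := hf'.conePointUniqueUpToIso_hom_comp hf WalkingParallelPair.zero
  exact this.trans (Category.comp_id _).symm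

lemma exists_lift {S : ShortComplex C} (h : E.conflation S) {T : C} (f : T ⟶ S.X₂)
    (w : f ≫ S.g = 0) : ∃ l : T ⟶ S.X₁, l ≫ S.f = f :=
  ⟨_, (KernelFork.IsLimit.lift' (E.kernel S h).some f w).2⟩

lemma exists_desc {S : ShortComplex C} (h : E.conflation S) {T : C} (f : S.X₂ ⟶ T)
    (w : S.f ≫ f = 0) : ∃ l : S.X₃ ⟶ T, S.g ≫ l = f :=
  ⟨_, (CokernelCofork.IsColimit.desc' (E.cokernel S h).some f w).2⟩

lemma nonempty_isLimit {X Y Z : C} {f : X ⟶ Y} {g : Y ⟶ Z} (w : f ≫ g = 0) [Mono f]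
    (h : ∀ {T : C} (k : T ⟶ Y), k ≫ g = 0 → ∃ l : T ⟶ X, l ≫ f = k) :
    Nonempty (IsLimit (KernelFork.ofι f w)) :=
  ⟨KernelFork.IsLimit.ofι _ _ (fun k hk => (h k hk).choose) (fun k hk => (h k hk).choose_spec)
    (fun k hk m hm => by rw [← cancel_mono f, hm, (h k hk).choose_spec])⟩

lemma nonempty_isColimit {X Y Z : C} {f : X ⟶ Y} {g : Y ⟶ Z} (w : f ≫ g = 0) [Epi g]
    (h : ∀ {T : C} (k : Y ⟶ T), f ≫ k = 0 → ∃ l : Z ⟶ T, g ≫ l = k) :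
    Nonempty (IsColimit (CokernelCofork.ofπ g w)) :=
  ⟨CokernelCofork.IsColimit.ofπ _ _ (fun k hk => (h k hk).choose)
    (fun k hk => (h k hk).choose_spec)
    (fun k hk m hm => by rw [← cancel_epi g, hm, (h k hk).choose_spec])⟩

/-- The pushout of a conflation is a conflation. -/
lemma conflation_of_isPushout {X Y Z X' Y' : C} {i : X ⟶ Y} {p : Y ⟶ Z} {w : i ≫ p = 0}
    (h : E.conflation (ShortComplex.mk i p w)) {f : X ⟶ X'} {f' : Y ⟶ Y'} {i' : X' ⟶ Y'}
    (sq : IsPushout i f f' i') {p' : Y' ⟶ Z} (hp : f' ≫ p' = p) (w' : i' ≫ p' = 0) :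
    E.conflation (ShortComplex.mk i' p' w') := by
  have : Epi p := E.epi_g h
  have : Epi p' := epi_of_epi_fac hp
  refine conflation_of_isColimit (inflation_of_isPushout ⟨_, _, _, h⟩ sq) w'
    (nonempty_isColimit w' fun k hk => ?_)
  obtain ⟨l, hl⟩ := exists_desc h (f' ≫ k) (by
    dsimp; rw [← Category.assoc, sq.w, Category.assoc, hk, comp_zero])
  refine ⟨l, sq.hom_ext ?_ ?_⟩
  · rw [← Category.assoc, hp]
    exact hl
  · rw [← Category.assoc, w', zero_comp, hk]

/-- The pullback of a conflation is a conflation. -/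
lemma conflation_of_isPullback {X Y Z Y' Z' : C} {i : X ⟶ Y} {p : Y ⟶ Z} {w : i ≫ p = 0}
    (h : E.conflation (ShortComplex.mk i p w)) {g : Z' ⟶ Z} {g' : Y' ⟶ Y} {p' : Y' ⟶ Z'}
    (sq : IsPullback g' p' p g) {i' : X ⟶ Y'} (hi : i' ≫ g' = i) (w' : i' ≫ p' = 0) :
    E.conflation (ShortComplex.mk i' p' w') := by
  have : Mono i := E.mono_f h
  have : Mono i' := mono_of_mono_fac hi
  refine conflation_of_isLimit (deflation_of_isPullback ⟨_, _, _, h⟩ sq) w'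
    (nonempty_isLimit w' fun k hk => ?_)
  obtain ⟨l, hl⟩ := exists_lift h (k ≫ g') (by
    dsimp; rw [Category.assoc, sq.w, ← Category.assoc, hk, zero_comp])
  refine ⟨l, sq.hom_ext ?_ ?_⟩
  · rw [Category.assoc, hi]
    exact hl
  · rw [Category.assoc, w', comp_zero, hk]

/-- The short five lemma, for morphisms of conflations which are identities on both ends. -/
lemma isIso_of_conflations {X Z P K : C} {i : X ⟶ P} {q : P ⟶ Z} {w : i ≫ q = 0}
    (h : E.conflation (ShortComplex.mk i q w)) {i' : X ⟶ K} {q' : K ⟶ Z} {w' : i' ≫ q' = 0}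
    (h' : E.conflation (ShortComplex.mk i' q' w')) (α : P ⟶ K) (hi : i ≫ α = i')
    (hq : α ≫ q' = q) : IsIso α := by
  -- In the fibre product `D` of `K` and `P` over `Z`, both projections have kernel `X`. The graph
  -- `s` of `α` splits `π₁`, and `t` measures the difference `k - α p` of a pair `(k, p)` as an
  -- element of `X`.
  obtain ⟨D, π₂, π₁, sq, -⟩ := E.pullback q' q ⟨_, _, _, h'⟩
  have h₁ := conflation_of_isPullback h' sq (i' := sq.lift i' 0 (by rw [w', zero_comp]))
    (sq.lift_fst _ _ _) (sq.lift_snd _ _ _)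
  have h₂ := conflation_of_isPullback h sq.flip (i' := sq.lift 0 i (by rw [w, zero_comp]))
    (sq.lift_snd _ _ _) (sq.lift_fst _ _ _)
  have hm : Mono (sq.lift i' 0 (by rw [w', zero_comp])) := E.mono_f h₁
  have he : Epi π₂ := E.epi_g h₂
  set κ := sq.lift i' 0 (by rw [w', zero_comp]) with hκ
  have hκ₁ : κ ≫ π₂ = i' := sq.lift_fst _ _ _
  have hκ₂ : κ ≫ π₁ = 0 := sq.lift_snd _ _ _
  let s : P ⟶ D := sq.lift α (𝟙 P) (by rw [hq, Category.id_comp])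
  have hs₁ : s ≫ π₁ = 𝟙 P := sq.lift_snd _ _ _
  have hs₂ : s ≫ π₂ = α := sq.lift_fst _ _ _
  obtain ⟨t, ht⟩ := exists_lift h₁ (𝟙 D - π₁ ≫ s) (by simp [hs₁])
  dsimp at ht
  have ht₁ : sq.lift 0 i (by rw [w, zero_comp]) ≫ t = -𝟙 X := by
    rw [← cancel_mono κ, Category.assoc, ht]
    refine sq.hom_ext ?_ ?_ <;> simp [hs₁, hs₂, hi, hκ₁, hκ₂]
  have ht₂ : s ≫ t = 0 := by
    rw [← cancel_mono κ, Category.assoc, ht, zero_comp,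
      Preadditive.comp_sub, ← Category.assoc, hs₁, Category.comp_id, Category.id_comp, sub_self]
  -- The inverse sends `k` to `p + i (k - α p)` for any `p` with the same image in `Z`; this does
  -- not depend on `p`, so it descends along `π₂`.
  obtain ⟨ψ, hψ⟩ := exists_desc h₂ (π₁ + t ≫ i) (by
    dsimp
    rw [Preadditive.comp_add, ← Category.assoc, ht₁]
    simp)
  dsimp at hψ
  refine ⟨ψ, ?_, ?_⟩
  · rw [← hs₂, Category.assoc, hψ, Preadditive.comp_add, hs₁, ← Category.assoc, ht₂]
    simp
  · have := ht =≫ π₂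
    rw [Category.assoc, hκ₁, Preadditive.sub_comp, Category.assoc, hs₂,
      Category.id_comp] at this
    rw [← cancel_epi π₂, ← Category.assoc, hψ, Preadditive.add_comp, Category.assoc, hi, this]
    simp

/-- A cokernel of an inflation of conflations is a conflation. -/
lemma conflation_of_columns {S₁ S₂ S₃ : ShortComplex C} (φ : S₁ ⟶ S₂) (ψ : S₂ ⟶ S₃)
    (h₁ : E.conflation S₁) (h₂ : E.conflation S₂) (w₁ : φ.τ₁ ≫ ψ.τ₁ = 0)
    (w₂ : φ.τ₂ ≫ ψ.τ₂ = 0) (w₃ : φ.τ₃ ≫ ψ.τ₃ = 0)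
    (c₁ : E.conflation (ShortComplex.mk _ _ w₁)) (c₂ : E.conflation (ShortComplex.mk _ _ w₂))
    (c₃ : E.conflation (ShortComplex.mk _ _ w₃)) : E.conflation S₃ := by
  have e₁ : Epi ψ.τ₁ := E.epi_g c₁
  have e₂ : Epi ψ.τ₂ := E.epi_g c₂
  obtain ⟨P, j, k, sq, -⟩ := E.pushout S₁.f φ.τ₁ ⟨_, _, _, h₁⟩
  obtain ⟨q, hq₁, hq₂⟩ : ∃ q : P ⟶ S₁.X₃, j ≫ q = S₁.g ∧ k ≫ q = 0 :=
    ⟨sq.desc S₁.g 0 (by simp), sq.inl_desc _ _ _, sq.inr_desc _ _ _⟩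
  obtain ⟨m, hm₁, hm₂⟩ : ∃ m : P ⟶ S₂.X₂, j ≫ m = φ.τ₂ ∧ k ≫ m = S₂.f :=
    ⟨sq.desc φ.τ₂ S₂.f φ.comm₁₂.symm, sq.inl_desc _ _ _, sq.inr_desc _ _ _⟩
  obtain ⟨e, he₁, he₂⟩ : ∃ e : P ⟶ S₃.X₁, j ≫ e = 0 ∧ k ≫ e = ψ.τ₁ :=
    ⟨sq.desc 0 ψ.τ₁ (by simp [w₁]), sq.inl_desc _ _ _, sq.inr_desc _ _ _⟩
  -- The morphism of the first two rows factors through the pushout `P` of the first row along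
  -- `φ.τ₁`. By the short five lemma `P` is also the pullback `P'` of the second row along `φ.τ₃`.
  have hP : E.conflation (ShortComplex.mk k q hq₂) := conflation_of_isPushout h₁ sq hq₁ hq₂
  obtain ⟨P', g', p', sq', -⟩ := E.pullback S₂.g φ.τ₃ ⟨_, _, _, h₂⟩
  have hP' := conflation_of_isPullback h₂ sq' (i' := sq'.lift S₂.f 0 (by simp))
    (sq'.lift_fst _ _ _) (sq'.lift_snd _ _ _)
  have hα : m ≫ S₂.g = q ≫ φ.τ₃ := sq.hom_ext
    (by rw [← Category.assoc, hm₁, ← Category.assoc, hq₁, φ.comm₂₃])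
    (by rw [← Category.assoc, hm₂, ← Category.assoc, hq₂, S₂.zero, zero_comp])
  have iso : IsIso (sq'.lift m q hα) := isIso_of_conflations hP hP' _
    (sq'.hom_ext (by simp [hm₂]) (by simp [hq₂])) (sq'.lift_snd _ _ _)
  have m₃ : Mono φ.τ₃ := E.mono_f c₃
  have mg : Mono g' := ⟨fun a b hab => sq'.hom_ext hab (by
    rw [← cancel_mono φ.τ₃, Category.assoc, Category.assoc, ← sq'.w, reassoc_of% hab])⟩
  have wg : g' ≫ S₂.g ≫ ψ.τ₃ = 0 := by rw [← Category.assoc, sq'.w, Category.assoc, w₃, comp_zero]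
  -- A composite of deflations is a deflation, and the kernel of this one is the preimage under
  -- `S₂.g` of the kernel `S₁.X₃` of `ψ.τ₃`, that is, `P'`.
  have hg : E.conflation (ShortComplex.mk g' (S₂.g ≫ ψ.τ₃) wg) := by
    refine conflation_of_isLimit (E.comp_deflation _ _ ⟨_, _, _, h₂⟩ ⟨_, _, _, c₃⟩) wg
      (nonempty_isLimit wg fun t ht => ?_)
    obtain ⟨l, hl⟩ := exists_lift c₃ (t ≫ S₂.g) (by simpa using ht)
    exact ⟨sq'.lift t l hl.symm, sq'.lift_fst _ _ _⟩
  have wm : m ≫ S₂.g ≫ ψ.τ₃ = 0 := by rw [← Category.assoc, hα, Category.assoc, w₃, comp_zero]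
  have hm : E.conflation (ShortComplex.mk m (S₂.g ≫ ψ.τ₃) wm) :=
    E.of_iso (ShortComplex.isoMk (S₁ := ShortComplex.mk g' (S₂.g ≫ ψ.τ₃) wg)
      (asIso (sq'.lift m q hα)).symm (Iso.refl _) (Iso.refl _)
      (by rw [Iso.symm_hom, Iso.inv_comp_eq]; simp) (by simp)) hg
  have w' : m ≫ ψ.τ₂ = e ≫ S₃.f := sq.hom_ext
    (by rw [← Category.assoc, hm₁, w₂, ← Category.assoc, he₁, zero_comp])
    (by rw [← Category.assoc, hm₂, ← Category.assoc, he₂, ψ.comm₁₂])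
  have key {T : C} (a : S₂.X₂ ⟶ T) (b : S₃.X₁ ⟶ T) (hab : m ≫ a = e ≫ b) :
      ∃ l : S₃.X₂ ⟶ T, ψ.τ₂ ≫ l = a ∧ S₃.f ≫ l = b := by
    obtain ⟨l, hl⟩ := exists_desc c₂ a (by
      have := j ≫= hab
      rwa [← Category.assoc, hm₁, ← Category.assoc, he₁, zero_comp] at this)
    dsimp at hl
    refine ⟨l, hl, ?_⟩
    rw [← cancel_epi ψ.τ₁, ← Category.assoc, ψ.comm₁₂, Category.assoc, hl, ← hm₂, Category.assoc,
      hab, ← Category.assoc, he₂]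
  -- The third row is now the pushout along `e` of the conflation `P ⟶ S₂.X₂ ⟶ S₃.X₃`.
  have sq₃ : IsPushout m e ψ.τ₂ S₃.f := ⟨⟨w'⟩, ⟨PushoutCocone.IsColimit.mk _
    (fun s => (key _ _ s.condition).choose) (fun s => (key _ _ s.condition).choose_spec.1)
    (fun s => (key _ _ s.condition).choose_spec.2)
    (fun s l hl _ => by rw [← cancel_epi ψ.τ₂, hl, (key _ _ s.condition).choose_spec.1])⟩⟩
  exact conflation_of_isPushout hm sq₃ ψ.comm₂₃ S₃.zero

lemma conflation_of_isZero_left {X Y Z : C} (hX : IsZero X) (f : X ⟶ Y) (g : Y ⟶ Z) [IsIso g] :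
    E.conflation (ShortComplex.mk f g (hX.eq_of_src _ _)) := by
  have : Mono f := ⟨fun _ _ _ => hX.eq_of_tgt _ _⟩
  exact conflation_of_isLimit (deflation_of_isIso g) _ (nonempty_isLimit _ fun k hk =>
    ⟨0, by rw [zero_comp, ← cancel_mono g, hk, zero_comp]⟩)

lemma conflation_of_isZero_right {X Y Z : C} (hZ : IsZero Z) (f : X ⟶ Y) (g : Y ⟶ Z) [IsIso f] :
    E.conflation (ShortComplex.mk f g (hZ.eq_of_tgt _ _)) := by
  have : Epi g := ⟨fun _ _ _ => hZ.eq_of_src _ _⟩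
  exact conflation_of_isColimit (inflation_of_isIso f) _ (nonempty_isColimit _ fun k hk =>
    ⟨0, by rw [comp_zero, ← cancel_epi f, hk, comp_zero]⟩)

end

section

variable {C : Type u} [Category.{v} C] [Preadditive C] [HasBinaryBiproducts C]

lemma isPushout_map_id {X Y Z : C} (i : X ⟶ Y) :
    IsPushout i biprod.inl biprod.inl (biprod.map i (𝟙 Z)) :=
  ⟨⟨by simp⟩, ⟨PushoutCocone.IsColimit.mk _ (fun s => biprod.desc s.inl (biprod.inr ≫ s.inr))
    (fun s => by simp) (fun s => by ext <;> simp [s.condition])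
    (fun s m hm₁ hm₂ => by ext <;> simp [← hm₁, ← hm₂])⟩⟩

lemma isPullback_map_id {X Y Z : C} (p : X ⟶ Y) :
    IsPullback biprod.fst (biprod.map p (𝟙 Z)) p biprod.fst :=
  ⟨⟨by simp⟩, ⟨PullbackCone.IsLimit.mk _ (fun s => biprod.lift s.fst (s.snd ≫ biprod.snd))
    (fun s => by simp) (fun s => by ext <;> simp [s.condition])
    (fun s m hm₁ hm₂ => by ext <;> simp [← hm₁, ← hm₂])⟩⟩

end

section

variable {C : Type u} [Category.{v} C] [Preadditive C] [HasZeroObject C] [HasBinaryBiproducts C]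
  {E : ExactStructure C}

lemma inflation_inl (X Y : C) : inflations E.conflation (biprod.inl : X ⟶ X ⊞ Y) :=
  have h : biprod.inr ≫ (biprod.braiding Y X).hom = biprod.inl := by ext <;> simp
  h ▸ inflation_comp_iso (E.inflation_inr Y X) (biprod.braiding Y X)

lemma conflation_inl_snd (X Y : C) :
    E.conflation (ShortComplex.mk (biprod.inl : X ⟶ X ⊞ Y) biprod.snd biprod.inl_snd) :=
  E.of_iso (ShortComplex.isoMk (S₁ := ShortComplex.mk (biprod.inr : X ⟶ Y ⊞ X) biprod.fst
    biprod.inr_fst) (Iso.refl _) (biprod.braiding Y X) (Iso.refl _) (by ext <;> simp) (by simp))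
    (E.conflation_inr_fst Y X)

/-- The conflation `X ⟶ Y ⊞ X' ⟶ Y'` attached to a pushout of an inflation. -/
lemma conflation_biprod_of_isPushout {X Y X' Y' : C} {i : X ⟶ Y} (hi : inflations E.conflation i)
    {f : X ⟶ X'} {f' : Y ⟶ Y'} {i' : X' ⟶ Y'} (sq : IsPushout i f f' i') :
    E.conflation (ShortComplex.mk (biprod.lift i f) (biprod.desc f' (-i'))
      (by simp [sq.w])) := by
  -- A graph is an inclusion followed by a shear automorphism; `(i, f)` is then the graph of `f`
  -- followed by `i ⊕ 𝟙`.
  have hs : inflations E.conflation (biprod.lift (𝟙 X) f) := by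
    let e : X ⊞ X' ≅ X ⊞ X' :=
      { hom := biprod.lift biprod.fst (biprod.fst ≫ f + biprod.snd)
        inv := biprod.lift biprod.fst (-biprod.fst ≫ f + biprod.snd)
        hom_inv_id := by ext <;> simp
        inv_hom_id := by ext <;> simp }
    have : biprod.lift (𝟙 X) f = biprod.inl ≫ e.hom := by ext <;> simp [e]
    rw [this]
    exact inflation_comp_iso (inflation_inl _ _) e
  have h : inflations E.conflation (biprod.lift i f) := by
    have h := E.comp_inflation _ _ hs (inflation_of_isPushout hi (isPushout_map_id (Z := X') i))
    rwa [show biprod.lift (𝟙 X) f ≫ biprod.map i (𝟙 X') = biprod.lift i f by ext <;> simp] at h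
  refine conflation_of_isColimit h _ ⟨CokernelCofork.IsColimit.ofπ _ _
    (fun k hk => sq.desc (biprod.inl ≫ k) (-(biprod.inr ≫ k)) ?_) (fun k hk => ?_)
    (fun k hk m hm => ?_)⟩
  · have : biprod.lift i f = i ≫ biprod.inl + f ≫ biprod.inr := by ext <;> simp
    rw [this, Preadditive.add_comp, Category.assoc, Category.assoc] at hk
    rw [Preadditive.comp_neg, eq_neg_iff_add_eq_zero, hk]
  · ext <;> simp
  · subst hm
    exact sq.hom_ext (by simp) (by simp)

/-- The conflation `Y' ⟶ Y ⊞ Z' ⟶ Z` attached to a pullback of a deflation. -/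
lemma conflation_biprod_of_isPullback {Y' Y Z' Z : C} {g' : Y' ⟶ Y} {p' : Y' ⟶ Z'} {p : Y ⟶ Z}
    {g : Z' ⟶ Z} (hp : deflations E.conflation p) (sq : IsPullback g' p' p g) :
    E.conflation (ShortComplex.mk (biprod.lift g' p') (biprod.desc p (-g))
      (by simp [sq.w])) := by
  have hs : deflations E.conflation (biprod.desc (𝟙 Z) (-g)) := by
    let e : Z ⊞ Z' ≅ Z ⊞ Z' :=
      { hom := biprod.lift (biprod.fst - biprod.snd ≫ g) biprod.snd
        inv := biprod.lift (biprod.fst + biprod.snd ≫ g) biprod.snd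
        hom_inv_id := by ext <;> simp
        inv_hom_id := by ext <;> simp }
    have : biprod.desc (𝟙 Z) (-g) = e.hom ≫ biprod.fst := by ext <;> simp [e]
    rw [this]
    exact iso_comp_deflation ⟨_, _, _, E.conflation_inr_fst Z Z'⟩ e
  have h : deflations E.conflation (biprod.desc p (-g)) := by
    have h := E.comp_deflation _ _ (deflation_of_isPullback hp (isPullback_map_id (Z := Z') p)) hs
    rwa [show biprod.map p (𝟙 Z') ≫ biprod.desc (𝟙 Z) (-g) = biprod.desc p (-g) by
      ext <;> simp] at h
  refine conflation_of_isLimit h _ ⟨KernelFork.IsLimit.ofι _ _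
    (fun k hk => sq.lift (k ≫ biprod.fst) (k ≫ biprod.snd) ?_) (fun k hk => ?_)
    (fun k hk m hm => ?_)⟩
  · have : biprod.desc p (-g) = biprod.fst ≫ p - biprod.snd ≫ g := by ext <;> simp
    rw [this, Preadditive.comp_sub, sub_eq_zero] at hk
    simpa using hk
  · ext <;> simp
  · subst hm
    exact sq.hom_ext (by simp) (by simp)

end

end ExactStructure

/-! ### The total complex of a degreewise conflation is spliced from conflations. -/

section TotalComplex

variable {C : Type u} [Category.{v} C] [Preadditive C] [HasZeroObject C] [HasBinaryBiproducts C]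
  {E : ExactStructure C}

/-- One degree of the acyclicity of the total complex of a degreewise conflation. -/
lemma ExactStructure.conflation_total {K L₂ M₂ L₁ M₁ M₀ Z₁ Z₂ T : C} {f : K ⟶ L₂} {g₂ : L₂ ⟶ M₂}
    {w : f ≫ g₂ = 0} (h : E.conflation (ShortComplex.mk f g₂ w)) {g₁ : L₁ ⟶ M₁}
    (hg₁ : deflations E.conflation g₁) {dL : L₁ ⟶ L₂} {dM : M₁ ⟶ M₂} {dM₀ : M₀ ⟶ M₁}
    (hd : dM₀ ≫ dM = 0) (comm : g₁ ≫ dM = dL ≫ g₂) {l₁ : Z₁ ⟶ L₁} {m₁ : Z₁ ⟶ M₀}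
    (sq₁ : IsPullback l₁ m₁ g₁ (-dM₀)) {l₂ : Z₂ ⟶ L₂} {m₂ : Z₂ ⟶ M₁}
    (sq₂ : IsPullback l₂ m₂ g₂ (-dM)) (a : T ⟶ K) (b : T ⟶ L₁) (c : T ⟶ M₀)
    (hT : ∀ {X : C} (x : X ⟶ K) (y : X ⟶ L₁) (z : X ⟶ M₀), ∃ t : X ⟶ T,
      t ≫ a = x ∧ t ≫ b = y ∧ t ≫ c = z)
    (hT' : ∀ {X : C} (t t' : X ⟶ T), t ≫ a = t' ≫ a → t ≫ b = t' ≫ b → t ≫ c = t' ≫ c → t = t')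
    (i : Z₁ ⟶ T) (p : T ⟶ Z₂) (ib : i ≫ b = l₁) (ic : i ≫ c = m₁)
    (pl : p ≫ l₂ = -(a ≫ f) - b ≫ dL) (pm : p ≫ m₂ = b ≫ g₁ + c ≫ dM₀) (ip : i ≫ p = 0) :
    E.conflation (ShortComplex.mk i p ip) := by
  have : Mono f := E.mono_f h
  have key {X : C} (s : X ⟶ L₁ ⊞ M₀) (z : X ⟶ Z₂)
      (hs : s ≫ biprod.desc g₁ (- -dM₀) = z ≫ m₂) :
      ∃ t : X ⟶ T, t ≫ biprod.lift b c = s ∧ t ≫ p = z := by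
    have hs' : s ≫ biprod.fst ≫ g₁ + s ≫ biprod.snd ≫ dM₀ = z ≫ m₂ := by
      rw [← hs, neg_neg, ← Preadditive.comp_add, biprod.desc_eq]
    obtain ⟨k, hk⟩ := exists_lift h (-(z ≫ l₂) - s ≫ biprod.fst ≫ dL) (by
      have h₀ := hs' =≫ dM
      simp only [Preadditive.add_comp, Category.assoc, hd, comp_zero, add_zero] at h₀
      simp [sq₂.w, ← comm, h₀])
    dsimp at hk
    obtain ⟨t, ta, tb, tc⟩ := hT k (s ≫ biprod.fst) (s ≫ biprod.snd)
    refine ⟨t, by ext <;> simp [tb, tc], sq₂.hom_ext ?_ ?_⟩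
    · rw [Category.assoc, pl, Preadditive.comp_sub, Preadditive.comp_neg, ← Category.assoc t a, ta, hk,
        ← Category.assoc t b, tb]
      simp
    · rw [Category.assoc, pm, Preadditive.comp_add, ← Category.assoc, tb, ← Category.assoc, tc,
        ← hs', Category.assoc, Category.assoc]
  have w' : biprod.lift b c ≫ biprod.desc g₁ (- -dM₀) = p ≫ m₂ := by simp [pm]
  -- Here `T` is `K ⊕ L₁ ⊕ M₀` with coordinates `a`, `b`, `c`. It is also the pullback along `m₂` of
  -- the conflation `Z₁ ⟶ L₁ ⊞ M₀ ⟶ M₁`: the coordinate in `K` is recovered from the rest because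
  -- `f` is a kernel of `g₂`.
  have sq : IsPullback (biprod.lift b c) p (biprod.desc g₁ (- -dM₀)) m₂ :=
    ⟨⟨w'⟩, ⟨PullbackCone.IsLimit.mk _ (fun s => (key _ _ s.condition).choose)
      (fun s => (key _ _ s.condition).choose_spec.1)
      (fun s => (key _ _ s.condition).choose_spec.2) (fun s m h₁ h₂ => by
        have h₃ := h₁.trans (key _ _ s.condition).choose_spec.1.symm
        have h₄ := h₂.trans (key _ _ s.condition).choose_spec.2.symm
        generalize (key _ _ s.condition).choose = m' at h₃ h₄
        have hb : m ≫ b = m' ≫ b := by simpa using h₃ =≫ biprod.fst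
        refine hT' _ _ ?_ hb (by simpa using h₃ =≫ biprod.snd)
        have h₅ := h₄ =≫ l₂
        rw [Category.assoc, Category.assoc, pl, Preadditive.comp_sub, Preadditive.comp_sub,
          ← Category.assoc m b, ← Category.assoc m' b, hb, sub_left_inj, Preadditive.comp_neg,
          Preadditive.comp_neg, neg_inj] at h₅
        rw [← cancel_mono f]
        simpa using h₅)⟩⟩
  exact conflation_of_isPullback (conflation_biprod_of_isPullback hg₁ sq₁) sq
    (by ext <;> simp [ib, ic]) ip

open CochainComplex in
/-- The canonical morphism from the mapping cone of the first morphism of a short complex of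
complexes to its third object. -/
noncomputable def coneDesc (S : ShortComplex (CochainComplex C ℤ)) :
    mappingCone S.f ⟶ S.X₃ :=
  mappingCone.desc S.f 0 S.g (by simp)

-- The term of degree `n` is `K^{n+2} ⊕ L^{n+1} ⊕ M^n`, for a conflation `K ⟶ L ⟶ M`. A cycle is
-- determined by its components `(y, z)` in `L^{n+1}` and `M^n`, subject only to `g y = -d z`, since
-- its component in `K` is forced by `f` being a kernel. So the cycles are the pullback `Z n`, which
-- exists because `g` is a deflation.
open CochainComplex HomComplex in
lemma strictlyAcyclic_mappingCone_coneDesc (S : ShortComplex (CochainComplex C ℤ))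
    (hS : ∀ n, E.conflation (S.map (HomologicalComplex.eval C (ComplexShape.up ℤ) n))) :
    StrictlyAcyclic E (mappingCone (coneDesc S)) := by
  have hS' (n : ℤ) : E.conflation (ShortComplex.mk (S.f.f n) (S.g.f n)
    (by rw [← HomologicalComplex.comp_f, S.zero, HomologicalComplex.zero_f])) := hS n
  have hm (n : ℤ) : Mono (S.f.f n) := E.mono_f (hS' n)
  choose Z l m sq _ using fun n : ℤ =>
    E.pullback (S.g.f (n + 1)) (-S.X₃.d n (n + 1)) ⟨_, _, _, hS' (n + 1)⟩
  let a (n : ℤ) : (mappingCone (coneDesc S)).X n ⟶ S.X₁.X (n + 1 + 1) :=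
    (mappingCone.fst (coneDesc S)).1.v n (n + 1) rfl ≫
      (mappingCone.fst S.f).1.v (n + 1) (n + 1 + 1) rfl
  let b (n : ℤ) : (mappingCone (coneDesc S)).X n ⟶ S.X₂.X (n + 1) :=
    (mappingCone.fst (coneDesc S)).1.v n (n + 1) rfl ≫
      (mappingCone.snd S.f).v (n + 1) (n + 1) (add_zero _)
  let c (n : ℤ) : (mappingCone (coneDesc S)).X n ⟶ S.X₃.X n :=
    (mappingCone.snd (coneDesc S)).v n n (add_zero _)
  have hT (n : ℤ) {X : C} (x : X ⟶ S.X₁.X (n + 1 + 1)) (y : X ⟶ S.X₂.X (n + 1))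
      (z : X ⟶ S.X₃.X n) : ∃ t : X ⟶ (mappingCone (coneDesc S)).X n,
      t ≫ a n = x ∧ t ≫ b n = y ∧ t ≫ c n = z := by
    refine ⟨x ≫ (mappingCone.inl S.f).v (n + 1 + 1) (n + 1) (by omega) ≫
      (mappingCone.inl (coneDesc S)).v (n + 1) n (by omega) +
      y ≫ (mappingCone.inr S.f).f (n + 1) ≫
      (mappingCone.inl (coneDesc S)).v (n + 1) n (by omega) +
      z ≫ (mappingCone.inr (coneDesc S)).f n, ?_, ?_, ?_⟩ <;> simp [a, b, c]
  have hT' (n : ℤ) {X : C} (t t' : X ⟶ (mappingCone (coneDesc S)).X n)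
      (ha : t ≫ a n = t' ≫ a n) (hb : t ≫ b n = t' ≫ b n) (hc : t ≫ c n = t' ≫ c n) :
      t = t' := by
    rw [mappingCone.ext_to_iff _ n (n + 1) rfl, mappingCone.ext_to_iff _ (n + 1) (n + 1 + 1) rfl]
    simpa [a, b, c, and_assoc] using And.intro ha (And.intro hb hc)
  have da (n : ℤ) : (mappingCone (coneDesc S)).d n (n + 1) ≫ a (n + 1) =
      a n ≫ S.X₁.d (n + 1 + 1) (n + 1 + 1 + 1) := by
    simp [a, mappingCone.d_fst_v_assoc _ n (n + 1) (n + 1 + 1) rfl rfl,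
      mappingCone.d_fst_v _ (n + 1) (n + 1 + 1) (n + 1 + 1 + 1) rfl rfl]
  have db (n : ℤ) : (mappingCone (coneDesc S)).d n (n + 1) ≫ b (n + 1) =
      -(a n ≫ S.f.f (n + 1 + 1)) - b n ≫ S.X₂.d (n + 1) (n + 1 + 1) := by
    simp [a, b, mappingCone.d_fst_v_assoc _ n (n + 1) (n + 1 + 1) rfl rfl,
      mappingCone.d_snd_v _ (n + 1) (n + 1 + 1) rfl]
    abel
  have hdesc (n : ℤ) : (coneDesc S).f n = (mappingCone.snd S.f).v n n (add_zero _) ≫ S.g.f n := by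
    simp [coneDesc, mappingCone.desc_f _ _ _ _ n (n + 1) rfl]
  have dc (n : ℤ) : (mappingCone (coneDesc S)).d n (n + 1) ≫ c (n + 1) =
      b n ≫ S.g.f (n + 1) + c n ≫ S.X₃.d n (n + 1) := by
    simp [b, c, mappingCone.d_snd_v _ n (n + 1) rfl, hdesc]
  clear_value a b c
  have hi (n : ℤ) : ∃ i : Z n ⟶ (mappingCone (coneDesc S)).X n,
      (i ≫ a n) ≫ S.f.f (n + 1 + 1) = -(l n ≫ S.X₂.d (n + 1) (n + 1 + 1)) ∧
        i ≫ b n = l n ∧ i ≫ c n = m n := by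
    obtain ⟨k, hk⟩ := ExactStructure.exists_lift (hS' (n + 1 + 1))
      (-(l n ≫ S.X₂.d (n + 1) (n + 1 + 1))) (by
        dsimp
        rw [Preadditive.neg_comp, Category.assoc, ← S.g.comm, ← Category.assoc, (sq n).w]
        simp)
    obtain ⟨t, ta, tb, tc⟩ := hT n k (l n) (m n)
    exact ⟨t, by rw [ta]; exact hk, tb, tc⟩
  choose i ia ib ic using hi
  have hp (n : ℤ) : ∃ p : (mappingCone (coneDesc S)).X n ⟶ Z (n + 1),
      p ≫ l (n + 1) = -(a n ≫ S.f.f (n + 1 + 1)) - b n ≫ S.X₂.d (n + 1) (n + 1 + 1) ∧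
      p ≫ m (n + 1) = b n ≫ S.g.f (n + 1) + c n ≫ S.X₃.d n (n + 1) := by
    refine ⟨(sq (n + 1)).lift (-(a n ≫ S.f.f (n + 1 + 1)) - b n ≫ S.X₂.d (n + 1) (n + 1 + 1))
      (b n ≫ S.g.f (n + 1) + c n ≫ S.X₃.d n (n + 1)) ?_, (sq (n + 1)).lift_fst _ _ _,
      (sq (n + 1)).lift_snd _ _ _⟩
    have : S.f.f (n + 1 + 1) ≫ S.g.f (n + 1 + 1) = 0 := by
      rw [← HomologicalComplex.comp_f, S.zero, HomologicalComplex.zero_f]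
    rw [Preadditive.sub_comp, Preadditive.neg_comp, Category.assoc, this, Category.assoc,
      ← S.g.comm]
    simp
  choose p pl pm using hp
  have ip (n : ℤ) : i n ≫ p n = 0 := (sq (n + 1)).hom_ext
    (by rw [Category.assoc, pl, Preadditive.comp_sub, Preadditive.comp_neg,
      ← Category.assoc (i n) (a n), ia, ← Category.assoc (i n) (b n), ib]; simp)
    (by rw [Category.assoc, pm, Preadditive.comp_add, ← Category.assoc (i n) (b n), ib,
      ← Category.assoc (i n) (c n), ic, (sq n).w]; simp)
  refine ⟨Z, i, p, ip, fun n => ?_, fun n => hT' _ _ _ ?_ ?_ ?_⟩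
  · exact ExactStructure.conflation_total (hS' (n + 1 + 1)) ⟨_, _, _, hS' (n + 1)⟩
      (S.X₃.d_comp_d _ _ _) (S.g.comm _ _) (sq n) (sq (n + 1)) (a n) (b n) (c n) (hT n) (hT' n)
      (i n) (p n) (ib n) (ic n) (pl n) (pm n) (ip n)
  · have h₁ := ia (n + 1)
    rw [Category.assoc] at h₁
    rw [← cancel_mono (S.f.f (n + 1 + 1 + 1)), da, Category.assoc, ← S.f.comm, Category.assoc,
      Category.assoc, h₁, Preadditive.comp_neg, ← Category.assoc (p n), pl]
    simp
  · rw [db, Category.assoc, ib, pl]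
  · rw [dc, Category.assoc, ic, pm]

end TotalComplex

/-! ### Kernels and the universal property of Verdier quotients. -/

section VerdierLift

variable {T : Type u} [Category.{v} T] [HasZeroObject T] [HasShift T ℤ] [Preadditive T]
  [∀ n : ℤ, (shiftFunctor T n).Additive] [Pretriangulated T] [IsTriangulated T]
  {T' : Type*} [Category T'] [HasZeroObject T'] [HasShift T' ℤ] [Preadditive T']
  [∀ n : ℤ, (shiftFunctor T' n).Additive] [Pretriangulated T']

omit [IsTriangulated T] in
lemma le_triClosure (P : ObjectProperty T) : P ≤ triClosure P := fun _ h _ _ _ hP => hP _ h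

omit [IsTriangulated T] in
lemma isTriangulated_isZero_obj (F : T ⥤ T') [F.CommShift ℤ] [F.IsTriangulated] :
    (ObjectProperty.IsTriangulated (fun X : T => IsZero (F.obj X))) where
  exists_zero := ⟨0, isZero_zero T, F.map_isZero (isZero_zero T)⟩
  isStableUnderShiftBy n := ⟨fun X h =>
    IsZero.of_iso ((shiftFunctor T' n).map_isZero h) ((F.commShiftIso n).app X)⟩
  toIsTriangulatedClosed₂ := ⟨fun A hA h₁ h₃ => ObjectProperty.le_isoClosure _ _
    ((F.mapTriangle.obj A).isZero₂_of_isZero₁₃ (F.map_distinguished A hA) h₁ h₃)⟩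

variable (P : ObjectProperty T)

lemma VerdierQuotient.isZero_proj {X : T} (h : P X) : IsZero ((VerdierQuotient.proj P).obj X) := by
  have : (triClosure P).trW (0 : X ⟶ 0) := by
    rw [ObjectProperty.trW_iff']
    exact ⟨X, 𝟙 X, 0, contractible_distinguished X, le_triClosure P _ h⟩
  have := Localization.inverts (VerdierQuotient.proj P) _ _ this
  exact IsZero.of_iso ((VerdierQuotient.proj P).map_isZero (isZero_zero T))
    (asIso ((VerdierQuotient.proj P).map (0 : X ⟶ 0)))

-- If `X` vanishes in the quotient, its identity is killed by some `s : X ⟶ Y` with cone in the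
-- subcategory generated by `P`. Then `s = 0`, and the cone of a zero morphism out of `X` has `X⟦1⟧`
-- as a retract.
variable {P} in
lemma VerdierQuotient.of_isZero {X : T} (h : IsZero ((VerdierQuotient.proj P).obj X))
    (Q : ObjectProperty T) [Q.IsTriangulated] [Q.IsClosedUnderIsomorphisms] (hP : P ≤ Q)
    (hQ : ∀ {Y Z : T}, Retract Y Z → Q Z → Q Y) : Q X := by
  obtain ⟨Y, s, hs, hs'⟩ := (MorphismProperty.map_eq_iff_postcomp (VerdierQuotient.proj P)
    (triClosure P).trW (𝟙 X) 0).1 (h.eq_of_src _ _)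
  rw [Category.id_comp, zero_comp] at hs'
  subst hs'
  obtain ⟨Z, g, k, hT, hZ⟩ := hs
  obtain ⟨l, hl⟩ := Triangle.coyoneda_exact₁ _ hT (𝟙 (X⟦(1 : ℤ)⟧))
    ((Category.id_comp _).trans ((shiftFunctor T (1 : ℤ)).map_zero _ _))
  have : Q (X⟦(1 : ℤ)⟧) := hQ ⟨l, k, hl.symm⟩ (hZ Q inferInstance inferInstance hP)
  exact Q.prop_of_iso ((shiftEquiv T (1 : ℤ)).unitIso.app X).symm (Q.le_shift (-1 : ℤ) _ this)

lemma VerdierQuotient.exists_lift (F : T ⥤ T') [F.CommShift ℤ] [F.IsTriangulated]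
    (hF : ∀ X, P X → IsZero (F.obj X)) :
    ∃ (G : VerdierQuotient P ⥤ T') (_ : G.CommShift ℤ) (e : VerdierQuotient.proj P ⋙ G ≅ F),
      NatTrans.CommShift e.hom ℤ ∧ G.IsTriangulated := by
  have hF' : (triClosure P).trW.IsInvertedBy F := fun X Y f ⟨Z, g, h, hT, hZ⟩ => by
    have := isTriangulated_isZero_obj F
    have : IsZero (F.obj Z) := hZ _ this ⟨fun e h => h.of_iso (F.mapIso e.symm)⟩ hF
    exact (Triangle.isZero₃_iff_isIso₁ _ (F.map_distinguished _ hT)).1 this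
  let G : VerdierQuotient P ⥤ T' := Localization.lift F hF' (VerdierQuotient.proj P)
  let : G.CommShift ℤ := Functor.commShiftOfLocalization (VerdierQuotient.proj P)
    (triClosure P).trW ℤ F G
  let e : VerdierQuotient.proj P ⋙ G ≅ F := Localization.Lifting.iso _ (triClosure P).trW F G
  have he : NatTrans.CommShift e.hom ℤ := by infer_instance
  refine ⟨G, inferInstance, e, he, ?_⟩
  -- Every arrow of the quotient is isomorphic to the image of an arrow of `T`, so every
  -- distinguished triangle is isomorphic to the image of one.
  have : (VerdierQuotient.proj P).mapArrow.EssSurj :=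
    Localization.essSurj_mapArrow _ (triClosure P).trW
  exact Functor.isTriangulated_of_precomp_iso e

end VerdierLift

/-! ### Mapping cones of bounded complexes and their triangles in the bounded homotopy category. -/

section MappingCone

variable {C : Type u} [Category.{v} C] [Preadditive C] [HasBinaryBiproducts C]

/-- The mapping cone of a morphism of bounded complexes. -/
noncomputable def mcB {K L : ChB C} (f : K ⟶ L) : ChB C :=
  ⟨CochainComplex.mappingCone f.hom, by
    obtain ⟨a, b, h₁⟩ := K.property
    obtain ⟨a', b', h₂⟩ := L.property
    refine ⟨min (a - 1) a', max b b', fun n hn => ?_⟩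
    rw [CochainComplex.mappingCone.isZero_X_iff]
    exact ⟨h₁ _ (by grind), h₂ _ (by grind)⟩⟩

/-- The inclusion of the target in the mapping cone. -/
noncomputable def mcB.inr {K L : ChB C} (f : K ⟶ L) : L ⟶ mcB f :=
  ObjectProperty.homMk (CochainComplex.mappingCone.inr f.hom)

/-- The functoriality of the mapping cone. -/
noncomputable def mcB.map {K L K' L' : ChB C} (f : K ⟶ L) (f' : K' ⟶ L') (a : K ⟶ K')
    (b : L ⟶ L') (comm : f ≫ b = a ≫ f') : mcB f ⟶ mcB f' :=
  ObjectProperty.homMk (CochainComplex.mappingCone.map f.hom f'.hom a.hom b.hom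
    (congrArg (fun φ => φ.hom) comm))

/-- The connecting morphism of the mapping cone sequence, in the homotopy category. -/
noncomputable def mcB.δ' {K L : ChB C} (f : K ⟶ L) :
    (boundedHo C).ι.obj ((toHb C).obj (mcB f)) ⟶
      ((boundedHo C).ι.obj ((toHb C).obj K))⟦(1 : ℤ)⟧ :=
  (CochainComplex.mappingCone.triangleh f.hom).mor₃

lemma mcB.δ'_naturality {K L K' L' : ChB C} (f : K ⟶ L) (f' : K' ⟶ L') (a : K ⟶ K')
    (b : L ⟶ L') (comm : f ≫ b = a ≫ f') :
    (boundedHo C).ι.map ((toHb C).map (mcB.map f f' a b comm)) ≫ mcB.δ' f' =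
      mcB.δ' f ≫ ((boundedHo C).ι.map ((toHb C).map a))⟦(1 : ℤ)⟧' :=
  ((HomotopyCategory.quotient _ _).mapTriangle.map
    (CochainComplex.mappingCone.triangleMap f.hom f'.hom a.hom b.hom
      (congrArg (fun φ => φ.hom) comm))).comm₃.symm

/-- The connecting morphism of the mapping cone sequence. -/
noncomputable def mcB.δ {K L : ChB C} (f : K ⟶ L) :
    (toHb C).obj (mcB f) ⟶ ((toHb C).obj K)⟦(1 : ℤ)⟧ :=
  (boundedHo C).fullyFaithfulι.preimage
    (mcB.δ' f ≫ ((boundedHo C).ι.commShiftIso (1 : ℤ)).inv.app ((toHb C).obj K))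

lemma mcB.map_δ {K L : ChB C} (f : K ⟶ L) :
    (boundedHo C).ι.map (mcB.δ f) = mcB.δ' f ≫
      ((boundedHo C).ι.commShiftIso (1 : ℤ)).inv.app ((toHb C).obj K) :=
  (boundedHo C).fullyFaithfulι.map_preimage _

lemma mcB.δ_naturality {K L K' L' : ChB C} (f : K ⟶ L) (f' : K' ⟶ L') (a : K ⟶ K')
    (b : L ⟶ L') (comm : f ≫ b = a ≫ f') :
    (toHb C).map (mcB.map f f' a b comm) ≫ mcB.δ f' = mcB.δ f ≫ ((toHb C).map a)⟦(1 : ℤ)⟧' := by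
  apply (boundedHo C).ι.map_injective
  rw [Functor.map_comp, Functor.map_comp, mcB.map_δ, mcB.map_δ, Category.assoc]
  erw [← ((boundedHo C).ι.commShiftIso (1 : ℤ)).inv.naturality]
  rw [← Category.assoc, ← Category.assoc, mcB.δ'_naturality]
  rfl

variable [HasZeroObject C]

lemma mcB.distinguished {K L : ChB C} (f : K ⟶ L) :
    Triangle.mk ((toHb C).map f) ((toHb C).map (mcB.inr f)) (mcB.δ f) ∈ distTriang (Hb C) := by
  have h : (boundedHo C).ι.map (mcB.δ f) ≫
      ((boundedHo C).ι.commShiftIso (1 : ℤ)).hom.app ((toHb C).obj K) = mcB.δ' f := by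
    rw [mcB.map_δ, Category.assoc, Iso.inv_hom_id_app]
    exact Category.comp_id _
  change Triangle.mk _ _ ((boundedHo C).ι.map (mcB.δ f) ≫
      ((boundedHo C).ι.commShiftIso (1 : ℤ)).hom.app ((toHb C).obj K)) ∈ distTriang _
  rw [h]
  exact HomotopyCategory.mappingCone_triangleh_distinguished f.hom

lemma mcB.isIso_map_iff {D : Type*} [Category D] [HasZeroObject D] [HasShift D ℤ] [Preadditive D]
    [∀ n : ℤ, (shiftFunctor D n).Additive] [Pretriangulated D] (F : Hb C ⥤ D) [F.CommShift ℤ]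
    [F.IsTriangulated] {K L : ChB C} (f : K ⟶ L) :
    IsIso ((toHb C ⋙ F).map f) ↔ IsZero ((toHb C ⋙ F).obj (mcB f)) :=
  (Triangle.isZero₃_iff_isIso₁ _ (F.map_distinguished _ (mcB.distinguished f))).symm

end MappingCone

/-! ### Natural triangles in the derived category attached to degreewise conflations. -/

section ConnectingMorphism

variable {C : Type u} [Category.{v} C] [Preadditive C] [HasBinaryBiproducts C] [HasZeroObject C]
  (R : RelExact C)

lemma RelExact.isZero_proj_of_acyclicHb {K : ChB C} (h : acyclicHb R.exact ((toHb C).obj K)) :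
    IsZero (R.proj.obj K) :=
  (VerdierQuotient.proj R.image).map_isZero (VerdierQuotient.isZero_proj _ h)

lemma RelExact.isZero_proj_of_trivial {K : ChB C} (h : ∀ n, R.trivial (K.obj.X n)) :
    IsZero (R.proj.obj K) :=
  VerdierQuotient.isZero_proj R.image ⟨K, h, ⟨Iso.refl _⟩⟩

instance : (toHb C).Additive where

instance : R.projHb.Additive := inferInstance

instance : R.proj.Additive := inferInstanceAs (toHb C ⋙ R.projHb).Additive

/-- The canonical morphism from the mapping cone of an admissible monomorphism to its cokernel. -/
noncomputable def coneDescB (S : ShortComplex (ChB C)) : mcB S.f ⟶ S.X₃ :=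
  ObjectProperty.homMk (coneDesc (S.map (bounded C).ι))

lemma inr_coneDesc (S : ShortComplex (CochainComplex C ℤ)) :
    CochainComplex.mappingCone.inr S.f ≫ coneDesc S = S.g := by
  simp [coneDesc]

lemma mcB.inr_coneDescB (S : ShortComplex (ChB C)) : mcB.inr S.f ≫ coneDescB S = S.g := by
  ext : 1
  exact inr_coneDesc (S.map (bounded C).ι)

lemma coneDesc_naturality {S S' : ShortComplex (CochainComplex C ℤ)} (φ : S ⟶ S') :
    CochainComplex.mappingCone.map S.f S'.f φ.τ₁ φ.τ₂ φ.comm₁₂.symm ≫ coneDesc S' =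
      coneDesc S ≫ φ.τ₃ := by
  ext n
  have h := HomologicalComplex.congr_hom φ.comm₂₃ n
  rw [HomologicalComplex.comp_f, HomologicalComplex.comp_f] at h
  simp [coneDesc, CochainComplex.mappingCone.ext_from_iff _ (n + 1) n rfl,
    CochainComplex.mappingCone.map, h]

lemma coneDescB_naturality {S S' : ShortComplex (ChB C)} (φ : S ⟶ S') :
    mcB.map S.f S'.f φ.τ₁ φ.τ₂ φ.comm₁₂.symm ≫ coneDescB S' = coneDescB S ≫ φ.τ₃ := by
  ext : 1
  exact coneDesc_naturality ((bounded C).ι.mapShortComplex.map φ)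

/-- The mapping cone of `coneDescB S` is the total complex of the conflation `S`, which is strictly
acyclic. -/
lemma RelExact.isIso_proj_coneDescB {S : ShortComplex (ChB C)} (hS : degreewise R.exact S) :
    IsIso (R.proj.map (coneDescB S)) :=
  (mcB.isIso_map_iff R.projHb _).2 (R.isZero_proj_of_acyclicHb
    ⟨_, strictlyAcyclic_mappingCone_coneDesc (S.map (bounded C).ι) hS, ⟨Iso.refl _⟩⟩)

/-- The connecting morphism of the mapping cone sequence, in the derived category. -/
noncomputable def RelExact.mcδ {K L : ChB C} (f : K ⟶ L) :
    R.proj.obj (mcB f) ⟶ (R.proj.obj K)⟦(1 : ℤ)⟧ :=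
  R.projHb.map (mcB.δ f) ≫ (R.projHb.commShiftIso (1 : ℤ)).hom.app _

lemma RelExact.mcδ_naturality {K L K' L' : ChB C} (f : K ⟶ L) (f' : K' ⟶ L') (a : K ⟶ K')
    (b : L ⟶ L') (comm : f ≫ b = a ≫ f') :
    R.proj.map (mcB.map f f' a b comm) ≫ R.mcδ f' = R.mcδ f ≫ (R.proj.map a)⟦(1 : ℤ)⟧' := by
  have h := congrArg R.projHb.map (mcB.δ_naturality f f' a b comm)
  rw [Functor.map_comp, Functor.map_comp] at h
  have h' := (R.projHb.commShiftIso (1 : ℤ)).hom.naturality ((toHb C).map a)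
  refine (Category.assoc _ _ _).symm.trans ((congrArg (· ≫ _) h).trans
    ((Category.assoc _ _ _).trans ?_))
  exact (congrArg (_ ≫ ·) h').trans (Category.assoc _ _ _).symm

lemma RelExact.mc_distinguished {K L : ChB C} (f : K ⟶ L) :
    Triangle.mk (R.proj.map f) (R.proj.map (mcB.inr f)) (R.mcδ f) ∈ distTriang R.Db :=
  R.projHb.map_distinguished _ (mcB.distinguished f)

/-- The connecting morphism of a degreewise admissible short exact sequence. -/
noncomputable def RelExact.conn {S : ShortComplex (ChB C)} (hS : degreewise R.exact S) :
    R.proj.obj S.X₃ ⟶ (R.proj.obj S.X₁)⟦(1 : ℤ)⟧ :=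
  have := R.isIso_proj_coneDescB hS
  inv (R.proj.map (coneDescB S)) ≫ R.mcδ S.f

lemma RelExact.map_coneDescB_conn {S : ShortComplex (ChB C)} (hS : degreewise R.exact S) :
    R.proj.map (coneDescB S) ≫ R.conn hS = R.mcδ S.f := by
  have := R.isIso_proj_coneDescB hS
  simp [RelExact.conn]

lemma RelExact.distinguished {S : ShortComplex (ChB C)} (hS : degreewise R.exact S) :
    Triangle.mk (R.proj.map S.f) (R.proj.map S.g) (R.conn hS) ∈ distTriang R.Db := by
  have := R.isIso_proj_coneDescB hS
  let e := asIso (R.proj.map (coneDescB S))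
  refine isomorphic_distinguished _ (R.mc_distinguished S.f) _
    (Triangle.isoMk _ _ (Iso.refl _) (Iso.refl _) e.symm ?_ ?_ ?_)
  · exact (Category.comp_id _).trans (Category.id_comp _).symm
  · refine Eq.trans ?_ (Category.id_comp _).symm
    refine (Iso.comp_inv_eq e).2 ?_
    exact (congrArg R.proj.map (mcB.inr_coneDescB S)).symm.trans (R.proj.map_comp _ _)
  · refine (congrArg (_ ≫ ·) ((shiftFunctor _ (1 : ℤ)).map_id _)).trans
      ((Category.comp_id _).trans ?_)
    exact (Iso.eq_inv_comp e).2 (R.map_coneDescB_conn hS)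

/-- Naturality turns morphisms of conflations into morphisms of triangles; the extension axiom for
`qw` and the comparison of suspensions both rest on it. -/
lemma RelExact.conn_naturality {S S' : ShortComplex (ChB C)} (φ : S ⟶ S')
    (hS : degreewise R.exact S) (hS' : degreewise R.exact S') :
    R.proj.map φ.τ₃ ≫ R.conn hS' = R.conn hS ≫ (R.proj.map φ.τ₁)⟦(1 : ℤ)⟧' := by
  have := R.isIso_proj_coneDescB hS
  rw [← cancel_epi (R.proj.map (coneDescB S)), ← Category.assoc, ← Functor.map_comp,
    ← coneDescB_naturality, Functor.map_comp, Category.assoc, map_coneDescB_conn,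
    ← Category.assoc (R.proj.map (coneDescB S)), map_coneDescB_conn, mcδ_naturality]

end ConnectingMorphism

/-! ### Homotopies through the cone functor, cylinders, and the homotopy category as a localization.
-/

section Homotopies

variable {C : Type u} [Category.{v} C] [Preadditive C] [HasBinaryBiproducts C] [HasZeroObject C]

lemma toHb_map_eq_iff {K L : ChB C} (f g : K ⟶ L) :
    (toHb C).map f = (toHb C).map g ↔ Nonempty (Homotopy f.hom g.hom) := by
  constructor
  · intro h
    exact ⟨HomotopyCategory.homotopyOfEq _ _ (congrArg (fun φ => φ.hom) h)⟩
  · rintro ⟨h⟩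
    ext : 1
    exact HomotopyCategory.eq_of_homotopy _ _ h

lemma coneB_d (K : ChB C) (n : ℤ) : ((coneB C).obj K).obj.d n (n + 1) =
    triMap (-K.obj.d (n + 1) (n + 1 + 1)) (-𝟙 (K.obj.X (n + 1))) (K.obj.d n (n + 1)) := by
  change triMap _ (-idOrZero _ _ _) _ = _
  rw [idOrZero_self]

/-- A morphism `CK ⟶ L` extending `f - g` along `ι` has components `(-h, f - g)`, and compatibility
with the differentials says precisely that `h` is a chain homotopy. The sign comes from the entry
`-𝟙` in the differential of the cone. -/
lemma homotopic_iff (E : ExactStructure C) {K L : ChB C} (f g : K ⟶ L) :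
    (bicomplicialChB E).homotopic f g ↔ (toHb C).map f = (toHb C).map g := by
  rw [toHb_map_eq_iff]
  constructor
  · rintro ⟨H, hH⟩
    let h (n : ℤ) : K.obj.X (n + 1) ⊞ K.obj.X n ⟶ L.obj.X n := H.hom.f n
    have hH' (n : ℤ) : f.hom.f n - g.hom.f n = biprod.inr ≫ h n :=
      congrArg (fun φ => φ.hom.f n) hH
    have hc (n : ℤ) : h n ≫ L.obj.d n (n + 1) = triMap (-K.obj.d (n + 1) (n + 1 + 1))
        (-𝟙 (K.obj.X (n + 1))) (K.obj.d n (n + 1)) ≫ h (n + 1) :=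
      (ChB.comm H n (n + 1)).trans (congrArg (· ≫ h (n + 1)) (coneB_d K n))
    clear_value h
    refine ⟨
      { hom := fun i j => if h' : j + 1 = i then
          (K.obj.XIsoOfEq h'.symm).hom ≫ (-biprod.inl) ≫ h j else 0
        zero := fun i j h' => dif_neg h'
        comm := fun n => ?_ }⟩
    obtain ⟨m, rfl⟩ : ∃ m, n = m + 1 := ⟨n - 1, by simp⟩
    rw [dNext_eq _ (show (ComplexShape.up ℤ).Rel (m + 1) (m + 1 + 1) from rfl),
      prevD_eq _ (show (ComplexShape.up ℤ).Rel m (m + 1) from rfl), ← sub_eq_iff_eq_add, hH']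
    simp [hc, biprod.lift_eq]
  · rintro ⟨h⟩
    refine ⟨ObjectProperty.homMk
      { f := fun n => (biprod.desc (-h.hom (n + 1) n) (f.hom.f n - g.hom.f n) :
          K.obj.X (n + 1) ⊞ K.obj.X n ⟶ L.obj.X n)
        comm' := ?_ }, ?_⟩
    · rintro n m hnm
      obtain rfl : n + 1 = m := hnm
      have := h.comm (n + 1)
      rw [dNext_eq _ (show (ComplexShape.up ℤ).Rel (n + 1) (n + 1 + 1) from rfl),
        prevD_eq _ (show (ComplexShape.up ℤ).Rel n (n + 1) from rfl)] at this
      have key : (biprod.desc (-h.hom (n + 1) n) (f.hom.f n - g.hom.f n) :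
            K.obj.X (n + 1) ⊞ K.obj.X n ⟶ L.obj.X n) ≫ L.obj.d n (n + 1) =
          triMap (-K.obj.d (n + 1) (n + 1 + 1)) (-𝟙 (K.obj.X (n + 1))) (K.obj.d n (n + 1)) ≫
            biprod.desc (-h.hom (n + 1 + 1) (n + 1)) (f.hom.f (n + 1) - g.hom.f (n + 1)) := by
        ext <;> simp [this]
      exact key.trans (congrArg (· ≫ _) (coneB_d K n).symm)
    · refine ChB.hom_ext' fun n => ?_
      exact (biprod.inr_desc _ _).symm

lemma isZero_toHb_coneB (E : ExactStructure C) (K : ChB C) :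
    IsZero ((toHb C).obj ((coneB C).obj K)) := by
  rw [IsZero.iff_id_eq_zero, ← (toHb C).map_id, ← (toHb C).map_zero, ← homotopic_iff E]
  exact ⟨coner.app K, (sub_zero _).trans ((bicomplicialChB E).ι_r K).symm⟩

instance : (toHb C).Full :=
  inferInstanceAs ((boundedHo C).lift _ _).Full

instance : (toHb C).EssSurj where
  mem_essImage X := by
    obtain ⟨X, hX⟩ := X
    obtain ⟨K : CochainComplex _ _, rfl⟩ := X.quotient_obj_surjective
    exact ⟨⟨K, (boundedHo_quotient_obj_iff K).1 hX⟩, ⟨Iso.refl _⟩⟩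

/-- The object `x ⊞ Cx` serves as a cylinder, with ends `(𝟙, ι)` and `(𝟙, 0)`; a homotopy `H` from
`f` to `g` is the same as the extension `(g, H)`. -/
lemma Bicomplicial.exists_cylinder {A : Type*} [Category A] [Preadditive A] [HasBinaryBiproducts A]
    {E : ExactStructure A} (B : Bicomplicial E) {x y : A} {f g : x ⟶ y} (h : B.homotopic f g) :
    ∃ (i j : x ⟶ x ⊞ B.C.obj x) (φ : x ⊞ B.C.obj x ⟶ y), i ≫ biprod.fst = 𝟙 x ∧
      j ≫ biprod.fst = 𝟙 x ∧ i ≫ φ = f ∧ j ≫ φ = g := by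
  obtain ⟨H, hH⟩ := h
  exact ⟨biprod.lift (𝟙 x) (B.ι.app x), biprod.inl, biprod.desc g H, by simp, by simp,
    by rw [biprod.lift_desc, ← hH]; simp, by simp⟩

/-- The cylinder projection becomes invertible because `CK` is contractible, so inverting the
homotopy equivalences already identifies homotopic morphisms. -/
lemma isLocalization_toHb (E : ExactStructure C) :
    (toHb C).IsLocalization ((MorphismProperty.isomorphisms _).inverseImage (toHb C)) := by
  refine Functor.isLocalization_of_essSurj_of_full_of_exists_cylinders _ _ (fun _ _ _ h => h) ?_
  intro K L f g h
  obtain ⟨i, j, φ, h₁, h₂, h₃, h₄⟩ :=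
    (bicomplicialChB E).exists_cylinder ((homotopic_iff E f g).2 h)
  refine ⟨⟨_, i, j, biprod.fst, h₁, h₂⟩, ⟨φ, h₃, h₄⟩, ?_⟩
  refine ⟨(toHb C).map biprod.inl, ?_, ?_⟩
  · have h₀ : (toHb C).map (biprod.snd ≫ biprod.inr :
        K ⊞ (coneB C).obj K ⟶ K ⊞ (coneB C).obj K) = 0 := by
      rw [Functor.map_comp, (isZero_toHb_coneB E K).eq_of_tgt ((toHb C).map biprod.snd) 0,
        zero_comp]
    have h₀' : (toHb C).map (biprod.fst ≫ biprod.inl :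
        K ⊞ (coneB C).obj K ⟶ K ⊞ (coneB C).obj K) = 𝟙 _ := by
      rw [← CategoryTheory.Functor.map_id, ← biprod.total, Functor.map_add, h₀, add_zero]
    exact ((toHb C).map_comp _ _).symm.trans h₀'
  · rw [← Functor.map_comp, biprod.inl_fst, CategoryTheory.Functor.map_id]

end Homotopies

/-! ### Derived categories as localizations of categories of complexes. -/

section Localizations

variable {C D D' : Type*} [Category C] [Category D] [Category D']

/-- Arrowwise essential surjectivity lifts each member of `W` to an arrow of `C`, which then becomes
invertible in `D'`. -/
lemma isLocalization_comp (F : C ⥤ D) (G : D ⥤ D') (V : MorphismProperty C)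
    (W : MorphismProperty D) [F.IsLocalization V] [G.IsLocalization W] [F.mapArrow.EssSurj] :
    (F ⋙ G).IsLocalization ((MorphismProperty.isomorphisms D').inverseImage (F ⋙ G)) := by
  refine Functor.IsLocalization.comp F G V W _ (fun _ _ _ h => h) (fun X Y f hf => ?_)
    (fun X Y f hf => ?_)
  · have := Localization.inverts F V f hf
    exact inferInstanceAs (IsIso (G.map (F.map f)))
  · let e := F.mapArrow.objObjPreimageIso (Arrow.mk f)
    refine ⟨_, _, _, ?_, ⟨e⟩⟩
    have h : MorphismProperty.isomorphisms D' (G.map f) := Localization.inverts G W f hf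
    exact ((MorphismProperty.isomorphisms D').arrow_mk_iso_iff (G.mapArrow.mapIso e)).2 h

end Localizations

section

variable {C : Type u} [Category.{v} C] [Preadditive C] [HasBinaryBiproducts C] [HasZeroObject C]
  (R : RelExact C)

instance : R.projHb.IsLocalization
    ((MorphismProperty.isomorphisms R.Db).inverseImage R.projHb) := by
  have := Localization.essSurj_mapArrow (VerdierQuotient.proj (acyclicHb R.exact))
    (triClosure (acyclicHb R.exact)).trW
  exact isLocalization_comp _ _ (triClosure (acyclicHb R.exact)).trW (triClosure R.image).trW

/-- This is what allows functors and natural isomorphisms on the derived category to be constructed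
from bounded complexes alone. -/
instance : R.proj.IsLocalization R.qw := by
  have := isLocalization_toHb R.exact
  exact isLocalization_comp (toHb C) R.projHb
    ((MorphismProperty.isomorphisms _).inverseImage (toHb C))
    ((MorphismProperty.isomorphisms R.Db).inverseImage R.projHb)

end

/-! ### The universal property of `D_b(C, w)` for triangle functors on the homotopy category. -/

section LiftDb

variable {C : Type u} [Category.{v} C] [Preadditive C] [HasBinaryBiproducts C] [HasZeroObject C]
  (R : RelExact C) {T : Type*} [Category T] [HasZeroObject T] [HasShift T ℤ] [Preadditive T]
  [∀ n : ℤ, (shiftFunctor T n).Additive] [Pretriangulated T]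

lemma RelExact.exists_lift (F : Hb C ⥤ T) [F.CommShift ℤ] [F.IsTriangulated]
    (h : ∀ X, acyclicHb R.exact X → IsZero (F.obj X))
    (h' : ∀ K : ChB C, (∀ n, R.trivial (K.obj.X n)) → IsZero (F.obj ((toHb C).obj K))) :
    ∃ (G : R.Db ⥤ T) (_ : G.CommShift ℤ) (e : R.projHb ⋙ G ≅ F),
      NatTrans.CommShift e.hom ℤ ∧ G.IsTriangulated := by
  obtain ⟨G₁, _, e₁, _, _⟩ := VerdierQuotient.exists_lift (acyclicHb R.exact) F h
  obtain ⟨G₂, _, e₂, _, _⟩ := VerdierQuotient.exists_lift R.image G₁ (by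
    rintro X ⟨K, hK, ⟨e⟩⟩
    exact (h' K hK).of_iso (G₁.mapIso e ≪≫ e₁.app _))
  refine ⟨G₂, inferInstance, Functor.associator _ _ _ ≪≫ Functor.isoWhiskerLeft _ e₂ ≪≫ e₁,
    ?_, inferInstance⟩
  have : NatTrans.CommShift (Functor.isoWhiskerLeft (VerdierQuotient.proj (acyclicHb R.exact))
    e₂).hom ℤ := inferInstanceAs (NatTrans.CommShift (Functor.whiskerLeft _ e₂.hom) ℤ)
  have : NatTrans.CommShift (Functor.associator (VerdierQuotient.proj (acyclicHb R.exact))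
    (VerdierQuotient.proj R.image) G₂).hom ℤ := inferInstance
  exact inferInstanceAs (NatTrans.CommShift ((Functor.associator _ _ _).hom ≫
    ((VerdierQuotient.proj (acyclicHb R.exact)).isoWhiskerLeft e₂).hom ≫ e₁.hom) ℤ)

end LiftDb

/-! ### A criterion for membership of the complexes that vanish in the derived category. -/

section AcyclicClasses

variable {C : Type u} [Category.{v} C] [Preadditive C] [HasBinaryBiproducts C]

open CochainComplex in
/-- The conflation `L ⟶ mcB f ⟶ TK` attached to a morphism `f : K ⟶ L`. -/
noncomputable def mcB.shortComplex {K L : ChB C} (f : K ⟶ L) : ShortComplex (ChB C) :=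
  ShortComplex.mk (X₂ := mcB f) (X₃ := suspB.obj K) (mcB.inr f)
    (ObjectProperty.homMk (mappingCone.triangle f.hom).mor₃ : mcB f ⟶ suspB.obj K)
    (by ext : 1; exact mappingCone.inr_triangleδ f.hom)

variable [HasZeroObject C]

open CochainComplex in
lemma mcB.degreewise_shortComplex (E : ExactStructure C) {K L : ChB C} (f : K ⟶ L) :
    degreewise E (mcB.shortComplex f) := fun n => by
  let e : K.obj.X (n + 1) ⊞ L.obj.X n ≅ (mappingCone f.hom).X n :=
    { hom := biprod.desc ((mappingCone.inl f.hom).v (n + 1) n (by omega))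
        ((mappingCone.inr f.hom).f n)
      inv := biprod.lift ((mappingCone.fst f.hom).1.v n (n + 1) rfl)
        ((mappingCone.snd f.hom).v n n (add_zero n))
      hom_inv_id := by ext <;> simp
      inv_hom_id := by
        simp [mappingCone.ext_from_iff f.hom (n + 1) n rfl] }
  refine E.of_iso (ShortComplex.isoMk
    (S₁ := ShortComplex.mk (biprod.inr : L.obj.X n ⟶ K.obj.X (n + 1) ⊞ L.obj.X n) biprod.fst
      biprod.inr_fst) (S₂ := (mcB.shortComplex f).map (evalB n)) (Iso.refl (L.obj.X n)) e
    -- The third morphism of the mapping cone triangle is minus the projection, whence the sign.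
    (-Iso.refl (K.obj.X (n + 1))) ?_ ?_)
    (E.conflation_inr_fst (K.obj.X (n + 1)) (L.obj.X n))
  · exact (Category.id_comp _).trans (biprod.inr_desc _ _).symm
  · have h₁ := mappingCone.inl_v_triangle_mor₃_f f.hom (n + 1) n (by omega)
    have h₂ := mappingCone.inr_f_triangle_mor₃_f f.hom n
    refine biprod.hom_ext' _ _ ?_ ?_
    · refine (Category.assoc _ _ _).symm.trans
        ((congrArg (· ≫ _) (biprod.inl_desc _ _)).trans (h₁.trans ?_))
      refine Eq.trans ?_ (Category.assoc _ _ _)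
      refine Eq.trans ?_ (congrArg (· ≫ _) biprod.inl_fst.symm)
      exact (Category.id_comp _).symm
    · refine (Category.assoc _ _ _).symm.trans
        ((congrArg (· ≫ _) (biprod.inr_desc _ _)).trans (h₂.trans ?_))
      refine Eq.trans ?_ (Category.assoc _ _ _)
      refine Eq.trans ?_ (congrArg (· ≫ _) biprod.inr_fst.symm)
      exact zero_comp.symm

lemma strictlyAcyclic_of_isZero (E : ExactStructure C) {K : CochainComplex C ℤ}
    (h : ∀ n, IsZero (K.X n)) : StrictlyAcyclic E K :=
  ⟨fun n => K.X n, fun _ => 𝟙 _, fun n => 0, fun n => comp_zero,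
    fun n => by
      have := ExactStructure.conflation_of_isZero_right (E := E) (h (n + 1)) (𝟙 (K.X n)) 0
      exact this,
    fun n => (h n).eq_of_src _ _⟩

lemma acyclicHb_of_isZero (E : ExactStructure C) {X : Hb C} (h : IsZero X) : acyclicHb E X := by
  refine ⟨0, strictlyAcyclic_of_isZero E fun n =>
    (HomologicalComplex.eval C (ComplexShape.up ℤ) n).map_isZero (Limits.isZero_zero _), ⟨?_⟩⟩
  exact ((boundedHo C).ι.map_isZero h).iso
    ((HomotopyCategory.quotient C (ComplexShape.up ℤ)).map_isZero (Limits.isZero_zero _))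

variable (R : RelExact C) (P : ObjectProperty (ChB C))

/-- A class of bounded complexes which contains the acyclic complexes and the complexes with
trivial terms, which satisfies the two-out-of-three property for degreewise conflations, and which
is stable under retracts. -/
structure RelExact.IsAcyclicClass : Prop where
  X₁ : ∀ {S : ShortComplex (ChB C)}, degreewise R.exact S → P S.X₂ → P S.X₃ → P S.X₁
  X₂ : ∀ {S : ShortComplex (ChB C)}, degreewise R.exact S → P S.X₁ → P S.X₃ → P S.X₂
  X₃ : ∀ {S : ShortComplex (ChB C)}, degreewise R.exact S → P S.X₁ → P S.X₂ → P S.X₃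
  of_retract : ∀ {K L : ChB C}, Retract K L → P L → P K
  of_acyclicHb : ∀ {K : ChB C}, acyclicHb R.exact ((toHb C).obj K) → P K
  of_trivial : ∀ {K : ChB C}, (∀ n, R.trivial (K.obj.X n)) → P K

namespace RelExact.IsAcyclicClass

variable {R P} (hP : R.IsAcyclicClass P)

include hP

lemma coneB (K : ChB C) : P ((coneB C).obj K) :=
  hP.of_acyclicHb (acyclicHb_of_isZero _ (isZero_toHb_coneB R.exact K))

lemma suspB_iff (K : ChB C) : P (suspB.obj K) ↔ P K :=
  ⟨fun h => hP.X₁ ((bicomplicialChB R.exact).conflation_ι_π K) (hP.coneB K) h,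
    fun h => hP.X₃ ((bicomplicialChB R.exact).conflation_ι_π K) h (hP.coneB K)⟩

lemma mcB {K L : ChB C} (f : K ⟶ L) (hK : P K) (hL : P L) : P (mcB f) :=
  hP.X₂ (mcB.degreewise_shortComplex R.exact f) hL ((hP.suspB_iff K).2 hK)

lemma of_isZero_toHb {K : ChB C} (h : IsZero ((toHb C).obj K)) : P K :=
  hP.of_acyclicHb (acyclicHb_of_isZero _ h)

/-- The mapping cone of a homotopy equivalence is contractible, hence in `P`; two-out-of-three in `L
⟶ mcB f ⟶ TK` does the rest. -/
lemma of_isIso {K L : ChB C} (f : K ⟶ L) (hf : IsIso ((toHb C).map f)) (h : P K) : P L :=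
  hP.X₁ (mcB.degreewise_shortComplex R.exact f)
    (hP.of_isZero_toHb ((mcB.isIso_map_iff (𝟭 _) f).1 hf)) ((hP.suspB_iff K).2 h)

lemma of_iso_toHb {K L : ChB C} (e : (toHb C).obj K ≅ (toHb C).obj L) (h : P L) : P K := by
  obtain ⟨f, hf⟩ := (toHb C).map_surjective e.inv
  exact hP.of_isIso f (hf ▸ inferInstance) h

lemma biprod {K L : ChB C} (hK : P K) (hL : P L) : P (K ⊞ L) :=
  hP.X₂ (R.exact.chB.conflation_inr_fst K L) hL hK

end RelExact.IsAcyclicClass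

/-- The objects of the bounded homotopy category which are isomorphic to a complex in a given
class. -/
def isoClassHb : ObjectProperty (Hb C) := fun X => ∃ K, P K ∧ Nonempty (X ≅ (toHb C).obj K)

instance : (isoClassHb P).IsClosedUnderIsomorphisms where
  of_iso := by
    rintro X Y e ⟨K, hK, ⟨e'⟩⟩
    exact ⟨K, hK, ⟨e.symm ≪≫ e'⟩⟩

variable {R P} in
lemma RelExact.IsAcyclicClass.isTriangulated (hP : R.IsAcyclicClass P) :
    (isoClassHb P).IsTriangulated := by
  have h₃ : (isoClassHb P).IsTriangulatedClosed₃ := .mk' fun T hT h₁ h₂ => by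
    obtain ⟨K, hK, ⟨e₁⟩⟩ := h₁
    obtain ⟨L, hL, ⟨e₂⟩⟩ := h₂
    obtain ⟨f, hf⟩ := (toHb C).map_surjective (e₁.inv ≫ T.mor₁ ≫ e₂.hom)
    exact ⟨DerivedGW.mcB f, hP.mcB f hK hL, ⟨Triangle.π₃.mapIso (isoTriangleOfIso₁₂ _ _ hT
      (mcB.distinguished f) e₁ e₂
      (show T.mor₁ ≫ e₂.hom = e₁.hom ≫ (toHb C).map f by simp [hf]))⟩⟩
  have h₀ : isoClassHb P 0 := ⟨0, hP.of_isZero_toHb ((toHb C).map_isZero (Limits.isZero_zero _)),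
    ⟨(Limits.isZero_zero (Hb C)).iso ((toHb C).map_isZero (Limits.isZero_zero (ChB C)))⟩⟩
  have hs (X : Hb C) (h : isoClassHb P X) : isoClassHb P (X⟦(1 : ℤ)⟧) :=
    ObjectProperty.ext_of_isTriangulatedClosed₃ _ _ (contractible_distinguished₂ X) h h₀
  -- Desuspension: if `L` represents `X⟦-1⟧`, the cone of `L ⟶ 0` represents `X`, so it lies in `P`.
  -- The conflation `0 ⟶ mcB f ⟶ TL` then puts `TL`, and so `L`, in `P`.
  have hs' (X : Hb C) (h : isoClassHb P X) : isoClassHb P (X⟦(-1 : ℤ)⟧) := by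
    obtain ⟨K, hK, ⟨e⟩⟩ := h
    let L := (toHb C).objPreimage (X⟦(-1 : ℤ)⟧)
    let e' : (toHb C).obj L ≅ X⟦(-1 : ℤ)⟧ := (toHb C).objObjPreimageIso _
    let f : L ⟶ 0 := 0
    have : IsIso (mcB.δ f) := (Triangle.isZero₂_iff_isIso₃ _ (mcB.distinguished f)).1
      ((toHb C).map_isZero (Limits.isZero_zero (ChB C)))
    have h₁ : P (DerivedGW.mcB f) := hP.of_iso_toHb (asIso (mcB.δ f) ≪≫
      (shiftFunctor _ (1 : ℤ)).mapIso e' ≪≫ (shiftEquiv (Hb C) (1 : ℤ)).counitIso.app X ≪≫ e) hK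
    exact ⟨L, (hP.suspB_iff L).1 (hP.X₃ (mcB.degreewise_shortComplex R.exact f)
      (hP.of_isZero_toHb ((toHb C).map_isZero (Limits.isZero_zero _))) h₁), ⟨e'.symm⟩⟩
  have : (isoClassHb P).IsStableUnderShift ℤ := ⟨fun n => ⟨fun X hX => by
    rw [ObjectProperty.prop_shift_iff]
    induction n using Int.induction_on with
    | zero => exact (isoClassHb P).prop_of_iso ((shiftFunctorZero _ ℤ).app X).symm hX
    | succ n hn => exact (isoClassHb P).prop_of_iso ((shiftFunctorAdd _ _ _).app X).symm (hs _ hn)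
    | pred n hn =>
      exact (isoClassHb P).prop_of_iso ((shiftFunctorAdd _ _ _).app X).symm (hs' _ hn)⟩⟩
  exact { exists_zero := ⟨0, Limits.isZero_zero _, h₀⟩
          toIsTriangulatedClosed₂ := .of_isTriangulatedClosed₃ }

variable {R P} in
/-- A complex which vanishes in the derived category belongs to every class of acyclic
complexes. -/
theorem RelExact.IsAcyclicClass.of_isZero_proj (hP : R.IsAcyclicClass P) {K : ChB C}
    (h : IsZero (R.proj.obj K)) : P K := by
  have := hP.isTriangulated
  let F := VerdierQuotient.proj (isoClassHb P)
  -- The quotient of `H_b` by `P` receives a functor from `D_b`, so `K` vanishes there too; what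
  -- remains is closure of `P` under retracts in the homotopy category.
  obtain ⟨G, _, e, _, _⟩ := R.exists_lift F
    (fun X hX => by
      let e := (toHb C).objObjPreimageIso X
      refine VerdierQuotient.isZero_proj _ ⟨_, hP.of_acyclicHb ?_, ⟨e.symm⟩⟩
      obtain ⟨K, hK, ⟨e'⟩⟩ := hX
      exact ⟨K, hK, ⟨(boundedHo C).ι.mapIso e ≪≫ e'⟩⟩)
    (fun L hL => VerdierQuotient.isZero_proj _ ⟨L, hP.of_trivial hL, ⟨Iso.refl _⟩⟩)
  have h' : IsZero (F.obj ((toHb C).obj K)) :=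
    (G.map_isZero h).of_iso (e.app ((toHb C).obj K)).symm
  obtain ⟨L, hL, ⟨e'⟩⟩ := VerdierQuotient.of_isZero h' (isoClassHb P) le_rfl (by
    rintro Y Z r ⟨L, hL, ⟨e⟩⟩
    obtain ⟨K, ⟨e'⟩⟩ : ∃ K, Nonempty ((toHb C).obj K ≅ Y) :=
      ⟨_, ⟨(toHb C).objObjPreimageIso Y⟩⟩
    refine ⟨K, ?_, ⟨e'.symm⟩⟩
    obtain ⟨i, hi⟩ := (toHb C).map_surjective (e'.hom ≫ r.i ≫ e.hom)
    obtain ⟨p, hp⟩ := (toHb C).map_surjective (e.inv ≫ r.r ≫ e'.inv)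
    -- A retract up to homotopy of `L` is a strict retract of `L ⊞ CK`: the homotopy `𝟙 - i ≫ p = ι
    -- ≫ H` supplies the missing component through `CK`.
    obtain ⟨H, hH⟩ := (homotopic_iff R.exact (𝟙 K) (i ≫ p)).2 (by
      rw [Functor.map_comp, hi, hp]; simp)
    refine hP.of_retract (L := L ⊞ (bicomplicialChB R.exact).C.obj K)
      ⟨biprod.lift i ((bicomplicialChB R.exact).ι.app K), biprod.desc p H, ?_⟩
      (hP.biprod hL (hP.coneB _))
    rw [biprod.lift_desc, ← hH, add_sub_cancel])
  exact hP.of_iso_toHb e' hL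

end AcyclicClasses

/-! ### Trivial objects and weak equivalences in a bicomplicial pair. -/

section Pair

variable {A : Type u} [Category.{v} A] [Preadditive A]

namespace Bicomplicial

variable {E : ExactStructure A} (B : Bicomplicial E)

lemma ι_naturality {x y : A} (f : x ⟶ y) : B.ι.app x ≫ B.C.map f = f ≫ B.ι.app y :=
  (B.ι.naturality f).symm

lemma homotopic_refl {x y : A} (f : x ⟶ y) : B.homotopic f f := ⟨0, by simp⟩

instance : Congruence B.homotopic where
  equivalence :=
    { refl := B.homotopic_refl
      symm := fun ⟨H, hH⟩ => ⟨-H, by rw [Preadditive.comp_neg, ← hH, neg_sub]⟩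
      trans := fun ⟨H, hH⟩ ⟨H', hH'⟩ =>
        ⟨H + H', by rw [Preadditive.comp_add, ← hH, ← hH', sub_add_sub_cancel]⟩ }
  comp_left f _ _ := by
    rintro ⟨H, hH⟩
    exact ⟨B.C.map f ≫ H, by
      rw [← Preadditive.comp_sub, hH, ← Category.assoc, ← Category.assoc, B.ι_naturality]⟩
  comp_right g := by
    rintro ⟨H, hH⟩
    exact ⟨H ≫ g, by rw [← Preadditive.sub_comp, hH, Category.assoc]⟩

lemma toHo_map_eq_iff {x y : A} (f g : x ⟶ y) : B.toHo.map f = B.toHo.map g ↔ B.homotopic f g :=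
  Quotient.functor_map_eq_iff _ _ _

lemma isHomotopyEquiv_iff {x y : A} (f : x ⟶ y) : B.IsHomotopyEquiv f ↔ IsIso (B.toHo.map f) := by
  constructor
  · rintro ⟨g, h₁, h₂⟩
    refine ⟨B.toHo.map g, ?_, ?_⟩
    · rw [← Functor.map_comp, ← CategoryTheory.Functor.map_id]
      exact (B.toHo_map_eq_iff _ _).2 h₁
    · rw [← Functor.map_comp, ← CategoryTheory.Functor.map_id]
      exact (B.toHo_map_eq_iff _ _).2 h₂
  · intro h
    obtain ⟨g, hg⟩ := B.toHo.map_surjective (inv (B.toHo.map f))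
    refine ⟨g, (B.toHo_map_eq_iff _ _).1 ?_, (B.toHo_map_eq_iff _ _).1 ?_⟩
    · rw [Functor.map_comp, hg, IsIso.hom_inv_id, CategoryTheory.Functor.map_id]
    · rw [Functor.map_comp, hg, IsIso.inv_hom_id, CategoryTheory.Functor.map_id]

lemma IsConeSequence.conflation {B : Bicomplicial E} {x y z : A} {f : x ⟶ y} {κ : y ⟶ z}
    {ψ : z ⟶ B.T.obj x} (h : B.IsConeSequence f κ ψ) : ∃ w, E.conflation (ShortComplex.mk κ ψ w) := by
  obtain ⟨μ, hμ, h₁, h₂⟩ := h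
  exact ⟨h₁, ExactStructure.conflation_of_isPushout (B.conflation_ι_π x) hμ.flip h₂ h₁⟩

lemma exists_isConeSequence {x y : A} (f : x ⟶ y) :
    ∃ (z : A) (κ : y ⟶ z) (ψ : z ⟶ B.T.obj x), B.IsConeSequence f κ ψ := by
  obtain ⟨z, μ, κ, sq, -⟩ := E.pushout (B.ι.app x) f ⟨_, _, _, B.conflation_ι_π x⟩
  exact ⟨z, κ, sq.flip.desc 0 (B.π.app x) (by simp [B.ι_π]), μ, sq.flip,
    sq.flip.inl_desc _ _ _, sq.flip.inr_desc _ _ _⟩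

end Bicomplicial

variable [HasZeroObject A] [HasBinaryBiproducts A]

namespace RelExact.IsBicomplicialPair

variable {R : RelExact A} {B : Bicomplicial R.exact} (hB : R.IsBicomplicialPair B)

include hB

lemma of_isIso {x y : A} (f : x ⟶ y) [IsIso f] : R.w f :=
  hB.of_homotopyEquiv f ((B.isHomotopyEquiv_iff f).2 inferInstance)

lemma comp {x y z : A} {f : x ⟶ y} {g : y ⟶ z} (hf : R.w f) (hg : R.w g) : R.w (f ≫ g) :=
  R.isMultiplicative.comp_mem f g hf hg

lemma of_precomp {x y z : A} {f : x ⟶ y} {g : y ⟶ z} (hf : R.w f) (h : R.w (f ≫ g)) : R.w g :=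
  hB.saturated.of_precomp f g hf h

lemma of_postcomp {x y z : A} {f : x ⟶ y} {g : y ⟶ z} (hg : R.w g) (h : R.w (f ≫ g)) : R.w f :=
  hB.saturated.of_postcomp f g hg h

lemma w_from_zero_iff {x z : A} (hz : IsZero z) (f : z ⟶ x) : R.w f ↔ R.trivial x := by
  have : IsIso (R.isZero_zero.to_ z) := R.isZero_zero.isIso hz _
  have h : R.isZero_zero.to_ z ≫ f = R.isZero_zero.to_ x := R.isZero_zero.eq_of_src _ _
  refine ⟨fun hf => ?_, fun hx => hB.of_precomp (hB.of_isIso (R.isZero_zero.to_ z)) ?_⟩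
  · rw [RelExact.trivial, ← h]
    exact hB.comp (hB.of_isIso _) hf
  · rw [h]
    exact hx

lemma w_to_zero_iff {x z : A} (hz : IsZero z) (f : x ⟶ z) : R.w f ↔ R.trivial x := by
  have : IsIso (R.isZero_zero.to_ x ≫ f) := R.isZero_zero.isIso hz _
  exact ⟨fun hf => hB.of_postcomp hf (hB.of_isIso (R.isZero_zero.to_ x ≫ f)),
    fun hx => hB.of_precomp hx (hB.of_isIso (R.isZero_zero.to_ x ≫ f))⟩

lemma trivial_of_isZero {x : A} (hx : IsZero x) : R.trivial x :=
  (hB.w_from_zero_iff hx (𝟙 x)).1 (hB.of_isIso _)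

lemma trivial_iff {x y : A} {f : x ⟶ y} (hf : R.w f) : R.trivial x ↔ R.trivial y := by
  have h : R.isZero_zero.to_ x ≫ f = R.isZero_zero.to_ y := R.isZero_zero.eq_of_src _ _
  refine ⟨fun hx => ?_, fun hy => hB.of_postcomp hf ?_⟩
  · rw [RelExact.trivial, ← h]
    exact hB.comp hx hf
  · rw [h]
    exact hy

lemma w_of_trivial {x y : A} (f : x ⟶ y) (hx : R.trivial x) (hy : R.trivial y) : R.w f := by
  have h : R.isZero_zero.to_ x ≫ f = R.isZero_zero.to_ y := R.isZero_zero.eq_of_src _ _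
  exact hB.of_precomp hx (h ▸ hy)

/-- The morphism `r` contracts `Cx`, since `ι_C r = 𝟙`. -/
lemma trivial_C (x : A) : R.trivial (B.C.obj x) :=
  (hB.w_from_zero_iff (Limits.isZero_zero A) 0).1 (hB.of_homotopyEquiv _ ⟨0,
    by rw [(Limits.isZero_zero A).eq_of_src (0 ≫ 0) (𝟙 _)]; exact B.homotopic_refl _,
    -B.r.app x, by rw [zero_comp, zero_sub, Preadditive.comp_neg]; exact congrArg _ (B.ι_r x).symm⟩)

/-- The extension axiom is applied to the morphism from the conflation to `0 ⟶ X₃ ⟶ X₃`, whose outer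
components are `X₁ ⟶ 0` and the identity. -/
lemma w_g {S : ShortComplex A} (hS : R.exact.conflation S) (h : R.trivial S.X₁) : R.w S.g :=
  hB.extensional (S' := ShortComplex.mk (0 : 0 ⟶ S.X₃) (𝟙 S.X₃) zero_comp)
    { τ₁ := 0, τ₂ := S.g, τ₃ := 𝟙 _ } hS
    (ExactStructure.conflation_of_isZero_left (Limits.isZero_zero A) 0 (𝟙 S.X₃))
    ((hB.w_to_zero_iff (Limits.isZero_zero A) _).2 h) (hB.of_isIso _)

lemma w_f {S : ShortComplex A} (hS : R.exact.conflation S) (h : R.trivial S.X₃) : R.w S.f :=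
  hB.extensional (S := ShortComplex.mk (𝟙 S.X₁) (0 : S.X₁ ⟶ 0) comp_zero) (S' := S)
    { τ₁ := 𝟙 _, τ₂ := S.f, τ₃ := 0 }
    (ExactStructure.conflation_of_isZero_right (Limits.isZero_zero A) (𝟙 S.X₁) 0) hS
    (hB.of_isIso _) ((hB.w_from_zero_iff (Limits.isZero_zero A) _).2 h)

lemma w_fst {x y : A} (hy : R.trivial y) : R.w (biprod.fst : x ⊞ y ⟶ x) :=
  hB.w_g (R.exact.conflation_inr_fst x y) hy

lemma w_snd {x y : A} (hx : R.trivial x) : R.w (biprod.snd : x ⊞ y ⟶ y) :=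
  hB.w_g (ExactStructure.conflation_inl_snd x y) hx

/-- Comparing the conflation `x ⟶ Cx ⟶ Tx` with its pushout `y ⟶ z ⟶ Tx`, the extension axiom makes
`Cx ⟶ z` a weak equivalence. -/
lemma trivial_of_w {x y z : A} {f : x ⟶ y} {κ : y ⟶ z} {ψ : z ⟶ B.T.obj x}
    (h : B.IsConeSequence f κ ψ) (hf : R.w f) : R.trivial z := by
  obtain ⟨w, hS⟩ := h.conflation
  obtain ⟨μ, hμ, h₁, h₂⟩ := h
  have : R.w μ := hB.extensional
    (S := ShortComplex.mk (B.ι.app x) (B.π.app x) (B.ι_π x)) (S' := ShortComplex.mk κ ψ w)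
    { τ₁ := f, τ₂ := μ, τ₃ := 𝟙 _, comm₁₂ := hμ.w, comm₂₃ := by simpa using h₂ }
    (B.conflation_ι_π x) hS hf (hB.of_isIso _)
  exact (hB.trivial_iff this).1 (hB.trivial_C x)

/-- Up to the projection away from the trivial object `Cx`, the morphism `f` is the inflation `x ⟶
Cx ⊞ y`, whose cokernel is the cone. -/
lemma w_of_trivial_cone {x y z : A} {f : x ⟶ y} {κ : y ⟶ z} {ψ : z ⟶ B.T.obj x}
    (h : B.IsConeSequence f κ ψ) (hz : R.trivial z) : R.w f := by
  obtain ⟨μ, hμ, -, -⟩ := h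
  have := hB.w_f (ExactStructure.conflation_biprod_of_isPushout
    ⟨_, _, _, B.conflation_ι_π x⟩ hμ.flip) hz
  simpa using hB.comp this (hB.w_snd (hB.trivial_C x))

lemma trivial_T_iff (x : A) : R.trivial (B.T.obj x) ↔ R.trivial x :=
  ⟨fun h => (hB.trivial_iff (hB.w_f (B.conflation_ι_π x) h)).2 (hB.trivial_C x),
    fun h => (hB.trivial_iff (hB.w_g (B.conflation_ι_π x) h)).1 (hB.trivial_C x)⟩

/-- The mapping cone of the inflation `S.f` maps onto its cokernel with kernel `Cx`, so cone and
cokernel are weakly equivalent. -/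
lemma trivial_X₃_of_w {S : ShortComplex A} (hS : R.exact.conflation S) (h : R.w S.f) :
    R.trivial S.X₃ := by
  obtain ⟨z, κ, ψ, hz⟩ := B.exists_isConeSequence S.f
  have hz' := hB.trivial_of_w hz h
  obtain ⟨μ, sq, -, -⟩ := hz
  have := ExactStructure.conflation_of_isPushout hS sq (sq.inl_desc S.g 0 (by simp))
    (sq.inr_desc _ _ _)
  exact (hB.trivial_iff (hB.w_g this (hB.trivial_C _))).1 hz'

/-- `S.g` is `κ : X₂ ⟶ Cone S.f` followed by the weak equivalence onto `X₃`. Thus `κ` is in `w`, and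
its cokernel is `T X₁`. -/
lemma trivial_X₁_of_w {S : ShortComplex A} (hS : R.exact.conflation S) (h : R.w S.g) :
    R.trivial S.X₁ := by
  obtain ⟨z, κ, ψ, hz⟩ := B.exists_isConeSequence S.f
  obtain ⟨w, hc⟩ := hz.conflation
  obtain ⟨μ, sq, -, -⟩ := hz
  have := ExactStructure.conflation_of_isPushout hS sq (sq.inl_desc S.g 0 (by simp))
    (sq.inr_desc _ _ _)
  have h₁ := hB.w_g this (hB.trivial_C _)
  have h₂ : R.w κ := hB.of_postcomp h₁ (by dsimp; rwa [sq.inl_desc])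
  exact (hB.trivial_T_iff _).1 (hB.trivial_X₃_of_w hc h₂)

lemma trivial_X₁ {S : ShortComplex A} (hS : R.exact.conflation S) (h₂ : R.trivial S.X₂)
    (h₃ : R.trivial S.X₃) : R.trivial S.X₁ :=
  (hB.trivial_iff (hB.w_f hS h₃)).2 h₂

lemma trivial_X₂ {S : ShortComplex A} (hS : R.exact.conflation S) (h₁ : R.trivial S.X₁)
    (h₃ : R.trivial S.X₃) : R.trivial S.X₂ :=
  (hB.trivial_iff (hB.w_f hS h₃)).1 h₁

lemma trivial_X₃ {S : ShortComplex A} (hS : R.exact.conflation S) (h₁ : R.trivial S.X₁)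
    (h₂ : R.trivial S.X₂) : R.trivial S.X₃ :=
  (hB.trivial_iff (hB.w_g hS h₁)).1 h₂

lemma w_of_homotopic {x y : A} {f g : x ⟶ y} (h : B.homotopic f g) (hf : R.w f) : R.w g := by
  obtain ⟨i, j, φ, h₁, h₂, rfl, rfl⟩ := B.exists_cylinder h
  have hp : R.w (biprod.fst : x ⊞ B.C.obj x ⟶ x) := hB.w_fst (hB.trivial_C x)
  have hi : R.w i := hB.of_postcomp hp (by rw [h₁]; exact hB.of_isIso _)
  have hj : R.w j := hB.of_postcomp hp (by rw [h₂]; exact hB.of_isIso _)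
  exact hB.comp hj (hB.of_precomp hi hf)

lemma trivial_of_retract (hR : R.IsThick) {x y : A} (r : Retract x y) (hy : R.trivial y) :
    R.trivial x :=
  hR.of_retract (f := R.isZero_zero.to_ x) (g := R.isZero_zero.to_ y)
    { i := Arrow.homMk (𝟙 _) r.i (R.isZero_zero.eq_of_src _ _)
      r := Arrow.homMk (𝟙 _) r.r (R.isZero_zero.eq_of_src _ _)
      retract := by ext <;> simp } hy

end RelExact.IsBicomplicialPair

end Pair

/-! ### Left fractions for weak equivalences: `𝒯` is the localization of the pair at `w`. -/

section PairHo

variable {A : Type u} [Category.{v} A] [Preadditive A] [HasZeroObject A] [HasBinaryBiproducts A]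

namespace RelExact.IsBicomplicialPair

variable {R : RelExact A} {B : Bicomplicial R.exact} (hB : R.IsBicomplicialPair B)

include hB

lemma exists_inflation {x y : A} {s : x ⟶ y} (hs : R.w s) :
    ∃ (z : A) (q : B.C.obj x ⊞ y ⟶ z) (w : biprod.lift (B.ι.app x) s ≫ q = 0),
      R.exact.conflation (ShortComplex.mk (biprod.lift (B.ι.app x) s) q w) ∧ R.trivial z := by
  obtain ⟨z, κ, ψ, hz⟩ := B.exists_isConeSequence s
  have hz' := hB.trivial_of_w hz hs
  obtain ⟨μ, sq, -, -⟩ := hz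
  exact ⟨z, _, _, ExactStructure.conflation_biprod_of_isPushout
    ⟨_, _, _, B.conflation_ι_π x⟩ sq.flip, hz'⟩

/-- Adding `Cx'` to the target turns `s` into an inflation with trivial cokernel, which can be
pushed out along `f`. The square for `s` alone commutes up to the homotopy given by the component on
`Cx'`. -/
lemma exists_leftFraction {x x' y : A} {s : x' ⟶ x} (hs : R.w s) (f : x' ⟶ y) :
    ∃ (y' : A) (g : x ⟶ y') (t : y ⟶ y'), R.w t ∧ B.homotopic (f ≫ t) (s ≫ g) := by
  obtain ⟨z, q, w, hS, hz⟩ := hB.exists_inflation hs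
  obtain ⟨y', g', t, sq, -⟩ := R.exact.pushout _ f ⟨_, _, _, hS⟩
  have := ExactStructure.conflation_of_isPushout hS sq (sq.inl_desc q 0 (by simp [w]))
    (sq.inr_desc _ _ _)
  refine ⟨y', biprod.inr ≫ g', t, hB.w_f this hz, biprod.inl ≫ g', ?_⟩
  rw [← sq.w, biprod.lift_eq]
  simp

/-- A homotopy between `s ≫ f` and `s ≫ g` makes `f - g` factor, after inclusion of its source in
`Cx' ⊞ x`, through the trivial cokernel `z` as `k : z ⟶ y`. The morphism `t` from `y` to the cone of
`k` makes `k` null-homotopic, and it lies in `w` because its cokernel is `Tz`. -/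
lemma exists_equalizing {x x' y : A} {s : x' ⟶ x} (hs : R.w s) {f g : x ⟶ y}
    (h : B.homotopic (s ≫ f) (s ≫ g)) :
    ∃ (y' : A) (t : y ⟶ y'), R.w t ∧ B.homotopic (f ≫ t) (g ≫ t) := by
  obtain ⟨H, hH⟩ := h
  obtain ⟨z, q, w, hS, hz⟩ := hB.exists_inflation hs
  obtain ⟨k, hk⟩ := ExactStructure.exists_desc hS (biprod.desc (-H) (f - g)) (by simp [hH])
  obtain ⟨y', μ, t, sq, -⟩ := R.exact.pushout (B.ι.app z) k ⟨_, _, _, B.conflation_ι_π z⟩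
  have := ExactStructure.conflation_of_isPushout (B.conflation_ι_π z) sq
    (sq.inl_desc (B.π.app z) 0 (by simp [B.ι_π])) (sq.inr_desc _ _ _)
  refine ⟨y', t, hB.w_f this ((hB.trivial_T_iff z).2 hz), B.C.map (biprod.inr ≫ q) ≫ μ, ?_⟩
  rw [← Category.assoc, B.ι_naturality, Category.assoc, sq.w, ← Preadditive.sub_comp]
  dsimp at hk
  rw [Category.assoc, reassoc_of% hk, biprod.inr_desc_assoc]

lemma isTriangulatedSubcategory : B.triangleData.IsTriangulatedSubcategory (R.trivialHo B) where
  of_iso {x y} e h := by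
    obtain ⟨f, hf⟩ := B.toHo.map_surjective (X := x.as) (Y := y.as) e.hom
    have : IsIso (B.toHo.map f) := by rw [hf]; infer_instance
    exact (hB.trivial_iff (hB.of_homotopyEquiv f ((B.isHomotopyEquiv_iff f).2 this))).1 h
  susp_iff x := hB.trivial_T_iff x.as
  cone {x y z} f g h := by
    rintro ⟨x', y', z', f', κ, ψ, a, b, c, hc, -⟩ hx hy
    have iso {x : B.Ho} {y : A} (e : x ≅ B.toHo.obj y) : R.trivialHo B x ↔ R.trivial y := by
      obtain ⟨f, hf⟩ := B.toHo.map_surjective (X := x.as) (Y := y) e.hom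
      have : IsIso (B.toHo.map f) := by rw [hf]; infer_instance
      exact hB.trivial_iff (hB.of_homotopyEquiv f ((B.isHomotopyEquiv_iff f).2 this))
    exact (iso c).2 (hB.trivial_of_w hc (hB.w_of_trivial f' ((iso a).1 hx) ((iso b).1 hy)))

/-- The trivial objects already form a strictly full triangulated subcategory, so nothing is added
in forming the Verdier quotient. -/
lemma closure_trivialHo (x : B.Ho) :
    B.triangleData.closure (R.trivialHo B) x ↔ R.trivialHo B x :=
  ⟨fun h => h _ hB.isTriangulatedSubcategory le_rfl, fun h _ _ hN => hN _ h⟩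

lemma exact_of_isConeSequence {x y z : A} {f : x ⟶ y} {κ : y ⟶ z} {ψ : z ⟶ B.T.obj x}
    (h : B.IsConeSequence f κ ψ) : B.triangleData.exact (x := B.toHo.obj x) (B.toHo.map f)
      (B.toHo.map κ) (B.toHo.map ψ) :=
  ⟨x, y, z, f, κ, ψ, Iso.refl _, Iso.refl _, Iso.refl _, h, by simp, by simp, by
    erw [B.suspHo.map_id, Category.comp_id, Category.id_comp]⟩

lemma verdierW_map_iff {x y : A} (f : x ⟶ y) :
    B.triangleData.verdierW (R.trivialHo B) (B.toHo.map f) ↔ R.w f := by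
  constructor
  · rintro ⟨z, g, h, ⟨x', y', z', f', κ, ψ, a, b, c, hc, hf, -⟩, hz⟩
    rw [hB.closure_trivialHo] at hz
    have h₁ := hB.w_of_trivial_cone hc (hB.isTriangulatedSubcategory.of_iso c hz)
    obtain ⟨a', ha⟩ := B.toHo.map_surjective (X := x) (Y := x') a.hom
    obtain ⟨b', hb⟩ := B.toHo.map_surjective (X := y) (Y := y') b.hom
    have ha' : R.w a' := hB.of_homotopyEquiv _ ((B.isHomotopyEquiv_iff a').2 (ha ▸ inferInstance))
    have hb' : R.w b' := hB.of_homotopyEquiv _ ((B.isHomotopyEquiv_iff b').2 (hb ▸ inferInstance))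
    refine hB.of_postcomp hb' (hB.w_of_homotopic ((B.toHo_map_eq_iff (a' ≫ f') (f ≫ b')).1 ?_)
      (hB.comp ha' h₁))
    rw [Functor.map_comp, Functor.map_comp, ha, hb]
    exact hf.symm
  · intro hf
    obtain ⟨z, κ, ψ, hz⟩ := B.exists_isConeSequence f
    exact ⟨B.toHo.obj z, _, _, hB.exact_of_isConeSequence hz,
      (hB.closure_trivialHo _).2 (hB.trivial_of_w hz hf)⟩

lemma hasLeftCalculusOfFractions :
    (B.triangleData.verdierW (R.trivialHo B)).HasLeftCalculusOfFractions where
  id_mem X := by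
    have := (hB.verdierW_map_iff (𝟙 X.as)).2 (hB.of_isIso _)
    rwa [CategoryTheory.Functor.map_id] at this
  comp_mem {X Y Z} f g hf hg := by
    obtain ⟨f, rfl⟩ := B.toHo.map_surjective (X := X.as) (Y := Y.as) f
    obtain ⟨g, rfl⟩ := B.toHo.map_surjective (X := Y.as) (Y := Z.as) g
    rw [← Functor.map_comp]
    exact (hB.verdierW_map_iff _).2 (hB.comp ((hB.verdierW_map_iff _).1 hf)
      ((hB.verdierW_map_iff _).1 hg))
  exists_leftFraction X Y φ := by
    obtain ⟨s, hs, f⟩ := φ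
    rename_i X'
    obtain ⟨s, rfl⟩ := B.toHo.map_surjective (X := X'.as) (Y := X.as) s
    obtain ⟨f, rfl⟩ := B.toHo.map_surjective (X := X'.as) (Y := Y.as) f
    obtain ⟨y', g, t, ht, h⟩ := hB.exists_leftFraction ((hB.verdierW_map_iff _).1 hs) f
    refine ⟨⟨B.toHo.map g, B.toHo.map t, (hB.verdierW_map_iff t).2 ht⟩, ?_⟩
    have := (B.toHo_map_eq_iff _ _).2 h
    rwa [Functor.map_comp, Functor.map_comp] at this
  ext X' X Y f₁ f₂ s hs h := by
    obtain ⟨s, rfl⟩ := B.toHo.map_surjective (X := X'.as) (Y := X.as) s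
    obtain ⟨f₁, rfl⟩ := B.toHo.map_surjective (X := X.as) (Y := Y.as) f₁
    obtain ⟨f₂, rfl⟩ := B.toHo.map_surjective (X := X.as) (Y := Y.as) f₂
    obtain ⟨y', t, ht, h'⟩ := hB.exists_equalizing ((hB.verdierW_map_iff _).1 hs)
      ((B.toHo_map_eq_iff (s ≫ f₁) (s ≫ f₂)).1 (by rwa [Functor.map_comp, Functor.map_comp]))
    refine ⟨_, B.toHo.map t, (hB.verdierW_map_iff t).2 ht, ?_⟩
    have := (B.toHo_map_eq_iff _ _).2 h'
    rwa [Functor.map_comp, Functor.map_comp] at this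

lemma isLocalization_toHo :
    B.toHo.IsLocalization ((MorphismProperty.isomorphisms _).inverseImage B.toHo) := by
  refine Functor.isLocalization_of_essSurj_of_full_of_exists_cylinders _ _ (fun _ _ _ h => h) ?_
  intro x y f g h
  obtain ⟨i, j, φ, h₁, h₂, h₃, h₄⟩ := B.exists_cylinder ((B.toHo_map_eq_iff f g).1 h)
  refine ⟨⟨_, i, j, biprod.fst, h₁, h₂⟩, ⟨φ, h₃, h₄⟩, ?_⟩
  refine (B.isHomotopyEquiv_iff _).1 ⟨biprod.inl, ?_, ?_⟩
  -- The difference to be contracted is `-(snd ≫ inr)`; naturality of `ι` moves it past `snd`, and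
  -- `ι_C r = 𝟙` finishes.
  · refine ⟨B.C.map biprod.snd ≫ (-B.r.app x) ≫ biprod.inr, ?_⟩
    have h : B.ι.app (B.C.obj x) ≫ (-B.r.app x) ≫ (biprod.inr : B.C.obj x ⟶ x ⊞ B.C.obj x) =
        -biprod.inr := by
      rw [← Category.assoc, Preadditive.comp_neg]
      exact (congrArg (fun a => (-a) ≫ _) (B.ι_r x)).trans (by simp)
    rw [← Category.assoc, B.ι_naturality, Category.assoc, h, sub_eq_iff_eq_add,
      Preadditive.comp_neg]
    have h' : (biprod.fst ≫ biprod.inl : x ⊞ B.C.obj x ⟶ x ⊞ B.C.obj x) =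
        -(biprod.snd ≫ biprod.inr) + 𝟙 _ := by
      rw [← biprod.total]
      abel
    exact h'
  · dsimp
    rw [biprod.inl_fst]
    exact B.homotopic_refl _

/-- First homotopy equivalences are inverted, then the morphisms with trivial cone; by
`verdierW_map_iff` these lift exactly to `w`. -/
lemma isLocalization_projT : (R.projT B).IsLocalization R.w := by
  have := hB.isLocalization_toHo
  have h : (B.triangleData.verdierW (R.trivialHo B)).Q.IsLocalization
    (B.triangleData.verdierW (R.trivialHo B)) := inferInstance
  refine Functor.IsLocalization.comp B.toHo (B.triangleData.verdierW (R.trivialHo B)).Q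
    ((MorphismProperty.isomorphisms _).inverseImage B.toHo)
    (B.triangleData.verdierW (R.trivialHo B)) R.w ?_ ?_ ?_
  · intro x y f hf
    exact h.inverts _ ((hB.verdierW_map_iff f).2 hf)
  · intro x y f hf
    exact hB.of_homotopyEquiv f ((B.isHomotopyEquiv_iff f).2 hf)
  · intro X Y f hf
    obtain ⟨f, rfl⟩ := B.toHo.map_surjective (X := X.as) (Y := Y.as) f
    exact ⟨_, _, f, (hB.verdierW_map_iff f).1 hf, ⟨Iso.refl _⟩⟩

lemma exists_leftFraction₂_projT {x y : A} (g g' : (R.projT B).obj x ⟶ (R.projT B).obj y) :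
    ∃ (y' : A) (f f' : x ⟶ y') (s : y ⟶ y'), R.w s ∧
      g ≫ (R.projT B).map s = (R.projT B).map f ∧
      g' ≫ (R.projT B).map s = (R.projT B).map f' := by
  have := hB.hasLeftCalculusOfFractions
  have h : (B.triangleData.verdierW (R.trivialHo B)).Q.IsLocalization
    (B.triangleData.verdierW (R.trivialHo B)) := inferInstance
  obtain ⟨φ, h₁, h₂⟩ := Localization.exists_leftFraction₂
    (B.triangleData.verdierW (R.trivialHo B)).Q (B.triangleData.verdierW (R.trivialHo B))
    (X := B.toHo.obj x) (Y := B.toHo.obj y) g g'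
  obtain ⟨f, hf⟩ := B.toHo.map_surjective (X := x) (Y := φ.Y'.as) φ.f
  obtain ⟨f', hf'⟩ := B.toHo.map_surjective (X := x) (Y := φ.Y'.as) φ.f'
  obtain ⟨s, hs⟩ := B.toHo.map_surjective (X := y) (Y := φ.Y'.as) φ.s
  refine ⟨φ.Y'.as, f, f', s, (hB.verdierW_map_iff s).1 (hs ▸ φ.hs), ?_, ?_⟩
  · change g ≫ (B.triangleData.verdierW (R.trivialHo B)).Q.map (B.toHo.map s) =
      (B.triangleData.verdierW (R.trivialHo B)).Q.map (B.toHo.map f)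
    rw [hs, hf, h₁]
    exact φ.fst.map_comp_map_s _ _
  · change g' ≫ (B.triangleData.verdierW (R.trivialHo B)).Q.map (B.toHo.map s) =
      (B.triangleData.verdierW (R.trivialHo B)).Q.map (B.toHo.map f')
    rw [hs, hf', h₂]
    exact φ.snd.map_comp_map_s _ _

lemma projT_map_eq_of_homotopic {x y : A} {f g : x ⟶ y} (h : B.homotopic f g) :
    (R.projT B).map f = (R.projT B).map g :=
  congrArg (B.triangleData.verdierW (R.trivialHo B)).Q.map ((B.toHo_map_eq_iff f g).2 h)

end RelExact.IsBicomplicialPair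

end PairHo

/-! ### Functorial mapping cones and the total object of a complex. -/

section ConeFunctor

variable {A : Type u} [Category.{v} A] [Preadditive A] {E : ExactStructure A} (B : Bicomplicial E)

namespace Bicomplicial

/-- The mapping cone of a morphism. -/
noncomputable def coneObj {x y : A} (f : x ⟶ y) : A := (B.exists_isConeSequence f).choose

/-- The inclusion of the target in the mapping cone. -/
noncomputable def coneInr {x y : A} (f : x ⟶ y) : y ⟶ B.coneObj f :=
  (B.exists_isConeSequence f).choose_spec.choose

/-- The morphism from the cone of the source to the mapping cone. -/
noncomputable def coneInl {x y : A} (f : x ⟶ y) : B.C.obj x ⟶ B.coneObj f :=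
  (B.exists_isConeSequence f).choose_spec.choose_spec.choose_spec.choose

lemma isPushout_cone {x y : A} (f : x ⟶ y) :
    IsPushout f (B.ι.app x) (B.coneInr f) (B.coneInl f) :=
  (B.exists_isConeSequence f).choose_spec.choose_spec.choose_spec.choose_spec.1

/-- The functoriality of the mapping cone. -/
noncomputable def coneHom {x y x' y' : A} {f : x ⟶ y} {f' : x' ⟶ y'} (a : x ⟶ x') (b : y ⟶ y')
    (comm : f ≫ b = a ≫ f') : B.coneObj f ⟶ B.coneObj f' :=
  (B.isPushout_cone f).desc (b ≫ B.coneInr f') (B.C.map a ≫ B.coneInl f') (by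
    rw [← Category.assoc, comm, Category.assoc, (B.isPushout_cone f').w, ← Category.assoc,
      ← Category.assoc, B.ι_naturality])

lemma coneInr_coneHom {x y x' y' : A} {f : x ⟶ y} {f' : x' ⟶ y'} (a : x ⟶ x') (b : y ⟶ y')
    (comm : f ≫ b = a ≫ f') : B.coneInr f ≫ B.coneHom a b comm = b ≫ B.coneInr f' :=
  (B.isPushout_cone f).inl_desc _ _ _

lemma coneInl_coneHom {x y x' y' : A} {f : x ⟶ y} {f' : x' ⟶ y'} (a : x ⟶ x') (b : y ⟶ y')
    (comm : f ≫ b = a ≫ f') : B.coneInl f ≫ B.coneHom a b comm = B.C.map a ≫ B.coneInl f' :=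
  (B.isPushout_cone f).inr_desc _ _ _

lemma conflation_cone [HasZeroObject A] [HasBinaryBiproducts A] {x y : A} (f : x ⟶ y) :
    ∃ w, E.conflation (ShortComplex.mk (biprod.lift (B.ι.app x) f)
      (biprod.desc (B.coneInl f) (-B.coneInr f)) w) :=
  ⟨_, ExactStructure.conflation_biprod_of_isPushout ⟨_, _, _, B.conflation_ι_π x⟩
    (B.isPushout_cone f).flip⟩

lemma coneHom_id {x y : A} (f : x ⟶ y) :
    B.coneHom (𝟙 x) (𝟙 y) (by simp) = 𝟙 (B.coneObj f) :=
  (B.isPushout_cone _).hom_ext (by rw [coneInr_coneHom, Category.id_comp, Category.comp_id])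
    (by rw [coneInl_coneHom, CategoryTheory.Functor.map_id, Category.id_comp, Category.comp_id])

lemma coneHom_comp {x y x' y' x'' y'' : A} {f : x ⟶ y} {f' : x' ⟶ y'} {f'' : x'' ⟶ y''}
    (a : x ⟶ x') (b : y ⟶ y') (comm : f ≫ b = a ≫ f') (a' : x' ⟶ x'') (b' : y' ⟶ y'')
    (comm' : f' ≫ b' = a' ≫ f'') (comm'' : f ≫ b ≫ b' = (a ≫ a') ≫ f'') :
    B.coneHom (a ≫ a') (b ≫ b') comm'' = B.coneHom a b comm ≫ B.coneHom a' b' comm' :=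
  (B.isPushout_cone _).hom_ext
    (by rw [coneInr_coneHom, ← Category.assoc (B.coneInr f), coneInr_coneHom, Category.assoc,
      Category.assoc, coneInr_coneHom])
    (by rw [coneInl_coneHom, ← Category.assoc (B.coneInl f), coneInl_coneHom, Category.assoc,
      coneInl_coneHom, Functor.map_comp, Category.assoc])

lemma coneHom_add {x y x' y' : A} {f : x ⟶ y} {f' : x' ⟶ y'} (a a' : x ⟶ x') (b b' : y ⟶ y')
    (h : f ≫ b = a ≫ f') (h' : f ≫ b' = a' ≫ f')
    (h'' : f ≫ (b + b') = (a + a') ≫ f') :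
    B.coneHom (a + a') (b + b') h'' = B.coneHom a b h + B.coneHom a' b' h' :=
  (B.isPushout_cone _).hom_ext
    (by rw [coneInr_coneHom, Preadditive.comp_add, coneInr_coneHom, coneInr_coneHom,
      Preadditive.add_comp])
    (by rw [coneInl_coneHom, Preadditive.comp_add, coneInl_coneHom, coneInl_coneHom,
      Functor.map_add, Preadditive.add_comp])

lemma conflation_cone_of_conflation [HasZeroObject A] [HasBinaryBiproducts A]
    {S S' : ShortComplex A} (h : E.conflation S) (h' : E.conflation S') (φ : S ⟶ S') :
    ∃ w : B.coneHom S.f S'.f φ.comm₁₂ ≫ B.coneHom S.g S'.g φ.comm₂₃ = 0,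
      E.conflation (ShortComplex.mk _ _ w) := by
  have w : B.coneHom S.f S'.f φ.comm₁₂ ≫ B.coneHom S.g S'.g φ.comm₂₃ = 0 :=
    (B.isPushout_cone _).hom_ext
      (by rw [← Category.assoc, coneInr_coneHom, Category.assoc, coneInr_coneHom,
        ← Category.assoc, S'.zero, zero_comp, comp_zero])
      (by rw [← Category.assoc, coneInl_coneHom, Category.assoc, coneInl_coneHom,
        ← Category.assoc, ← Functor.map_comp, S.zero, Functor.map_zero, zero_comp, comp_zero])
  obtain ⟨w₁, c₁⟩ := B.conflation_cone φ.τ₁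
  obtain ⟨w₂, c₂⟩ := B.conflation_cone φ.τ₂
  obtain ⟨w₃, c₃⟩ := B.conflation_cone φ.τ₃
  -- The columns are the conflations `x ⟶ Cx ⊞ y ⟶ Cone` and the first two rows are `S` and `C S ⊕
  -- S'`, so the row of cones is a conflation by the 3×3 argument.
  refine ⟨w, ExactStructure.conflation_of_columns (S₁ := S)
    (S₂ := ShortComplex.mk (biprod.map (B.C.map S.f) S'.f) (biprod.map (B.C.map S.g) S'.g)
      (by rw [← biprod_map_comp, ← Functor.map_comp, S.zero, S'.zero]; ext <;> simp))
    { τ₁ := biprod.lift (B.ι.app S.X₁) φ.τ₁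
      τ₂ := biprod.lift (B.ι.app S.X₂) φ.τ₂
      τ₃ := biprod.lift (B.ι.app S.X₃) φ.τ₃
      comm₁₂ := by ext <;> simp [B.ι_naturality, φ.comm₁₂]
      comm₂₃ := by ext <;> simp [B.ι_naturality, φ.comm₂₃] }
    { τ₁ := biprod.desc (B.coneInl φ.τ₁) (-B.coneInr φ.τ₁)
      τ₂ := biprod.desc (B.coneInl φ.τ₂) (-B.coneInr φ.τ₂)
      τ₃ := biprod.desc (B.coneInl φ.τ₃) (-B.coneInr φ.τ₃)
      comm₁₂ := by ext <;> simp [coneInr_coneHom, coneInl_coneHom]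
      comm₂₃ := by ext <;> simp [coneInr_coneHom, coneInl_coneHom] }
    h (ExactStructure.conflation_biprod_map (B.map_conflation _ h) h') w₁ w₂ w₃ c₁ c₂ c₃⟩

variable (A) in
/-- An iterated mapping cone of the first `k + 1` terms of a complex. -/
structure TotStage (k : ℕ) where
  /-- the iterated mapping cone -/
  F : CochainComplex A ℕ ⥤ A
  /-- the next differential -/
  δ : ∀ K, F.obj K ⟶ K.X (k + 1)
  map_δ : ∀ {K L} (f : K ⟶ L), F.map f ≫ δ L = δ K ≫ f.f (k + 1)
  δ_d : ∀ K, δ K ≫ K.d (k + 1) (k + 1 + 1) = 0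

/-- The initial stage. -/
noncomputable def TotStage.init : TotStage A 0 where
  F := HomologicalComplex.eval A _ 0
  δ K := K.d 0 1
  map_δ f := f.comm 0 1
  δ_d K := K.d_comp_d _ _ _

/-- The next stage. -/
noncomputable def TotStage.next {k : ℕ} (S : TotStage A k) : TotStage A (k + 1) where
  F :=
    { obj := fun K => B.coneObj (S.δ K)
      map := fun {K L} f => B.coneHom (S.F.map f) (f.f (k + 1)) (S.map_δ f).symm
      map_id := fun K => by
        refine Eq.trans ?_ (B.coneHom_id _)
        congr 1
        exact CategoryTheory.Functor.map_id _ _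
      map_comp := fun f g => by
        refine Eq.trans ?_ (B.coneHom_comp _ _ _ _ _ _ ?_)
        · congr 1
          exact CategoryTheory.Functor.map_comp _ _ _
        · rw [← Functor.map_comp, S.map_δ]
          rfl }
  -- The differential out of the last term is extended by zero over the glued cone; this is
  -- consistent since it vanishes after the previous `δ`.
  δ K := (B.isPushout_cone (S.δ K)).desc (K.d (k + 1) (k + 1 + 1)) 0 (by rw [S.δ_d, comp_zero])
  map_δ {K L} f := (B.isPushout_cone _).hom_ext
    (by rw [← Category.assoc, coneInr_coneHom, Category.assoc, IsPushout.inl_desc,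
      ← Category.assoc, IsPushout.inl_desc, f.comm])
    (by rw [← Category.assoc, coneInl_coneHom, Category.assoc, IsPushout.inr_desc,
      ← Category.assoc, IsPushout.inr_desc, zero_comp, comp_zero])
  δ_d K := (B.isPushout_cone _).hom_ext
    (by rw [← Category.assoc, IsPushout.inl_desc, K.d_comp_d, comp_zero])
    (by rw [← Category.assoc, IsPushout.inr_desc, zero_comp, comp_zero])

/-- The total object of the first `k + 1` terms of a complex. -/
noncomputable def tot : ∀ k : ℕ, TotStage A k
  | 0 => TotStage.init
  | k + 1 => (tot k).next B

lemma tot_map_succ (k : ℕ) {K L : CochainComplex A ℕ} (f : K ⟶ L) :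
    (B.tot (k + 1)).F.map f =
      B.coneHom ((B.tot k).F.map f) (f.f (k + 1)) ((B.tot k).map_δ f).symm := rfl

instance additive_tot (k : ℕ) : (B.tot k).F.Additive := by
  induction k with
  | zero => exact inferInstanceAs (HomologicalComplex.eval A _ 0).Additive
  | succ k hk =>
    refine ⟨fun {K L f g} => Eq.trans ?_ (B.coneHom_add _ _ _ _
      ((B.tot k).map_δ f).symm ((B.tot k).map_δ g).symm ?_)⟩
    · rw [tot_map_succ]
      congr 1
      exact Functor.map_add _
    · rw [← Functor.map_add, (B.tot k).map_δ]
      rfl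

lemma conflation_tot [HasZeroObject A] [HasBinaryBiproducts A]
    {S : ShortComplex (CochainComplex A ℕ)}
    (hS : ∀ n, E.conflation (S.map (HomologicalComplex.eval A _ n))) (k : ℕ) :
    E.conflation (S.map (B.tot k).F) := by
  induction k with
  | zero => exact hS 0
  | succ k hk =>
    obtain ⟨w, h⟩ := B.conflation_cone_of_conflation hk (hS (k + 1))
      { τ₁ := (B.tot k).δ S.X₁, τ₂ := (B.tot k).δ S.X₂, τ₃ := (B.tot k).δ S.X₃
        comm₁₂ := ((B.tot k).map_δ S.f).symm
        comm₂₃ := ((B.tot k).map_δ S.g).symm }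
    exact h

end Bicomplicial

end ConeFunctor

/-! ### Spliced complexes, their lower truncations, and the splicing of cones. -/

section SplicedComplexes

variable {A : Type u} [Category.{v} A] [Preadditive A]

/-- A complex `K` is spliced from conflations `Z n ↣ K n ↠ Z (n + 1)`. -/
def Spliced (E : ExactStructure A) {ι : Type*} {c : ComplexShape ι} (K : HomologicalComplex A c)
    (Z : ι → A) (i : ∀ n, Z n ⟶ K.X n) : Prop :=
  ∀ n m, c.Rel n m → ∃ (p : K.X n ⟶ Z m) (w : i n ≫ p = 0),
    E.conflation (ShortComplex.mk (i n) p w) ∧ K.d n m = p ≫ i m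

lemma StrictlyAcyclic.exists_spliced {E : ExactStructure A} {K : CochainComplex A ℤ}
    (h : StrictlyAcyclic E K) : ∃ Z i, Spliced E K Z i := by
  obtain ⟨Z, i, p, w, h, h'⟩ := h
  refine ⟨Z, i, ?_⟩
  rintro n _ rfl
  exact ⟨p n, w n, h n, h' n⟩

/-- The terms in degrees `≥ a` of a complex. -/
noncomputable abbrev res (a : ℤ) : CochainComplex A ℤ ⥤ CochainComplex A ℕ :=
  (ComplexShape.embeddingUpIntGE a).restrictionFunctor A

lemma Spliced.res {E : ExactStructure A} {K : CochainComplex A ℤ} {Z : ℤ → A}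
    {i : ∀ n, Z n ⟶ K.X n} (h : Spliced E K Z i) (a : ℤ) :
    Spliced E ((res a).obj K) (fun n : ℕ => Z (a + n)) (fun n => i (a + n)) :=
  fun _ _ hnm => h _ _ ((ComplexShape.embeddingUpIntGE a).rel hnm)

/-- The cycles of `CK` are the pairs `(d b, b)`. The involution `φ : (a, b) ↦ (d b - a, b)` carries
the split conflation `inr`, `fst` to the one needed here. -/
lemma spliced_coneB [HasBinaryBiproducts A] [HasZeroObject A] (E : ExactStructure A) (K : ChB A) :
    Spliced E ((coneB A).obj K).obj K.obj.X
      (fun n => (biprod.lift (K.obj.d n (n + 1)) (𝟙 _) :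
        K.obj.X n ⟶ K.obj.X (n + 1) ⊞ K.obj.X n)) := by
  rintro n _ rfl
  let φ : K.obj.X (n + 1) ⊞ K.obj.X n ⟶ K.obj.X (n + 1) ⊞ K.obj.X n :=
    biprod.desc (-biprod.inl) (biprod.lift (K.obj.d n (n + 1)) (𝟙 _))
  have hφ : φ ≫ φ = 𝟙 _ := by ext <;> simp [φ]
  have key : triMap (-K.obj.d (n + 1) (n + 1 + 1)) (-𝟙 (K.obj.X (n + 1))) (K.obj.d n (n + 1)) =
      biprod.desc (-𝟙 _) (K.obj.d n (n + 1)) ≫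
        biprod.lift (K.obj.d (n + 1) (n + 1 + 1)) (𝟙 (K.obj.X (n + 1))) := by
    ext <;> simp
  refine ⟨(biprod.desc (-𝟙 _) (K.obj.d n (n + 1)) :
    K.obj.X (n + 1) ⊞ K.obj.X n ⟶ K.obj.X (n + 1)), biprod.lift_desc.trans (by simp),
    E.of_iso (ShortComplex.isoMk
      (S₁ := ShortComplex.mk (biprod.inr : K.obj.X n ⟶ K.obj.X (n + 1) ⊞ K.obj.X n)
        biprod.fst biprod.inr_fst)
      (S₂ := ShortComplex.mk (biprod.lift (K.obj.d n (n + 1)) (𝟙 _))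
        (biprod.desc (-𝟙 _) (K.obj.d n (n + 1))) (biprod.lift_desc.trans (by simp)))
      (Iso.refl _) ⟨φ, φ, hφ, hφ⟩ (Iso.refl _) ?_ ?_)
      (E.conflation_inr_fst (K.obj.X (n + 1)) (K.obj.X n)), (coneB_d K n).trans key⟩
  · exact (Category.id_comp _).trans (biprod.inr_desc _ _).symm
  · refine Eq.trans ?_ (Category.comp_id _).symm
    change φ ≫ biprod.desc (-𝟙 _) (K.obj.d n (n + 1)) = biprod.fst
    ext <;> simp [φ]

/-- The modification of a spliced complex `L` such that the zeroth term is `Z 1`. -/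
noncomputable def replaceZero (L : CochainComplex A ℕ) {Z : A} (i : Z ⟶ L.X 1)
    (hi : i ≫ L.d 1 2 = 0) : CochainComplex A ℕ :=
  CochainComplex.augment (CochainComplex.truncate.obj L) i hi

lemma Spliced.ι_comp_d {ι : Type*} {c : ComplexShape ι} {E : ExactStructure A}
    {K : HomologicalComplex A c} {Z : ι → A} {i : ∀ n, Z n ⟶ K.X n} (h : Spliced E K Z i)
    {n m : ι} (hnm : c.Rel n m) : i n ≫ K.d n m = 0 := by
  obtain ⟨p, w, -, hd⟩ := h n m hnm
  rw [hd, ← Category.assoc, w, zero_comp]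

/-- A truncation of an acyclic complex has the cycles `Z 0` as an obstruction at the bottom. Putting
`Z 1` in degree zero removes it, so that the complex starts with zero cycles. -/
lemma spliced_replaceZero [HasZeroObject A] [HasBinaryBiproducts A] {E : ExactStructure A}
    {L : CochainComplex A ℕ} {Z : ℕ → A} {i : ∀ n, Z n ⟶ L.X n} (h : Spliced E L Z i) :
    ∃ Z' i', Spliced E (replaceZero L (i 1) (h.ι_comp_d rfl)) Z' i' ∧ IsZero (Z' 0) := by
  refine ⟨Nat.rec 0 fun n _ => Z (n + 1), Nat.rec 0 fun n _ => i (n + 1), ?_,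
    Limits.isZero_zero _⟩
  rintro n _ rfl
  cases n with
  | zero =>
    have : IsIso (𝟙 (Z 1)) := inferInstance
    refine ⟨𝟙 (Z 1), zero_comp, E.conflation_of_isZero_left (X := 0) (Y := Z 1) (Z := Z 1)
      (Limits.isZero_zero _) _ (𝟙 (Z 1)), ?_⟩
    exact (CochainComplex.augment_d_zero_one _ _ _).trans (Category.id_comp _).symm
  | succ n =>
    obtain ⟨p, w, hp, hd⟩ := h (n + 1) (n + 1 + 1) rfl
    exact ⟨p, w, hp, hd⟩

/-- Since `X` vanishes in degree zero, `f ≫ g` uses only the positive degrees of `L`. The one new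
condition is that `g` kills the cycles `Z 1`, which holds because `L⁰ ⟶ Z 1` is epi and `g` vanishes
in degree zero. -/
lemma exists_factor_replaceZero {E : ExactStructure A} {X L : CochainComplex A ℕ} {Z : ℕ → A}
    {i : ∀ n, Z n ⟶ L.X n} (h : Spliced E L Z i) (hX : IsZero (X.X 0)) (f : X ⟶ L) (g : L ⟶ X) :
    ∃ (f' : X ⟶ replaceZero L (i 1) (h.ι_comp_d rfl)) (g' : replaceZero L (i 1) (h.ι_comp_d rfl) ⟶ X),
      f' ≫ g' = f ≫ g := by
  let f' : X ⟶ replaceZero L (i 1) (h.ι_comp_d rfl) :=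
    { f := fun n => Nat.casesOn n 0 fun n => f.f (n + 1)
      comm' := by
        rintro n _ rfl
        cases n with
        | zero => exact hX.eq_of_src _ _
        | succ n => exact f.comm _ _ }
  let g' : replaceZero L (i 1) (h.ι_comp_d rfl) ⟶ X :=
    { f := fun n => Nat.casesOn n 0 fun n => g.f (n + 1)
      comm' := by
        rintro n _ rfl
        cases n with
        | zero =>
          obtain ⟨p, w, hp, hd⟩ := h 0 1 rfl
          have : Epi p := E.epi_g hp
          have key : i 1 ≫ g.f 1 = 0 := by
            rw [← cancel_epi p, ← Category.assoc, ← hd, ← g.comm, hX.eq_of_tgt (g.f 0) 0,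
              zero_comp, comp_zero]
          exact zero_comp.trans key.symm
        | succ n => exact g.comm _ _ }
  refine ⟨f', g', HomologicalComplex.hom_ext _ _ fun n => ?_⟩
  cases n with
  | zero => exact hX.eq_of_src _ _
  | succ n => rfl

end SplicedComplexes

/-! ### Totalization detects trivial objects. -/

section TotalObjects

variable {A : Type u} [Category.{v} A] [Preadditive A] [HasZeroObject A] [HasBinaryBiproducts A]

namespace RelExact.IsBicomplicialPair

variable {R : RelExact A} {B : Bicomplicial R.exact} (hB : R.IsBicomplicialPair B)

include hB

lemma trivial_biprod {x y : A} (hx : R.trivial x) (hy : R.trivial y) : R.trivial (x ⊞ y) :=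
  hB.trivial_X₂ (R.exact.conflation_inr_fst x y) hy hx

lemma trivial_tot {K : CochainComplex A ℕ} {k : ℕ} (h : ∀ i ≤ k, R.trivial (K.X i)) :
    R.trivial ((B.tot k).F.obj K) := by
  induction k with
  | zero => exact h 0 le_rfl
  | succ k hk =>
    obtain ⟨w, hc⟩ := B.conflation_cone ((B.tot k).δ K)
    exact hB.trivial_X₃ hc (hk fun i hi => h i (by omega))
      (hB.trivial_biprod (hB.trivial_C _) (h (k + 1) le_rfl))

/-- The total object is built from the terms by successive conflations, so if all terms but one are
trivial, two-out-of-three passes triviality down to the remaining one. -/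
lemma trivial_X_of_tot {K : CochainComplex A ℕ} {k n : ℕ} (hn : n ≤ k)
    (h : ∀ i ≤ k, i ≠ n → R.trivial (K.X i)) (hK : R.trivial ((B.tot k).F.obj K)) :
    R.trivial (K.X n) := by
  induction k with
  | zero =>
    obtain rfl : n = 0 := by omega
    exact hK
  | succ k hk =>
    obtain ⟨w, hc⟩ := B.conflation_cone ((B.tot k).δ K)
    by_cases hn' : n = k + 1
    · subst hn'
      have h₁ := hB.trivial_tot (k := k) (fun i hi => h i (by omega) (by omega))
      exact (hB.trivial_iff (hB.w_snd (hB.trivial_C _))).1 (hB.trivial_X₂ hc h₁ hK)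
    · exact hk (by omega) (fun i hi => h i (by omega)) (hB.trivial_X₁ hc
        (hB.trivial_biprod (hB.trivial_C _) (h (k + 1) le_rfl (Ne.symm hn'))) hK)

/-- Adding terms of an acyclic complex that starts with zero cycles only advances the cycles: the
total object of the first `k + 1` terms is weakly equivalent to `Z (k + 1)`, compatibly with the
next differential. -/
lemma exists_w_tot {L : CochainComplex A ℕ} {Z : ℕ → A} {i : ∀ n, Z n ⟶ L.X n}
    (h : Spliced R.exact L Z i) (h₀ : IsZero (Z 0)) (k : ℕ) :
    ∃ e : (B.tot k).F.obj L ⟶ Z (k + 1), R.w e ∧ e ≫ i (k + 1) = (B.tot k).δ L := by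
  induction k with
  | zero =>
    obtain ⟨p, w, hp, hd⟩ := h 0 1 rfl
    exact ⟨p, hB.w_g hp (hB.trivial_of_isZero h₀), hd.symm⟩
  | succ k hk =>
    obtain ⟨e, he, he'⟩ := hk
    obtain ⟨p, w, hp, hd⟩ := h (k + 1) (k + 1 + 1) rfl
    have sq := B.isPushout_cone e
    have sq' := B.isPushout_cone ((B.tot k).δ L)
    have : Mono (i (k + 1)) := R.exact.mono_f hp
    let j : B.coneObj e ⟶ B.coneObj ((B.tot k).δ L) := sq.desc
      (i (k + 1) ≫ B.coneInr _) (B.coneInl _) (by rw [← Category.assoc, he', sq'.w])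
    have hj : B.coneInr e ≫ j = i (k + 1) ≫ B.coneInr _ := sq.inl_desc _ _ _
    have hj' : B.coneInl e ≫ j = B.coneInl _ := sq.inr_desc _ _ _
    -- Cancelling the pushout defining `Cone e` from the one defining `Cone δ` leaves `Cone δ` as a
    -- pushout of the inflation `i (k + 1)`. Its quotient is still `Z (k + 2)`, and the kernel of
    -- `q` is the trivial object `Cone e`.
    have hsq : IsPushout (i (k + 1)) (B.coneInr e) (B.coneInr ((B.tot k).δ L)) j :=
      IsPushout.of_left (by rw [he', hj']; exact sq') hj.symm sq
    let q : B.coneObj ((B.tot k).δ L) ⟶ Z (k + 1 + 1) :=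
      sq'.desc p 0 (by rw [← he', Category.assoc, w, comp_zero, comp_zero])
    have hq : B.coneInr _ ≫ q = p := sq'.inl_desc _ _ _
    have hq' : B.coneInl _ ≫ q = 0 := sq'.inr_desc _ _ _
    have hjq : j ≫ q = 0 := sq.hom_ext
      (by rw [← Category.assoc, hj, Category.assoc, hq, w, comp_zero])
      (by rw [← Category.assoc, hj', hq', comp_zero])
    refine ⟨q, hB.w_g (ExactStructure.conflation_of_isPushout hp hsq hq hjq)
      (hB.trivial_of_w ⟨_, sq, sq.inl_desc 0 (B.π.app _) (by rw [B.ι_π, comp_zero]),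
        sq.inr_desc _ _ _⟩ he), sq'.hom_ext ?_ ?_⟩
    · refine Eq.trans ?_ (sq'.inl_desc _ _ _).symm
      exact (Category.assoc _ _ _).symm.trans ((congrArg (· ≫ _) hq).trans hd.symm)
    · refine Eq.trans ?_ (sq'.inr_desc _ _ _).symm
      exact (Category.assoc _ _ _).symm.trans ((congrArg (· ≫ _) hq').trans zero_comp)

/-- The total object of `L` is equivalent to the cycles `Z (k + 1)`, and `f` composes to zero with
this equivalence since `X` vanishes in degree `k + 1`. Hence `f` factors through the trivial
homotopy fibre of the equivalence, and the total object of `X` is a retract of that fibre plus the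
total object of `Y`. -/
lemma trivial_tot_of_id_eq (hR : R.IsThick) {X L Y : CochainComplex A ℕ} {f : X ⟶ L}
    {g : L ⟶ X} {u : X ⟶ Y} {v : Y ⟶ X} (hid : f ≫ g + u ≫ v = 𝟙 X) {Z : ℕ → A}
    {i : ∀ n, Z n ⟶ L.X n} (h : Spliced R.exact L Z i) (h₀ : IsZero (Z 0)) {k : ℕ}
    (hX : IsZero (X.X (k + 1))) (hY : R.trivial ((B.tot k).F.obj Y)) :
    R.trivial ((B.tot k).F.obj X) := by
  obtain ⟨e, he, he'⟩ := hB.exists_w_tot h h₀ k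
  obtain ⟨_, _, hp, -⟩ := h (k + 1) (k + 1 + 1) rfl
  have : Mono (i (k + 1)) := R.exact.mono_f hp
  have hα : (B.tot k).F.map f ≫ e = 0 := by
    rw [← cancel_mono (i (k + 1)), Category.assoc, he', (B.tot k).map_δ, zero_comp,
      hX.eq_of_src (f.f (k + 1)) 0, comp_zero]
  have := B.isEquivalence
  -- Since `T` is essentially surjective, `Z (k + 1)` is the target of a deflation from a trivial
  -- object `Cy`; pulling it back along `e` gives the homotopy fibre `F`.
  obtain ⟨y, ⟨θ⟩⟩ : ∃ y, Nonempty (B.T.obj y ≅ Z (k + 1)) := ⟨_, ⟨B.T.objObjPreimageIso _⟩⟩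
  have hq : deflations R.exact.conflation (B.π.app y ≫ θ.hom) :=
    ExactStructure.deflation_comp_iso ⟨_, _, _, B.conflation_ι_π y⟩ θ
  obtain ⟨F, g', p', sq, -⟩ := R.exact.pullback _ e hq
  have hF : R.trivial F := by
    refine hB.trivial_X₁_of_w (ExactStructure.conflation_biprod_of_isPullback hq sq)
      (hB.of_precomp (f := biprod.inr) (hB.w_f (ExactStructure.conflation_inr_fst _ _ _)
        (hB.trivial_C y)) ?_)
    dsimp only
    rw [biprod.inr_desc]
    have : IsIso (-𝟙 (Z (k + 1))) := (-Iso.refl (Z (k + 1))).isIso_hom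
    simpa using hB.comp he (hB.of_isIso (-𝟙 _))
  let a : (B.tot k).F.obj X ⟶ F := sq.lift 0 ((B.tot k).F.map f) (by rw [hα, zero_comp])
  have ha : a ≫ p' = (B.tot k).F.map f := sq.lift_snd _ _ _
  refine hB.trivial_of_retract hR (y := F ⊞ (B.tot k).F.obj Y)
    ⟨biprod.lift a ((B.tot k).F.map u),
      biprod.desc (p' ≫ (B.tot k).F.map g) ((B.tot k).F.map v), ?_⟩ (hB.trivial_biprod hF hY)
  rw [biprod.lift_desc, ← Category.assoc, ha, ← Functor.map_comp, ← Functor.map_comp,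
    ← Functor.map_add, hid, CategoryTheory.Functor.map_id]

omit hB in
variable (B) in
/-- The total objects of all sufficiently large truncations of a complex are trivial. -/
def _root_.DerivedGW.RelExact.totTrivial : ObjectProperty (ChB A) :=
  fun K => ∃ N : ℤ, ∀ a ≤ -N, ∀ k : ℕ, N ≤ a + k →
    R.trivial ((B.tot k).F.obj ((res a).obj K.obj))

omit hB in
lemma totTrivial_of₂ {K L M : ChB A} (hK : RelExact.totTrivial B K) (hL : RelExact.totTrivial B L)
    (h : ∀ (a : ℤ) (k : ℕ), R.trivial ((B.tot k).F.obj ((res a).obj K.obj)) →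
      R.trivial ((B.tot k).F.obj ((res a).obj L.obj)) →
      R.trivial ((B.tot k).F.obj ((res a).obj M.obj))) : RelExact.totTrivial B M := by
  obtain ⟨N, hN⟩ := hK
  obtain ⟨N', hN'⟩ := hL
  exact ⟨max N N', fun a ha k hk => h a k (hN a (by omega) k (by omega))
    (hN' a (by omega) k (by omega))⟩

omit hB in
lemma conflation_tot_res {S : ShortComplex (ChB A)} (hS : degreewise R.exact S) (a : ℤ) (k : ℕ) :
    R.exact.conflation ((S.map ((bounded A).ι ⋙ res a)).map (B.tot k).F) :=
  B.conflation_tot (fun n => hS (a + n)) k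

lemma totTrivial_of_acyclicHb (hR : R.IsThick) {K : ChB A}
    (hK : acyclicHb R.exact ((toHb A).obj K)) : RelExact.totTrivial B K := by
  obtain ⟨L, hL, ⟨e⟩⟩ := hK
  obtain ⟨Z, i, hL⟩ := hL.exists_spliced
  obtain ⟨f, hf⟩ := (HomotopyCategory.quotient A (ComplexShape.up ℤ)).map_surjective
    (X := K.obj) e.hom
  obtain ⟨g, hg⟩ := (HomotopyCategory.quotient A (ComplexShape.up ℤ)).map_surjective
    (Y := K.obj) e.inv
  let φ : K ⟶ K := ObjectProperty.homMk (f ≫ g)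
  obtain ⟨H, hH⟩ := (homotopic_iff R.exact (𝟙 K) φ).2 (by
    ext : 1
    refine ((HomotopyCategory.quotient A (ComplexShape.up ℤ)).map_id _).trans
      (e.hom_inv_id.symm.trans ?_)
    rw [← hf, ← hg]
    exact ((HomotopyCategory.quotient A (ComplexShape.up ℤ)).map_comp _ _).symm)
  obtain ⟨lo, hi, hK⟩ := K.property
  -- With this bound `a < lo` and `a + k + 1 > hi`: the complex vanishes both in the first degree of
  -- the truncation and in the degree just after the last one totalized.
  refine ⟨max (1 - lo) hi, fun a ha k hk => ?_⟩
  obtain ⟨f', g', hfg⟩ := exists_factor_replaceZero (hL.res a)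
    (hK (a + (0 : ℕ)) (by push_cast; omega)) ((res a).map f) ((res a).map g)
  obtain ⟨Z', i', hL', hZ'⟩ := spliced_replaceZero (hL.res a)
  refine hB.trivial_tot_of_id_eq hR (f := f') (g := g')
    (u := (res a).map (coneι.app K).hom) (v := (res a).map H.hom) ?_ hL' hZ'
    (hK (a + (k + 1 : ℕ)) (by push_cast; omega)) ?_
  · let c : K ⟶ (coneB A).obj K := coneι.app K
    have h : φ + c ≫ H = 𝟙 K :=
      (add_comm _ _).trans (sub_eq_iff_eq_add.1 hH).symm
    rw [hfg]
    exact congrArg (fun ψ : K ⟶ K => (res a).map ψ.hom) h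
  -- The cone `CK` is spliced from the terms of `K`, which vanish at both ends, so its total object
  -- is weakly equivalent to zero.
  · obtain ⟨e, he, -⟩ := hB.exists_w_tot ((spliced_coneB R.exact K).res a)
      (hK (a + (0 : ℕ)) (by push_cast; omega)) k
    exact (hB.trivial_iff he).2 (hB.trivial_of_isZero (hK (a + (k + 1 : ℕ)) (by push_cast; omega)))

lemma isAcyclicClass_totTrivial (hR : R.IsThick) : R.IsAcyclicClass (RelExact.totTrivial B) where
  X₁ hS h₂ h₃ := totTrivial_of₂ h₂ h₃ fun a k => hB.trivial_X₁ (conflation_tot_res hS a k)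
  X₂ hS h₁ h₃ := totTrivial_of₂ h₁ h₃ fun a k => hB.trivial_X₂ (conflation_tot_res hS a k)
  X₃ hS h₁ h₂ := totTrivial_of₂ h₁ h₂ fun a k => hB.trivial_X₃ (conflation_tot_res hS a k)
  of_retract r h := totTrivial_of₂ h h fun a k h _ =>
    hB.trivial_of_retract hR (((r.map (bounded A).ι).map (res a)).map (B.tot k).F) h
  of_acyclicHb := hB.totTrivial_of_acyclicHb hR
  of_trivial h := ⟨0, fun _ _ _ _ => hB.trivial_tot fun _ _ => h _⟩

theorem trivial_of_isZero_proj (hR : R.IsThick) {x : A} (hx : IsZero (R.proj.obj (singleB.obj x))) :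
    R.trivial x := by
  obtain ⟨N, hN⟩ := (hB.isAcyclicClass_totTrivial hR).of_isZero_proj hx
  have h₁ (n : ℤ) (hn : n ≠ 0) : R.trivial ((singleB.obj x).obj.X n) :=
    hB.trivial_of_isZero (HomologicalComplex.isZero_single_obj_X _ _ _ _ hn)
  -- The window from `-|N|` to `|N|` is large enough for the bound `N`, and degree zero is its term
  -- of index `|N|`.
  have h₂ : R.trivial ((singleB.obj x).obj.X (-N.natAbs + N.natAbs)) :=
    hB.trivial_X_of_tot (n := N.natAbs) (by omega)
      (fun i _ hi => h₁ (-N.natAbs + i) (by omega))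
      (hN (-N.natAbs) (by omega) (2 * N.natAbs) (by omega))
  exact (hB.trivial_iff (hB.of_isIso ((HomologicalComplex.XIsoOfEq _ (by omega)) ≪≫
    HomologicalComplex.singleObjXSelf (ComplexShape.up ℤ) 0 x).hom)).1 h₂

end RelExact.IsBicomplicialPair

end TotalObjects

/-! ### Complexes with `qw` form a thick bicomplicial pair; `j` preserves and reflects weak
equivalences. -/

section DerivedPairs

variable {A : Type u} [Category.{v} A] [Preadditive A] [HasZeroObject A] [HasBinaryBiproducts A]

/-- The functor which sends an object to the complex concentrated in degree `m`. -/
noncomputable def singleAt (m : ℤ) : A ⥤ ChB A :=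
  (bounded A).lift (HomologicalComplex.single A (ComplexShape.up ℤ) m) fun X =>
    ⟨m, m, fun n hn => HomologicalComplex.isZero_single_obj_X _ _ _ _ (by omega)⟩

/-- The term of degree `m` of the complex concentrated in degree `m`. -/
noncomputable def singleAtEval (m : ℤ) : singleAt (A := A) m ⋙ evalB m ≅ 𝟭 A :=
  HomologicalComplex.singleCompEvalIsoSelf A (ComplexShape.up ℤ) m

lemma isZero_singleAt_X (x : A) {m n : ℤ} (hn : n ≠ m) : IsZero (((singleAt m).obj x).obj.X n) :=
  HomologicalComplex.isZero_single_obj_X _ _ _ _ hn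

instance (m : ℤ) : (singleAt (A := A) m).Additive where
  map_add := by
    intros
    ext : 1
    exact (HomologicalComplex.single A (ComplexShape.up ℤ) m).map_add

lemma conflation_singleAt {E : ExactStructure A} {S : ShortComplex A} (h : E.conflation S) (m : ℤ) :
    degreewise E (S.map (singleAt m)) := by
  intro n
  by_cases hn : n = m
  · subst hn
    exact E.of_iso (S.mapNatIso (singleAtEval n)).symm h
  · have : IsIso ((evalB n).map ((singleAt m).map S.g)) :=
      (isZero_singleAt_X _ hn).isIso (isZero_singleAt_X _ hn) _
    exact E.conflation_of_isZero_left (X := (evalB n).obj ((singleAt m).obj S.X₁))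
      (isZero_singleAt_X _ hn) ((evalB n).map ((singleAt m).map S.f))
      ((evalB n).map ((singleAt m).map S.g))

lemma conflation_singleB {E : ExactStructure A} {S : ShortComplex A} (h : E.conflation S) :
    degreewise E (S.map singleB) :=
  conflation_singleAt h 0

namespace RelExact

variable {R : RelExact A}

lemma isZero_proj_X₃_iff {S : ShortComplex (ChB A)} (hS : degreewise R.exact S) :
    IsZero (R.proj.obj S.X₃) ↔ IsIso (R.proj.map S.f) :=
  Triangle.isZero₃_iff_isIso₁ _ (R.distinguished hS)

lemma isZero_proj_X₁_iff {S : ShortComplex (ChB A)} (hS : degreewise R.exact S) :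
    IsZero (R.proj.obj S.X₁) ↔ IsIso (R.proj.map S.g) :=
  Triangle.isZero₁_iff_isIso₂ _ (R.distinguished hS)

/-- The five lemma for the natural triangles of the two conflations; this is the extension axiom for
`qw`. -/
lemma isIso_proj_τ₂ {S S' : ShortComplex (ChB A)} (φ : S ⟶ S') (hS : degreewise R.exact S)
    (hS' : degreewise R.exact S') (h₁ : IsIso (R.proj.map φ.τ₁))
    (h₃ : IsIso (R.proj.map φ.τ₃)) : IsIso (R.proj.map φ.τ₂) := by
  let ψ : Triangle.mk (R.proj.map S.f) (R.proj.map S.g) (R.conn hS) ⟶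
      Triangle.mk (R.proj.map S'.f) (R.proj.map S'.g) (R.conn hS') :=
    { hom₁ := R.proj.map φ.τ₁
      hom₂ := R.proj.map φ.τ₂
      hom₃ := R.proj.map φ.τ₃
      comm₁ := (R.proj.map_comp _ _).symm.trans
        ((congrArg R.proj.map φ.comm₁₂.symm).trans (R.proj.map_comp _ _))
      comm₂ := (R.proj.map_comp _ _).symm.trans
        ((congrArg R.proj.map φ.comm₂₃.symm).trans (R.proj.map_comp _ _))
      comm₃ := (R.conn_naturality φ hS hS').symm }
  exact isIso₂_of_isIso₁₃ ψ (R.distinguished hS) (R.distinguished hS') h₁ h₃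

variable (R) in
lemma isIso_proj_of_isIso_toHb {K L : ChB A} (f : K ⟶ L) (h : IsIso ((toHb A).map f)) :
    IsIso (R.proj.map f) :=
  inferInstanceAs (IsIso (R.projHb.map ((toHb A).map f)))

variable (R) in
lemma isBicomplicialPair_chB : R.chB.IsBicomplicialPair (bicomplicialChB R.exact) where
  saturated :=
    inferInstanceAs ((MorphismProperty.isomorphisms R.Db).inverseImage
      R.proj).HasTwoOutOfThreeProperty
  extensional φ hS hS' h₁ h₃ := isIso_proj_τ₂ φ hS hS' h₁ h₃
  of_homotopyEquiv f hf := by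
    obtain ⟨g, h₁, h₂⟩ := hf
    have h₁' := (homotopic_iff R.exact _ _).1 h₁
    have h₂' := (homotopic_iff R.exact _ _).1 h₂
    rw [Functor.map_comp, CategoryTheory.Functor.map_id] at h₁' h₂'
    exact R.isIso_proj_of_isIso_toHb f ⟨_, h₁', h₂'⟩

variable (R) in
lemma isThick_chB : R.chB.IsThick :=
  inferInstanceAs ((MorphismProperty.isomorphisms R.Db).inverseImage R.proj).IsStableUnderRetracts

lemma trivial_chB_iff (K : ChB A) : R.chB.trivial K ↔ IsZero (R.proj.obj K) := by
  have h₀ : IsZero (R.proj.obj R.chB.zero) := R.proj.map_isZero R.chB.isZero_zero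
  refine ⟨fun h => ?_, fun h => h₀.isIso h _⟩
  have : IsIso (R.proj.map (R.chB.isZero_zero.to_ K)) := h
  exact h₀.of_iso (asIso (R.proj.map (R.chB.isZero_zero.to_ K))).symm

namespace IsBicomplicialPair

variable {B : Bicomplicial R.exact} (hB : R.IsBicomplicialPair B)

include hB

lemma trivial_singleAt_X {x : A} (hx : R.trivial x) (m n : ℤ) :
    R.trivial (((singleAt m).obj x).obj.X n) := by
  by_cases hn : n = m
  · subst hn
    exact (hB.trivial_iff (hB.of_isIso ((singleAtEval n).hom.app x))).2 hx
  · exact hB.trivial_of_isZero (isZero_singleAt_X x hn)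

lemma isZero_proj_singleB {x : A} (hx : R.trivial x) : IsZero (R.proj.obj (singleB.obj x)) :=
  R.isZero_proj_of_trivial (hB.trivial_singleAt_X hx 0)

lemma isIso_proj_singleB_snd (x y : A) :
    IsIso (R.proj.map (singleB.map (biprod.snd : B.C.obj x ⊞ y ⟶ y))) :=
  (isZero_proj_X₁_iff (conflation_singleB
    (ExactStructure.conflation_inl_snd (E := R.exact) (B.C.obj x) y))).1
    (hB.isZero_proj_singleB (hB.trivial_C x))

/-- Replacing `s` by the inflation `(ι, s)` costs only the projection away from `Cx`, which `j`
sends to an isomorphism. Inflations can then be tested on their cokernels. -/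
lemma isIso_proj_singleB_iff {x y : A} (s : x ⟶ y) :
    IsIso (R.proj.map (singleB.map s)) ↔
      IsIso (R.proj.map (singleB.map (biprod.lift (B.ι.app x) s))) := by
  have := hB.isIso_proj_singleB_snd x y
  have h : R.proj.map (singleB.map s) = R.proj.map (singleB.map (biprod.lift (B.ι.app x) s)) ≫
      R.proj.map (singleB.map biprod.snd) := by
    rw [← Functor.map_comp, ← Functor.map_comp, biprod.lift_snd]
  rw [h]
  exact ⟨fun h' => IsIso.of_isIso_comp_right _
    (R.proj.map (singleB.map (biprod.snd : B.C.obj x ⊞ y ⟶ y))), fun _ => inferInstance⟩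

lemma isIso_proj_singleB {x y : A} {s : x ⟶ y} (hs : R.w s) :
    IsIso (R.proj.map (singleB.map s)) := by
  obtain ⟨w, hS⟩ := B.conflation_cone s
  refine (hB.isIso_proj_singleB_iff s).2 ((isZero_proj_X₃_iff (conflation_singleB hS)).1
    (hB.isZero_proj_singleB (hB.trivial_X₃_of_w hS ?_)))
  refine hB.of_postcomp (hB.w_snd (hB.trivial_C x)) ?_
  dsimp only
  rwa [biprod.lift_snd]

/-- The cone of `s` vanishes in the derived category, so it is trivial by detection. -/
lemma w_of_isIso_proj_singleB (hR : R.IsThick) {x y : A} {s : x ⟶ y}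
    (hs : IsIso (R.proj.map (singleB.map s))) : R.w s := by
  obtain ⟨w, hS⟩ := B.conflation_cone s
  have := hB.trivial_of_isZero_proj hR ((isZero_proj_X₃_iff (conflation_singleB hS)).2
    ((hB.isIso_proj_singleB_iff s).1 hs))
  simpa using hB.comp (hB.w_f hS this) (hB.w_snd (hB.trivial_C x))

end IsBicomplicialPair

end RelExact

end DerivedPairs

/-! ### Cones of graded objects and contractible complexes with two nonzero terms. -/

section ContractibleComplexes

variable {A : Type u} [Category.{v} A] [Preadditive A] [HasZeroObject A] [HasBinaryBiproducts A]

/-- The cone is cofree on the underlying graded object: any degreewise family lifts to a morphism of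
complexes, the other component being the failure of the family to commute with the differentials. -/
lemma exists_lift_coneB {K L : ChB A} (v : ∀ n, K.obj.X n ⟶ L.obj.X n) :
    ∃ H : K ⟶ (coneB A).obj L, ∀ n,
      H.hom.f n ≫ (biprod.snd : L.obj.X (n + 1) ⊞ L.obj.X n ⟶ L.obj.X n) = v n := by
  refine ⟨ObjectProperty.homMk
    { f := fun n => (biprod.lift (v n ≫ L.obj.d n (n + 1) - K.obj.d n (n + 1) ≫ v (n + 1)) (v n) :
        K.obj.X n ⟶ L.obj.X (n + 1) ⊞ L.obj.X n)
      comm' := ?_ }, fun n => biprod.lift_snd _ _⟩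
  rintro n _ rfl
  have key : biprod.lift (v n ≫ L.obj.d n (n + 1) - K.obj.d n (n + 1) ≫ v (n + 1)) (v n) ≫
      triMap (-L.obj.d (n + 1) (n + 1 + 1)) (-𝟙 (L.obj.X (n + 1))) (L.obj.d n (n + 1)) =
      K.obj.d n (n + 1) ≫ biprod.lift (v (n + 1) ≫ L.obj.d (n + 1) (n + 1 + 1) -
        K.obj.d (n + 1) (n + 1 + 1) ≫ v (n + 1 + 1)) (v (n + 1)) := by
    ext <;> simp
  exact (congrArg (_ ≫ ·) (coneB_d L n)).trans key

/-- Dually, morphisms out of the cone are free on their component of degree `-1`; the other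
component is minus the null-homotopic morphism defined by that family. -/
lemma exists_desc_coneB {K L : ChB A} (h : ∀ n, L.obj.X (n + 1) ⟶ K.obj.X n) :
    ∃ H : (coneB A).obj L ⟶ K, ∀ n,
      (biprod.inl : L.obj.X (n + 1) ⟶ L.obj.X (n + 1) ⊞ L.obj.X n) ≫ H.hom.f n = h n := by
  let h' (i j : ℤ) (hij : (ComplexShape.up ℤ).Rel j i) : L.obj.X i ⟶ K.obj.X j :=
    (L.obj.XIsoOfEq (show j + 1 = i from hij).symm).hom ≫ h j
  let g : L ⟶ K := ObjectProperty.homMk (-Homotopy.nullHomotopicMap' h')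
  have hg (m : ℤ) : g.hom.f (m + 1) =
      -(L.obj.d (m + 1) (m + 1 + 1) ≫ h (m + 1) + h m ≫ K.obj.d m (m + 1)) := by
    have := Homotopy.nullHomotopicMap'_f (show (ComplexShape.up ℤ).Rel m (m + 1) from rfl)
      (show (ComplexShape.up ℤ).Rel (m + 1) (m + 1 + 1) from rfl) h'
    refine congrArg (fun x => -x) (this.trans ?_)
    simp [h']
  refine ⟨ObjectProperty.homMk
    { f := fun n => (biprod.desc (h n) (g.hom.f n) :
        L.obj.X (n + 1) ⊞ L.obj.X n ⟶ K.obj.X n)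
      comm' := ?_ }, fun n => biprod.inl_desc _ _⟩
  rintro n _ rfl
  have key : biprod.desc (h n) (g.hom.f n) ≫ K.obj.d n (n + 1) =
      triMap (-L.obj.d (n + 1) (n + 1 + 1)) (-𝟙 (L.obj.X (n + 1))) (L.obj.d n (n + 1)) ≫
        biprod.desc (h (n + 1)) (g.hom.f (n + 1)) := by
    have := ChB.comm g n (n + 1)
    ext
    · simp [hg]
    · simp [this]
  exact key.trans (congrArg (· ≫ _) (coneB_d L n)).symm

/-- The contractible complex with the object `x` in degrees `m - 1` and `m`. -/
noncomputable abbrev contractible (m : ℤ) : A ⥤ ChB A := singleAt m ⋙ coneB A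

instance : (coneB A).Additive where
  map_add {K L f g} := ChB.hom_ext' fun n => by
    change biprod.map (f.hom.f (n + 1) + g.hom.f (n + 1)) (f.hom.f n + g.hom.f n) =
      biprod.map (f.hom.f (n + 1)) (f.hom.f n) + biprod.map (g.hom.f (n + 1)) (g.hom.f n)
    ext <;> simp

lemma isZero_contractible_X (x : A) {m n : ℤ} (h : n ≠ m) (h' : n + 1 ≠ m) :
    IsZero (((contractible m).obj x).obj.X n) := by
  rw [IsZero.iff_id_eq_zero]
  exact biprod.hom_ext' _ _ ((isZero_singleAt_X x h').eq_of_src _ _)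
    ((isZero_singleAt_X x h).eq_of_src _ _)

lemma conflation_contractible {E : ExactStructure A} {S : ShortComplex A} (h : E.conflation S)
    (m : ℤ) : degreewise E (S.map (contractible m)) :=
  (bicomplicialChB E).map_conflation _ (conflation_singleAt h m)

lemma isZero_proj_contractible (R : RelExact A) (m : ℤ) (x : A) :
    IsZero (R.proj.obj ((contractible m).obj x)) :=
  R.projHb.map_isZero (isZero_toHb_coneB R.exact _)

lemma exists_from_contractible (K : ChB A) (a : ℤ) :
    ∃ H : (contractible (a + 1)).obj (K.obj.X a) ⟶ K, IsIso (H.hom.f a) := by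
  let L := ((singleAt (a + 1)).obj (K.obj.X a)).obj
  let e (n : ℤ) (h : n = a) : L.X (n + 1) ≅ K.obj.X n :=
    L.XIsoOfEq (show n + 1 = a + 1 by rw [h]) ≪≫ (singleAtEval (a + 1)).app (K.obj.X a) ≪≫
      K.obj.XIsoOfEq h.symm
  obtain ⟨H, hH⟩ := exists_desc_coneB (K := K) (L := (singleAt (a + 1)).obj (K.obj.X a))
    fun n => if h : n = a then (e n h).hom else 0
  let i : L.X (a + 1) ≅ L.X (a + 1) ⊞ L.X a :=
    ⟨biprod.inl, biprod.fst, biprod.inl_fst, biprod.hom_ext' _ _ (by simp)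
      ((isZero_singleAt_X _ (by omega)).eq_of_src _ _)⟩
  have h : H.hom.f a = (i.symm ≪≫ e a rfl).hom :=
    (Iso.eq_inv_comp i).2 ((hH a).trans (dif_pos rfl))
  exact ⟨H, h ▸ (i.symm ≪≫ e a rfl).isIso_hom⟩

lemma exists_to_contractible (K : ChB A) (b : ℤ) :
    ∃ H : K ⟶ (contractible b).obj (K.obj.X b), IsIso (H.hom.f b) := by
  let L := ((singleAt b).obj (K.obj.X b)).obj
  let e (n : ℤ) (h : n = b) : K.obj.X n ≅ L.X n :=
    K.obj.XIsoOfEq h ≪≫ ((singleAtEval b).app (K.obj.X b)).symm ≪≫ L.XIsoOfEq h.symm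
  obtain ⟨H, hH⟩ := exists_lift_coneB (K := K) (L := (singleAt b).obj (K.obj.X b))
    fun n => if h : n = b then (e n h).hom else 0
  let p : L.X (b + 1) ⊞ L.X b ≅ L.X b :=
    ⟨biprod.snd, biprod.inr, biprod.hom_ext _ _
      ((isZero_singleAt_X _ (by omega)).eq_of_tgt _ _) (by simp), biprod.inr_snd⟩
  have h : H.hom.f b = (e b rfl ≪≫ p.symm).hom :=
    (Iso.eq_comp_inv p).2 ((hH b).trans (dif_pos rfl))
  exact ⟨H, h ▸ (e b rfl ≪≫ p.symm).isIso_hom⟩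

/-- A morphism from a complex concentrated in degree zero takes values in cycles. The contractible
complex has no nonzero cycles below degree `b`, its differential there being minus the identity of
`y`. -/
lemma eq_zero_of_single_contractible {x y : A} {b : ℤ} (hb : 0 < b)
    (φ : singleB.obj x ⟶ (contractible b).obj y) : φ = 0 := by
  refine ChB.hom_ext' fun n => ?_
  by_cases hn : n = 0
  · subst hn
    have h := ChB.comm φ 0 (0 + 1)
    have h₀ : (singleB.obj x).obj.d 0 (0 + 1) = 0 := (isZero_singleAt_X x (by omega)).eq_of_tgt _ _
    rw [h₀, zero_comp] at h
    let L := ((singleAt b).obj y).obj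
    let φ' : (singleB.obj x).obj.X 0 ⟶ L.X (0 + 1) ⊞ L.X 0 := φ.hom.f 0
    have h₁ : φ' ≫ biprod.snd = 0 := (isZero_singleAt_X y (by omega)).eq_of_tgt _ _
    have h' : φ' ≫ triMap (-L.d (0 + 1) (0 + 1 + 1)) (-𝟙 (L.X (0 + 1))) (L.d 0 (0 + 1)) = 0 :=
      (congrArg (φ' ≫ ·) (coneB_d ((singleAt b).obj y) 0)).symm.trans h
    have h₂ : (φ' ≫ triMap (-L.d (0 + 1) (0 + 1 + 1)) (-𝟙 (L.X (0 + 1))) (L.d 0 (0 + 1))) ≫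
        biprod.snd = 0 := by rw [h', zero_comp]
    have h₃ : φ' ≫ biprod.fst = 0 := by
      have e : triMap (-L.d (0 + 1) (0 + 1 + 1)) (-𝟙 (L.X (0 + 1))) (L.d 0 (0 + 1)) ≫ biprod.snd =
        -biprod.fst + biprod.snd ≫ L.d 0 (0 + 1) := by ext <;> simp
      rw [Category.assoc, e, Preadditive.comp_add, ← Category.assoc φ' biprod.snd, h₁] at h₂
      simpa using h₂
    exact biprod.hom_ext φ' 0 (h₃.trans zero_comp.symm) (h₁.trans zero_comp.symm)
  · exact (isZero_singleAt_X x hn).eq_of_src _ _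

end ContractibleComplexes

/-! ### Every bounded complex is derived isomorphic to an object in degree zero. -/

section Reduction

variable {A : Type u} [Category.{v} A] [Preadditive A] [HasZeroObject A] [HasBinaryBiproducts A]

namespace ExactStructure

variable {E : ExactStructure A} {S : ShortComplex A} (h : E.conflation S)

include h

lemma isZero_X₁ (h₂ : IsZero S.X₂) : IsZero S.X₁ := by
  have := E.mono_f h
  rw [IsZero.iff_id_eq_zero, ← cancel_mono S.f]
  exact h₂.eq_of_tgt _ _

lemma isZero_X₃ (h₂ : IsZero S.X₂) : IsZero S.X₃ := by
  have := E.epi_g h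
  rw [IsZero.iff_id_eq_zero, ← cancel_epi S.g]
  exact h₂.eq_of_src _ _

lemma isZero_X₂ (h₁ : IsZero S.X₁) (h₃ : IsZero S.X₃) : IsZero S.X₂ := by
  obtain ⟨k, hk⟩ := exists_lift h (𝟙 S.X₂) (h₃.eq_of_tgt _ _)
  rw [IsZero.iff_id_eq_zero, ← hk, h₁.eq_of_tgt k 0, zero_comp]

end ExactStructure

/-- The complexes which vanish outside of the interval `[a, b]`. -/
def supportedIn (a b : ℤ) : ObjectProperty (ChB A) :=
  fun K => ∀ n, (n < a ∨ b < n) → IsZero (K.obj.X n)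

/-- This is brutal truncation: with cohomological indexing the lowest term is a quotient complex,
and dually the highest term is a subcomplex. -/
lemma exists_conflation_to_singleAt (E : ExactStructure A) (K : ChB A) {a b : ℤ} (hab : a ≤ b)
    (hK : supportedIn a b K) :
    ∃ (L : ChB A) (i : L ⟶ K) (q : K ⟶ (singleAt a).obj (K.obj.X a)) (w : i ≫ q = 0),
      degreewise E (ShortComplex.mk i q w) ∧ supportedIn (a + 1) b L := by
  have h₀ (i : ℤ) (hi : (ComplexShape.up ℤ).Rel i a) : K.obj.d i a ≫ 𝟙 _ = 0 := by
    have hi : i + 1 = a := hi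
    exact (hK i (by omega)).eq_of_src _ _
  let q : K ⟶ (singleAt a).obj (K.obj.X a) := ObjectProperty.homMk
    (HomologicalComplex.mkHomToSingle (𝟙 _) h₀)
  have hq : IsIso (q.hom.f a) := by
    have : q.hom.f a = _ := HomologicalComplex.mkHomToSingle_f (𝟙 _) h₀
    rw [this, Category.id_comp]
    exact (HomologicalComplex.singleObjXSelf _ _ _).isIso_inv
  have hq' : deflations (degreewise E) q := (deflations_degreewise_iff q).2 fun n => by
    by_cases hn : n = a
    · subst hn
      exact ExactStructure.deflation_of_isIso _
    · exact ⟨_, 𝟙 _, (isZero_singleAt_X _ hn).eq_of_tgt _ _,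
        ExactStructure.conflation_of_isZero_right (isZero_singleAt_X _ hn) _ _⟩
  obtain ⟨L, i, w, h⟩ := hq'
  refine ⟨L, i, q, w, h, fun n hn => ?_⟩
  by_cases hn' : n = a
  · subst hn'
    have : Mono (i.hom.f n) := E.mono_f (h n)
    rw [IsZero.iff_id_eq_zero, ← cancel_mono (i.hom.f n), ← cancel_mono (q.hom.f n),
      Category.id_comp, degreewise.zero w n, zero_comp, zero_comp]
  · exact ExactStructure.isZero_X₁ (h n) (hK n (by omega))

lemma exists_conflation_from_singleAt (E : ExactStructure A) (K : ChB A) {a b : ℤ} (hab : a ≤ b)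
    (hK : supportedIn a b K) :
    ∃ (L : ChB A) (i : (singleAt b).obj (K.obj.X b) ⟶ K) (q : K ⟶ L) (w : i ≫ q = 0),
      degreewise E (ShortComplex.mk i q w) ∧ supportedIn a (b - 1) L := by
  have h₀ (i : ℤ) (hi : (ComplexShape.up ℤ).Rel b i) : 𝟙 _ ≫ K.obj.d b i = 0 := by
    have hi : b + 1 = i := hi
    exact (hK i (by omega)).eq_of_tgt _ _
  let i : (singleAt b).obj (K.obj.X b) ⟶ K := ObjectProperty.homMk
    (HomologicalComplex.mkHomFromSingle (𝟙 _) h₀)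
  have hi : IsIso (i.hom.f b) := by
    have : i.hom.f b = _ := HomologicalComplex.mkHomFromSingle_f (𝟙 _) h₀
    rw [this, Category.comp_id]
    exact (HomologicalComplex.singleObjXSelf _ _ _).isIso_hom
  have hi' : inflations (degreewise E) i := (inflations_degreewise_iff i).2 fun n => by
    by_cases hn : n = b
    · subst hn
      exact ExactStructure.inflation_of_isIso _
    · exact ⟨_, 𝟙 _, (isZero_singleAt_X _ hn).eq_of_src _ _,
        ExactStructure.conflation_of_isZero_left (isZero_singleAt_X _ hn) _ _⟩
  obtain ⟨L, q, w, h⟩ := hi'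
  refine ⟨L, i, q, w, h, fun n hn => ?_⟩
  by_cases hn' : n = b
  · subst hn'
    have : Epi (q.hom.f n) := E.epi_g (h n)
    rw [IsZero.iff_id_eq_zero, ← cancel_epi (q.hom.f n), ← cancel_epi (i.hom.f n),
      Category.comp_id, degreewise.zero w n, comp_zero, comp_zero]
  · exact ExactStructure.isZero_X₃ (h n) (hK n (by omega))

namespace RelExact

/-- The complexes which are isomorphic in the derived category to an object `z`, in such a way that
morphisms of complexes from objects correspond to morphisms to `z`. -/
def reducible (R : RelExact A) : ObjectProperty (ChB A) := fun K =>
  ∃ (z : A) (θ : R.proj.obj K ≅ R.proj.obj (singleB.obj z)),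
    ∀ (x : A) (f : singleB.obj x ⟶ K), ∃ f' : x ⟶ z,
      R.proj.map f ≫ θ.hom = R.proj.map (singleB.map f')

variable {R : RelExact A}

lemma reducible_of_hom {K L : ChB A} (s : K ⟶ L) (hs : IsIso (R.proj.map s))
    (h : R.reducible L) : R.reducible K := by
  obtain ⟨z, θ, h⟩ := h
  refine ⟨z, asIso (R.proj.map s) ≪≫ θ, fun x f => ?_⟩
  obtain ⟨f', hf'⟩ := h x (f ≫ s)
  exact ⟨f', by simpa using hf'⟩

lemma reducible_of_lift {K L : ChB A} (s : K ⟶ L) (hs : IsIso (R.proj.map s))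
    (hl : ∀ (x : A) (f : singleB.obj x ⟶ L), ∃ f', f' ≫ s = f) (h : R.reducible K) :
    R.reducible L := by
  obtain ⟨z, θ, h⟩ := h
  refine ⟨z, (asIso (R.proj.map s)).symm ≪≫ θ, fun x f => ?_⟩
  obtain ⟨f, rfl⟩ := hl x f
  obtain ⟨f', hf'⟩ := h x f
  exact ⟨f', by simpa using hf'⟩

lemma reducible_of_supportedIn_zero {K : ChB A} (hK : supportedIn 0 0 K) : R.reducible K := by
  obtain ⟨L, i, q, w, h, hL⟩ := exists_conflation_to_singleAt R.exact K le_rfl hK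
  have hq : IsIso (R.proj.map q) := (isZero_proj_X₁_iff h).1 (R.isZero_proj_of_acyclicHb
    ⟨L.obj, strictlyAcyclic_of_isZero _ fun n => hL n (by omega), ⟨Iso.refl _⟩⟩)
  let θ : R.proj.obj K ≅ R.proj.obj ((singleAt 0).obj (K.obj.X 0)) := asIso (R.proj.map q)
  refine ⟨K.obj.X 0, θ, fun x f => ?_⟩
  obtain ⟨f', hf'⟩ := (HomologicalComplex.single A (ComplexShape.up ℤ) 0).map_surjective
    (f ≫ q).hom
  refine ⟨f', (R.proj.map_comp _ _).symm.trans (congrArg R.proj.map ?_)⟩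
  ext : 1
  exact hf'.symm

namespace IsBicomplicialPair

variable {B : Bicomplicial R.exact} (hB : R.IsBicomplicialPair B)

include hB

lemma trivial_contractible_X {x : A} (hx : R.trivial x) (m n : ℤ) :
    R.trivial (((contractible m).obj x).obj.X n) :=
  hB.trivial_biprod (hB.trivial_singleAt_X hx _ _) (hB.trivial_singleAt_X hx _ _)

/-- Pushing out along the contractible complexes on `K^a ↣ C(K^a)`, in degrees `a` and `a + 1`,
enlarges `K` by a contractible quotient. By the extension axiom its term of degree `a` becomes
weakly equivalent to a trivial one and can be truncated. Morphisms from degree zero lift through the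
truncation because `a ≠ 0`. -/
lemma reducible_of_low {a b : ℤ} (ha : a < 0) (hb : a < b)
    (h : ∀ K, supportedIn (a + 1) b K → R.reducible K) {K : ChB A} (hK : supportedIn a b K) :
    R.reducible K := by
  obtain ⟨H, hH⟩ := exists_from_contractible K a
  have hc := conflation_contractible (B.conflation_ι_π (K.obj.X a)) (a + 1)
  obtain ⟨K', f', i', sq, -⟩ := R.exact.chB.pushout _ H ⟨_, _, _, hc⟩
  let p' := sq.desc ((contractible (a + 1)).map (B.π.app (K.obj.X a))) 0 (by
    rw [← Functor.map_comp, B.ι_π, Functor.map_zero, comp_zero])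
  have hp' : f' ≫ p' = (contractible (a + 1)).map (B.π.app (K.obj.X a)) := sq.inl_desc _ _ _
  have hS : degreewise R.exact (ShortComplex.mk i' p' (sq.inr_desc _ _ _)) :=
    ExactStructure.conflation_of_isPushout (E := R.exact.chB) hc sq hp' _
  have hi' : IsIso (R.proj.map i') := (isZero_proj_X₃_iff hS).1 (isZero_proj_contractible R _ _)
  have hK' : supportedIn a b K' := fun n hn => ExactStructure.isZero_X₂ (hS n) (hK n hn)
    (isZero_contractible_X _ (by omega) (by omega))
  let Φ : (ShortComplex.mk (B.ι.app (K.obj.X a)) (B.π.app (K.obj.X a)) (B.ι_π _)).map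
      (contractible (a + 1)) ⟶ ShortComplex.mk i' p' (sq.inr_desc _ _ _) :=
    { τ₁ := H, τ₂ := f', τ₃ := 𝟙 _, comm₁₂ := sq.w.symm
      comm₂₃ := hp'.trans (Category.comp_id _).symm }
  have hf' : R.w (f'.hom.f a) := hB.extensional ((evalB a).mapShortComplex.map Φ) (hc a) (hS a)
    (hB.of_isIso (H.hom.f a)) (hB.of_isIso (𝟙 _))
  have hK'a : R.trivial (K'.obj.X a) :=
    (hB.trivial_iff hf').1 (hB.trivial_contractible_X (hB.trivial_C _) _ _)
  obtain ⟨L, i, q, w, hL, hL'⟩ := exists_conflation_to_singleAt R.exact K' hb.le hK'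
  have hi : IsIso (R.proj.map i) := (isZero_proj_X₃_iff hL).1
    (R.isZero_proj_of_trivial (hB.trivial_singleAt_X hK'a _))
  refine reducible_of_hom i' hi' (reducible_of_lift i hi (fun x f => ?_) (h L hL'))
  refine ExactStructure.exists_lift (E := R.exact.chB) hL f (ChB.hom_ext' fun n => ?_)
  by_cases hn : n = 0
  · exact (isZero_singleAt_X _ (by omega)).eq_of_tgt _ _
  · exact (isZero_singleAt_X x hn).eq_of_src _ _

/-- Dual to the low case: `K^b` is written as `Ty`, and `K` is pulled back along the contractible
complexes on `Cy ↠ Ty`, in degrees `b - 1` and `b`. Morphisms `j x ⟶ K` lift to the pullback because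
their composite to the contractible complex on `K^b` vanishes for `b > 0`. -/
lemma reducible_of_high {a b : ℤ} (hb : 0 < b) (ha : a < b)
    (h : ∀ K, supportedIn a (b - 1) K → R.reducible K) {K : ChB A} (hK : supportedIn a b K) :
    R.reducible K := by
  obtain ⟨H, hH⟩ := exists_to_contractible K b
  obtain ⟨y, ⟨θ⟩⟩ : ∃ y, Nonempty (B.T.obj y ≅ K.obj.X b) := ⟨_, ⟨B.T.objObjPreimageIso _⟩⟩
  have hy₀ : B.ι.app y ≫ B.π.app y ≫ θ.hom = 0 := by rw [← Category.assoc, B.ι_π, zero_comp]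
  have hy : R.exact.conflation (ShortComplex.mk (B.ι.app y) (B.π.app y ≫ θ.hom) hy₀) :=
    R.exact.of_iso (ShortComplex.isoMk (S₁ := ShortComplex.mk (B.ι.app y) (B.π.app y) (B.ι_π y))
      (Iso.refl _) (Iso.refl _) θ (by simp) (by simp)) (B.conflation_ι_π y)
  have hc := conflation_contractible hy b
  obtain ⟨K', f', p', sq, -⟩ := R.exact.chB.pullback _ H ⟨_, _, _, hc⟩
  let i' := sq.lift ((contractible b).map (B.ι.app y)) 0 (by
    rw [← Functor.map_comp, hy₀, Functor.map_zero, zero_comp])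
  have hi' : i' ≫ f' = (contractible b).map (B.ι.app y) := sq.lift_fst _ _ _
  have hS : degreewise R.exact (ShortComplex.mk i' p' (sq.lift_snd _ _ _)) :=
    ExactStructure.conflation_of_isPullback (E := R.exact.chB) hc sq hi' _
  have hp' : IsIso (R.proj.map p') := (isZero_proj_X₁_iff hS).1 (isZero_proj_contractible R _ _)
  have hK' : supportedIn a b K' := fun n hn => ExactStructure.isZero_X₂ (hS n)
    (isZero_contractible_X _ (by omega) (by omega)) (hK n hn)
  let Φ : ShortComplex.mk i' p' (sq.lift_snd _ _ _) ⟶ (ShortComplex.mk (B.ι.app y)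
      (B.π.app y ≫ θ.hom) hy₀).map (contractible b) :=
    { τ₁ := 𝟙 _, τ₂ := f', τ₃ := H, comm₁₂ := (Category.id_comp _).trans hi'.symm
      comm₂₃ := sq.w }
  have hf' : R.w (f'.hom.f b) := hB.extensional ((evalB b).mapShortComplex.map Φ) (hS b) (hc b)
    (hB.of_isIso (𝟙 _)) (hB.of_isIso (H.hom.f b))
  have hK'b : R.trivial (K'.obj.X b) :=
    (hB.trivial_iff hf').2 (hB.trivial_contractible_X (hB.trivial_C _) _ _)
  obtain ⟨L, i, q, w, hL, hL'⟩ := exists_conflation_from_singleAt R.exact K' ha.le hK'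
  have hq : IsIso (R.proj.map q) := (isZero_proj_X₁_iff hL).1
    (R.isZero_proj_of_trivial (hB.trivial_singleAt_X hK'b _))
  exact reducible_of_lift p' hp' (fun x f => ⟨sq.lift 0 f (zero_comp.trans
    (eq_zero_of_single_contractible hb _).symm), sq.lift_snd _ _ _⟩)
    (reducible_of_hom q hq (h L hL'))

theorem reducible (K : ChB A) : R.reducible K := by
  have h₁ (n : ℕ) : ∀ K, supportedIn 0 (n : ℤ) K → R.reducible K := by
    induction n with
    | zero => exact fun K => reducible_of_supportedIn_zero
    | succ n hn =>
      refine fun K => hB.reducible_of_high (by omega) (by omega) fun L hL => hn L ?_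
      rwa [Nat.cast_succ, add_sub_cancel_right] at hL
  have h₂ (n m : ℕ) : ∀ K, supportedIn (-m : ℤ) (n : ℤ) K → R.reducible K := by
    induction m with
    | zero => simpa using h₁ n
    | succ m hm =>
      refine fun K => hB.reducible_of_low (by omega) (by omega) fun L hL => hm L ?_
      rwa [Nat.cast_succ, neg_add, neg_add_cancel_right] at hL
  obtain ⟨a, b, hK⟩ := K.property
  exact h₂ b.natAbs a.natAbs K fun n hn => hK n (by omega)

end IsBicomplicialPair

end RelExact

end Reduction

/-! ### Left fractions of complexes in the derived category. -/

section Fractions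

variable {C : Type u} [Category.{v} C] [Preadditive C] [HasBinaryBiproducts C] [HasZeroObject C]
  (R : RelExact C)

lemma RelExact.exists_leftFraction {K L : ChB C} (φ : R.proj.obj K ⟶ R.proj.obj L) :
    ∃ (L' : ChB C) (f : K ⟶ L') (s : L ⟶ L'), IsIso (R.proj.map s) ∧
      φ ≫ R.proj.map s = R.proj.map f := by
  let N : ObjectProperty (Hb C) := fun X => IsZero (R.projHb.obj X)
  have hN : N.IsTriangulated := isTriangulated_isZero_obj R.projHb
  -- The projection is a composite of two Verdier quotients. Identifying the morphisms it inverts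
  -- with those having cone in its kernel gives a single calculus of fractions.
  have h₁ : N.trW = (MorphismProperty.isomorphisms R.Db).inverseImage R.projHb := by
    ext X Y f
    constructor
    · rintro ⟨Z, g, h, hT, hZ⟩
      exact (Triangle.isZero₃_iff_isIso₁ _ (R.projHb.map_distinguished _ hT)).1 hZ
    · intro hf
      obtain ⟨Z, g, h, hT⟩ := distinguished_cocone_triangle f
      exact ⟨Z, g, h, hT,
        (Triangle.isZero₃_iff_isIso₁ _ (R.projHb.map_distinguished _ hT)).2 hf⟩
  have h₂ : R.projHb.IsLocalization N.trW := by
    rw [h₁]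
    infer_instance
  let φ' : R.projHb.obj ((toHb C).obj K) ⟶ R.projHb.obj ((toHb C).obj L) := φ
  obtain ⟨ψ, hψ⟩ := Localization.exists_leftFraction R.projHb N.trW φ'
  obtain ⟨L', ⟨e⟩⟩ : ∃ L', Nonempty ((toHb C).obj L' ≅ ψ.Y') :=
    ⟨_, ⟨(toHb C).objObjPreimageIso _⟩⟩
  obtain ⟨f', hf'⟩ := (toHb C).map_surjective (ψ.f ≫ e.inv)
  obtain ⟨s', hs'⟩ := (toHb C).map_surjective (ψ.s ≫ e.inv)
  have hs₀ : IsIso (R.projHb.map ψ.s) := Localization.inverts R.projHb N.trW _ ψ.hs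
  refine ⟨L', f', s', ?_, ?_⟩
  · change IsIso (R.projHb.map ((toHb C).map s'))
    rw [hs', Functor.map_comp]
    infer_instance
  · change φ' ≫ R.projHb.map ((toHb C).map s') = R.projHb.map ((toHb C).map f')
    rw [hs', hf', Functor.map_comp, Functor.map_comp, ← Category.assoc, hψ]
    exact congrArg (· ≫ _) (MorphismProperty.LeftFraction.map_comp_map_s _ _ _)

end Fractions

/-! ### Testing fullness and faithfulness along an essentially surjective functor. -/

section FullyFaithful

variable {C T D : Type*} [Category C] [Category T] [Category D] (L : C ⥤ T) [L.EssSurj] (F : T ⥤ D)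

lemma full_of_essSurj (h : ∀ {x y : C} (ψ : F.obj (L.obj x) ⟶ F.obj (L.obj y)),
    ∃ φ, F.map φ = ψ) : F.Full where
  map_surjective {X Y} ψ := by
    obtain ⟨φ, hφ⟩ := h (F.map (L.objObjPreimageIso X).hom ≫ ψ ≫
      F.map (L.objObjPreimageIso Y).inv)
    exact ⟨(L.objObjPreimageIso X).inv ≫ φ ≫ (L.objObjPreimageIso Y).hom, by simp [hφ]⟩

lemma faithful_of_essSurj (h : ∀ {x y : C} (φ φ' : L.obj x ⟶ L.obj y),
    F.map φ = F.map φ' → φ = φ') : F.Faithful where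
  map_injective {X Y} φ φ' hφ := by
    have := h ((L.objObjPreimageIso X).hom ≫ φ ≫ (L.objObjPreimageIso Y).inv)
      ((L.objObjPreimageIso X).hom ≫ φ' ≫ (L.objObjPreimageIso Y).inv) (by simp [hφ])
    simpa using this

end FullyFaithful

/-! ### The equivalence between `𝒯(A, w)` and `D_b(A, w)` on underlying categories. -/

section Comparison

variable {A : Type u} [Category.{v} A] [Preadditive A] [HasZeroObject A] [HasBinaryBiproducts A]

namespace RelExact.IsBicomplicialPair

variable {R : RelExact A} {B : Bicomplicial R.exact} (hB : R.IsBicomplicialPair B)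

include hB

/-- A fraction of complexes has both legs starting at objects in degree zero, so reduction of its
apex replaces both legs by morphisms of `A`. The denominator becomes invertible in the derived
category, hence lies in `w`. -/
lemma exists_leftFraction_singleB (hR : R.IsThick) {x y : A}
    (ψ : R.proj.obj (singleB.obj x) ⟶ R.proj.obj (singleB.obj y)) :
    ∃ (z : A) (f : x ⟶ z) (s : y ⟶ z), R.w s ∧
      ψ ≫ R.proj.map (singleB.map s) = R.proj.map (singleB.map f) := by
  obtain ⟨L, f, s, hs, h⟩ := R.exists_leftFraction ψ
  obtain ⟨z, θ, hθ⟩ := hB.reducible L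
  obtain ⟨f', hf'⟩ := hθ x f
  obtain ⟨s', hs'⟩ := hθ y s
  refine ⟨z, f', s', hB.w_of_isIso_proj_singleB hR (hs' ▸ inferInstance), ?_⟩
  rw [← hs', ← hf', ← Category.assoc, h]

/-- As `f - f'` vanishes in the derived category, the inclusion of `y` in its cone acquires a
retraction there. Writing the retraction as a fraction `(r', t)` of `A`, the composite of the
inclusion with `r'` has the same image as `t`, so it is in `w`; it equalizes `f` and `f'` up to
homotopy since the inclusion already does. -/
lemma exists_w_of_proj_singleB_eq (hR : R.IsThick) {x y : A} {f f' : x ⟶ y}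
    (h : R.proj.map (singleB.map f) = R.proj.map (singleB.map f')) :
    ∃ (z : A) (t : y ⟶ z), R.w t ∧ B.homotopic (f ≫ t) (f' ≫ t) := by
  obtain ⟨w, hS⟩ := B.conflation_cone (f - f')
  have hS' := conflation_singleB hS
  have hC : IsZero (R.proj.obj (singleB.obj (B.C.obj x))) :=
    hB.isZero_proj_singleB (hB.trivial_C x)
  let G : A ⥤ R.Db := singleB ⋙ R.proj
  have hG : G.Additive := inferInstance
  let ι : x ⟶ B.C.obj x := B.ι.app x
  have hG₀ : G.map (biprod.lift ι (f - f')) = 0 := by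
    have e : biprod.lift ι (f - f') = ι ≫ biprod.inl + (f - f') ≫ biprod.inr := by ext <;> simp
    have h' : G.map f = G.map f' := h
    rw [e, Functor.map_add, Functor.map_comp, Functor.map_comp, Functor.map_sub, h', sub_self,
      zero_comp, add_zero, show G.map ι = 0 from hC.eq_of_tgt _ _, zero_comp]
  obtain ⟨ρ, hρ⟩ : ∃ ρ : G.obj (B.coneObj (f - f')) ⟶ G.obj (B.C.obj x ⊞ y),
      𝟙 _ = G.map (biprod.desc (B.coneInl (f - f')) (-B.coneInr (f - f'))) ≫ ρ :=
    Triangle.yoneda_exact₂ _ (R.distinguished hS') (𝟙 _) ((Category.comp_id _).trans hG₀)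
  let r : G.obj (B.coneObj (f - f')) ⟶ G.obj y := -ρ ≫ G.map biprod.snd
  have hr : G.map (B.coneInr (f - f')) ≫ r = 𝟙 _ := by
    have := congrArg (fun φ => G.map biprod.inr ≫ φ ≫ G.map biprod.snd) hρ
    rw [Category.id_comp, ← Functor.map_comp, biprod.inr_snd, Category.assoc, ← Category.assoc,
      ← Functor.map_comp, biprod.inr_desc, CategoryTheory.Functor.map_id, Functor.map_neg] at this
    rw [this]
    simp [r]
  obtain ⟨z, r', t, ht, hr'⟩ := hB.exists_leftFraction_singleB hR r
  refine ⟨z, B.coneInr (f - f') ≫ r', hB.w_of_isIso_proj_singleB hR ?_,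
    B.coneInl (f - f') ≫ r', ?_⟩
  · have : G.map (B.coneInr (f - f') ≫ r') = G.map t := by
      rw [Functor.map_comp, show G.map r' = r ≫ G.map t from hr'.symm, ← Category.assoc, hr,
        Category.id_comp]
    have ht' := hB.isIso_proj_singleB ht
    exact this ▸ ht'
  · rw [← Category.assoc, ← Category.assoc, ← Preadditive.sub_comp, ← Preadditive.sub_comp]
    exact (congrArg (· ≫ r') (B.isPushout_cone (f - f')).w).trans (Category.assoc _ _ _)

/-- The functor from the localization of a bicomplicial pair to the derived category. -/
lemma exists_comparison (hR : R.IsThick) :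
    ∃ (Θ : R.T B ⥤ R.Db) (_ : R.projT B ⋙ Θ ≅ singleB ⋙ R.proj), Θ.IsEquivalence := by
  have := hB.isLocalization_projT
  let Θ := Localization.lift (singleB ⋙ R.proj) (fun _ _ _ hs => hB.isIso_proj_singleB hs)
    (R.projT B)
  let e : R.projT B ⋙ Θ ≅ singleB ⋙ R.proj := Localization.fac _ _ _
  have hL : (R.projT B).EssSurj := Localization.essSurj _ R.w
  have hP : R.proj.EssSurj := Localization.essSurj _ R.qw
  have h₁ : Θ.Full := full_of_essSurj (R.projT B) Θ fun {x y} ψ => by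
    obtain ⟨z, f, s, hs, h⟩ := hB.exists_leftFraction_singleB hR
      (e.inv.app x ≫ ψ ≫ e.hom.app y)
    have hs' : IsIso ((R.projT B).map s) := Localization.inverts (R.projT B) R.w s hs
    refine ⟨(R.projT B).map f ≫ inv ((R.projT B).map s), ?_⟩
    rw [Functor.map_comp, Functor.map_inv, IsIso.comp_inv_eq, ← cancel_mono (e.hom.app z),
      ← cancel_epi (e.inv.app x)]
    have h₁ := e.hom.naturality f
    have h₂ := e.hom.naturality s
    dsimp at h h₁ h₂ ⊢
    rw [h₁, Category.assoc, h₂]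
    simpa using h.symm
  have h₂ : Θ.Faithful := faithful_of_essSurj (R.projT B) Θ fun {x y} φ φ' hφ => by
    obtain ⟨z, f, f', s, hs, h, h'⟩ := hB.exists_leftFraction₂_projT φ φ'
    have hs' : IsIso ((R.projT B).map s) := Localization.inverts (R.projT B) R.w s hs
    have hf : Θ.map ((R.projT B).map f) = Θ.map ((R.projT B).map f') := by
      rw [← h, ← h', Functor.map_comp, Functor.map_comp, hφ]
    obtain ⟨z', t, ht, hft⟩ := hB.exists_w_of_proj_singleB_eq hR (f := f) (f' := f') (by
      have h₁ := e.hom.naturality f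
      have h₂ := e.hom.naturality f'
      dsimp at h₁ h₂
      rw [← cancel_epi (e.hom.app x)]
      dsimp
      rw [← h₁, ← h₂, hf])
    have ht' : IsIso ((R.projT B).map t) := Localization.inverts (R.projT B) R.w t ht
    have h₃ := hB.projT_map_eq_of_homotopic hft
    rw [Functor.map_comp, Functor.map_comp, cancel_mono] at h₃
    rwa [← cancel_mono ((R.projT B).map s), h, h']
  have h₃ : Θ.EssSurj := ⟨fun X => by
    obtain ⟨z, θ, -⟩ := hB.reducible (R.proj.objPreimage X)
    exact ⟨(R.projT B).obj z, ⟨e.app z ≪≫ θ.symm ≪≫ R.proj.objObjPreimageIso X⟩⟩⟩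
  exact ⟨Θ, e, { }⟩

end RelExact.IsBicomplicialPair

end Comparison

/-! ### From equivalences of categories to triangle equivalences. -/

section TriangleEquivalences

lemma TriangleData.map_quotientSusp_comp {T : Type u} [Category.{v} T] {D : TriangleData T}
    (hD : D.SuspCompat) (N : ObjectProperty T) {X Z : (D.verdierW N).Localization} {x x' z z' : T}
    {w : Z ⟶ (D.quotientSusp hD N).obj X} {a : X ⟶ (D.verdierW N).Q.obj x'}
    {c : Z ⟶ (D.verdierW N).Q.obj z'} {a' : x' ⟶ x} {c' : z' ⟶ z} {h' : z' ⟶ D.susp.obj x'}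
    {ψ : z ⟶ D.susp.obj x}
    (h₁ : w ≫ (D.quotientSusp hD N).map a =
      c ≫ (D.verdierW N).Q.map h' ≫ (D.quotientSuspIso hD N).inv.app x')
    (h₂ : h' ≫ D.susp.map a' = c' ≫ ψ) :
    w ≫ (D.quotientSusp hD N).map (a ≫ (D.verdierW N).Q.map a') =
      (c ≫ (D.verdierW N).Q.map c') ≫ (D.verdierW N).Q.map ψ ≫
        (D.quotientSuspIso hD N).inv.app x := by
  have nat := (D.quotientSuspIso hD N).inv.naturality a'
  dsimp at nat
  have h₃ := congrArg (D.verdierW N).Q.map h₂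
  rw [Functor.map_comp, Functor.map_comp] at h₃
  rw [Functor.map_comp, ← Category.assoc, h₁, Category.assoc, Category.assoc, ← nat,
    Category.assoc]
  exact congrArg (c ≫ ·) ((Category.assoc _ _ _).symm.trans
    ((congrArg (· ≫ _) h₃).trans (Category.assoc _ _ _)))

namespace RelExact.IsBicomplicialPair

variable {A : Type u} [Category.{v} A] [Preadditive A] [HasZeroObject A] [HasBinaryBiproducts A]
  {R : RelExact A} {B : Bicomplicial R.exact} (hB : R.IsBicomplicialPair B)

variable (R B) in
/-- The compatibility of the projection with the suspensions. -/
noncomputable def _root_.DerivedGW.RelExact.suspIsoT :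
    R.projT B ⋙ (R.triangleDataT B).susp ≅ B.T ⋙ R.projT B :=
  Functor.isoWhiskerLeft B.toHo (TriangleData.quotientSuspIso B.suspCompat (R.trivialHo B))

-- This collapses the two successive closures under isomorphism, in the homotopy category and in its
-- quotient, so exactness can be tested on cone sequences of `A` directly.
include hB in
lemma exact_triangleDataT_iff {X Y Z : R.T B} (u : X ⟶ Y) (v : Y ⟶ Z)
    (w : Z ⟶ (R.triangleDataT B).susp.obj X) :
    (R.triangleDataT B).exact u v w ↔ ∃ (x y z : A) (f : x ⟶ y) (κ : y ⟶ z) (ψ : z ⟶ B.T.obj x)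
      (a : X ≅ (R.projT B).obj x) (b : Y ≅ (R.projT B).obj y) (c : Z ≅ (R.projT B).obj z),
      B.IsConeSequence f κ ψ ∧ u ≫ b.hom = a.hom ≫ (R.projT B).map f ∧
        v ≫ c.hom = b.hom ≫ (R.projT B).map κ ∧
        w ≫ (R.triangleDataT B).susp.map a.hom =
          c.hom ≫ (R.projT B).map ψ ≫ (R.suspIsoT B).inv.app x := by
  constructor
  · rintro ⟨x', y', z', f', g', h', a, b, c, ⟨x, y, z, f, κ, ψ, a', b', c', h, h₁', h₂', h₃'⟩,
      h₁, h₂, h₃⟩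
    let Q := (B.triangleData.verdierW (R.trivialHo B)).Q
    refine ⟨x, y, z, f, κ, ψ, a ≪≫ Q.mapIso a', b ≪≫ Q.mapIso b', c ≪≫ Q.mapIso c', h, ?_, ?_, ?_⟩
    · change u ≫ b.hom ≫ Q.map b'.hom = (a.hom ≫ Q.map a'.hom) ≫ Q.map (B.toHo.map f)
      rw [← Category.assoc, h₁, Category.assoc, Category.assoc, ← Functor.map_comp,
        ← Functor.map_comp, h₁']
    · change v ≫ c.hom ≫ Q.map c'.hom = (b.hom ≫ Q.map b'.hom) ≫ Q.map (B.toHo.map κ)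
      rw [← Category.assoc, h₂, Category.assoc, Category.assoc, ← Functor.map_comp,
        ← Functor.map_comp, h₂']
    · exact TriangleData.map_quotientSusp_comp B.suspCompat (R.trivialHo B) h₃ h₃'
  · rintro ⟨x, y, z, f, κ, ψ, a, b, c, h, h₁, h₂, h₃⟩
    exact ⟨_, _, _, _, _, _, a, b, c, hB.exact_of_isConeSequence h, h₁, h₂, h₃⟩

-- By left fractions every morphism of `𝒯` is isomorphic to the image of a morphism of `A`, whose
-- cone sequence is then transported.
include hB in
lemma exists_exact_triangleDataT {X Y : R.T B} (u : X ⟶ Y) :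
    ∃ (Z : R.T B) (v : Y ⟶ Z) (w : Z ⟶ (R.triangleDataT B).susp.obj X),
      (R.triangleDataT B).exact u v w := by
  have := hB.isLocalization_projT
  have hL : (R.projT B).EssSurj := Localization.essSurj _ R.w
  let S := (R.triangleDataT B).susp
  let a := (R.projT B).objObjPreimageIso X
  let b := (R.projT B).objObjPreimageIso Y
  obtain ⟨y, f, -, s, hs, h, -⟩ := hB.exists_leftFraction₂_projT (a.hom ≫ u ≫ b.inv)
    (a.hom ≫ u ≫ b.inv)
  have hs' : IsIso ((R.projT B).map s) := Localization.inverts (R.projT B) R.w s hs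
  obtain ⟨z, κ, ψ, hf⟩ := B.exists_isConeSequence f
  let w : (R.projT B).obj z ⟶ S.obj X :=
    (R.projT B).map ψ ≫ (R.suspIsoT B).inv.app _ ≫ S.map a.hom
  let b' : Y ≅ (R.projT B).obj y := b.symm ≪≫ asIso ((R.projT B).map s)
  refine ⟨(R.projT B).obj z, b'.hom ≫ (R.projT B).map κ, w,
    (hB.exact_triangleDataT_iff _ _ _).2 ⟨_, _, _, f, κ, ψ, a.symm, b', Iso.refl _, hf, ?_, ?_, ?_⟩⟩
  · rw [← h]
    simp [b']
  · exact Category.comp_id _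
  · have e : w ≫ S.map a.inv = (R.projT B).map ψ ≫ (R.suspIsoT B).inv.app _ := by
      change ((R.projT B).map ψ ≫ (R.suspIsoT B).inv.app _ ≫ S.map a.hom) ≫ S.map a.inv = _
      rw [Category.assoc, Category.assoc, ← S.map_comp, Iso.hom_inv_id, S.map_id]
      exact congrArg ((R.projT B).map ψ ≫ ·) (Category.comp_id _)
    exact e.trans (Category.id_comp _).symm

end RelExact.IsBicomplicialPair

section

variable {A : Type u} [Category.{v} A] [Preadditive A] [HasZeroObject A] [HasBinaryBiproducts A]
  {R : RelExact A} {B : Bicomplicial R.exact}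
  {D : Type*} [Category D] [Preadditive D] [HasZeroObject D] [HasShift D ℤ]
  [∀ n : ℤ, (shiftFunctor D n).Additive] [Pretriangulated D] (P : A ⥤ D) [P.Additive]

/-- Natural connecting morphisms which turn the admissible short exact sequences into
distinguished triangles. -/
structure RelExact.Connecting (R : RelExact A) where
  conn : ∀ {S : ShortComplex A}, R.exact.conflation S → (P.obj S.X₃ ⟶ (P.obj S.X₁)⟦(1 : ℤ)⟧)
  distinguished : ∀ {S : ShortComplex A} (hS : R.exact.conflation S),
    Triangle.mk (P.map S.f) (P.map S.g) (conn hS) ∈ distTriang D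
  naturality : ∀ {S S' : ShortComplex A} (φ : S ⟶ S') (hS : R.exact.conflation S)
    (hS' : R.exact.conflation S'), P.map φ.τ₃ ≫ conn hS' = conn hS ≫ (P.map φ.τ₁)⟦(1 : ℤ)⟧'

namespace RelExact.Connecting

variable {P} (c : R.Connecting P)

variable (B) in
/-- The comparison of the suspension of a bicomplicial category with the shift. -/
def susp (x : A) : P.obj (B.T.obj x) ⟶ (P.obj x)⟦(1 : ℤ)⟧ := -c.conn (B.conflation_ι_π x)

lemma susp_naturality {x y : A} (f : x ⟶ y) :
    P.map (B.T.map f) ≫ c.susp B y = c.susp B x ≫ (P.map f)⟦(1 : ℤ)⟧' := by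
  let S := ShortComplex.mk _ _ (B.ι_π x)
  let S' := ShortComplex.mk _ _ (B.ι_π y)
  let φ : S ⟶ S' := ShortComplex.homMk (S₁ := S) (S₂ := S') f (B.C.map f) (B.T.map f)
    (B.ι.naturality f) (B.π.naturality f)
  have h : P.map (B.T.map f) ≫ c.conn (B.conflation_ι_π y) =
      c.conn (B.conflation_ι_π x) ≫ (P.map f)⟦(1 : ℤ)⟧' :=
    c.naturality φ (B.conflation_ι_π x) (B.conflation_ι_π y)
  change P.map (B.T.map f) ≫ (-c.conn (B.conflation_ι_π y)) =
    (-c.conn (B.conflation_ι_π x)) ≫ (P.map f)⟦(1 : ℤ)⟧'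
  rw [Preadditive.comp_neg, Preadditive.neg_comp, h]

lemma isIso_susp (hC : ∀ x, IsZero (P.obj (B.C.obj x))) (x : A) : IsIso (c.susp B x) := by
  have : IsIso (c.conn (B.conflation_ι_π x)) :=
    (Triangle.isZero₂_iff_isIso₃ _ (c.distinguished (B.conflation_ι_π x))).1 (hC x)
  exact ⟨-inv (c.conn (B.conflation_ι_π x)), by simp [susp], by simp [susp]⟩

/-- The cone sequence is compared with the conflation `x ⟶ Cx ⊞ y ⟶ z`, whose second map is `-κ` on
`y`. Since `P` kills `Cx`, the middle term becomes `P y`; the sign of `κ` is absorbed by `-𝟙` on `P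
z`, and this is why `susp` is minus the connecting morphism. -/
lemma distinguished_of_isConeSequence (hC : ∀ x, IsZero (P.obj (B.C.obj x))) {x y z : A}
    {f : x ⟶ y} {κ : y ⟶ z} {ψ : z ⟶ B.T.obj x} (h : B.IsConeSequence f κ ψ) :
    Triangle.mk (P.map f) (P.map κ) (P.map ψ ≫ c.susp B x) ∈ distTriang D := by
  obtain ⟨μ, hp, hκ, hμ⟩ := h
  let ι : x ⟶ B.C.obj x := B.ι.app x
  let S := ShortComplex.mk ι (B.π.app x) (B.ι_π x)
  let S' := ShortComplex.mk (biprod.lift ι f) (biprod.desc μ (-κ)) (by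
    rw [biprod.lift_desc, Preadditive.comp_neg]
    exact (congrArg (· + _) hp.w.symm).trans (add_neg_cancel _))
  have hS : R.exact.conflation S := B.conflation_ι_π x
  have hS' : R.exact.conflation S' := R.exact.conflation_biprod_of_isPushout
    ⟨_, _, _, hS⟩ hp.flip
  let φ : S' ⟶ S := ShortComplex.homMk (S₁ := S') (S₂ := S) (𝟙 x) biprod.fst ψ
    (by simp [S, S']) (by
      apply biprod.hom_ext'
      · simpa [S, S'] using hμ.symm
      · simpa [S, S'] using hκ)
  have hφ : P.map ψ ≫ c.conn hS = c.conn hS' := by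
    have : P.map ψ ≫ c.conn hS = c.conn hS' ≫ (P.map (𝟙 x))⟦(1 : ℤ)⟧' := c.naturality φ hS' hS
    rwa [CategoryTheory.Functor.map_id, CategoryTheory.Functor.map_id, Category.comp_id] at this
  have hsnd : IsIso (P.map (biprod.snd : B.C.obj x ⊞ y ⟶ y)) := by
    have hz : P.map (biprod.fst ≫ biprod.inl : B.C.obj x ⊞ y ⟶ B.C.obj x ⊞ y) = 0 := by
      rw [P.map_comp, (hC x).eq_of_tgt (P.map biprod.fst) 0, zero_comp]
    refine ⟨P.map biprod.inr, ?_, by rw [← P.map_comp, biprod.inr_snd, P.map_id]⟩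
    rw [← P.map_comp, ← P.map_id, ← biprod.total, P.map_add, hz, zero_add]
  let neg : P.obj z ≅ P.obj z := ⟨-𝟙 _, -𝟙 _, by simp, by simp⟩
  refine isomorphic_distinguished _ (c.distinguished hS') _ (Iso.symm
    (Triangle.isoMk _ _ (Iso.refl _) (@asIso _ _ _ _ _ hsnd) neg ?_ ?_ ?_))
  · exact (P.map_comp _ _).symm.trans ((congrArg P.map (biprod.lift_snd _ _)).trans
      (Category.id_comp _).symm)
  · change P.map (biprod.desc μ (-κ)) ≫ (-𝟙 _) = P.map biprod.snd ≫ P.map κ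
    have h₁ : P.map (biprod.desc μ (-κ)) = -(P.map biprod.snd ≫ P.map κ) := by
      rw [← P.map_comp, biprod.desc_eq, P.map_add, P.map_comp,
        (hC x).eq_of_tgt (P.map biprod.fst) 0, zero_comp, zero_add, Preadditive.comp_neg, P.map_neg]
    rw [h₁, Preadditive.comp_neg, Category.comp_id, neg_neg]
  · change c.conn hS' ≫ (𝟙 (P.obj x))⟦(1 : ℤ)⟧' = (-𝟙 _) ≫ P.map ψ ≫ (-c.conn hS)
    rw [CategoryTheory.Functor.map_id, Category.comp_id, Preadditive.comp_neg, hφ]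
    simp

-- The suspensions are compared on the image of `A` by naturality of the connecting morphisms, and
-- the comparison extends to `𝒯` because `𝒯` is a localization. Preservation of exact triangles then
-- follows from cone sequences, and reflection from preservation.
include c in
lemma isTriangleEquivalence (hB : R.IsBicomplicialPair B)
    (hC : ∀ x, IsZero (P.obj (B.C.obj x))) (F : R.T B ⥤ D) [F.IsEquivalence]
    (e : R.projT B ⋙ F ≅ P) :
    IsTriangleEquivalence (R.triangleDataT B) (TriangleData.ofPretriangulated D) F := by
  have := hB.isLocalization_projT
  let L := R.projT B
  let S := (R.triangleDataT B).susp
  have : L.IsLocalization R.w := hB.isLocalization_projT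
  let β (x : A) : P.obj (B.T.obj x) ≅ (P.obj x)⟦(1 : ℤ)⟧ :=
    @asIso _ _ _ _ (c.susp B x) (c.isIso_susp hC x)
  let γ₁ : B.T ⋙ P ≅ P ⋙ shiftFunctor D (1 : ℤ) :=
    NatIso.ofComponents β (fun f => c.susp_naturality f)
  let γ : L ⋙ S ⋙ F ≅ L ⋙ F ⋙ shiftFunctor D (1 : ℤ) :=
    Functor.isoWhiskerRight (R.suspIsoT B) F ≪≫ Functor.isoWhiskerLeft B.T e ≪≫ γ₁ ≪≫
      Functor.isoWhiskerRight e.symm (shiftFunctor D (1 : ℤ))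
  obtain ⟨α, hα⟩ : ∃ α : S ⋙ F ≅ F ⋙ shiftFunctor D (1 : ℤ),
      ∀ x, α.hom.app (L.obj x) = γ.hom.app x := by
    refine ⟨Localization.liftNatIso L R.w (L ⋙ S ⋙ F) (L ⋙ F ⋙ shiftFunctor D (1 : ℤ)) _ _ γ,
      fun x => ?_⟩
    simp
  let e' (x : A) : F.obj (L.obj x) ≅ P.obj x := e.app x
  have hγ (x : A) : F.map ((R.suspIsoT B).inv.app x) ≫ γ.hom.app x ≫ (e.hom.app x)⟦(1 : ℤ)⟧' =
      e.hom.app (B.T.obj x) ≫ c.susp B x := by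
    change F.map ((R.suspIsoT B).inv.app x) ≫ (F.map ((R.suspIsoT B).hom.app x) ≫
      (e' (B.T.obj x)).hom ≫ c.susp B x ≫ (e' x).inv⟦(1 : ℤ)⟧') ≫ (e' x).hom⟦(1 : ℤ)⟧' =
      (e' (B.T.obj x)).hom ≫ c.susp B x
    rw [Category.assoc, Category.assoc, Category.assoc, ← Functor.map_comp, Iso.inv_hom_id,
      CategoryTheory.Functor.map_id]
    refine (Category.assoc _ _ _).symm.trans ?_
    refine (congrArg (· ≫ _) ((F.map_comp _ _).symm.trans ((congrArg F.map
      ((R.suspIsoT B).inv_hom_id_app x)).trans (F.map_id _)))).trans ?_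
    refine (Category.id_comp _).trans ?_
    exact congrArg ((e' (B.T.obj x)).hom ≫ ·) (Category.comp_id _)
  have key {X Y Z : R.T B} (u : X ⟶ Y) (v : Y ⟶ Z) (w : Z ⟶ S.obj X)
      (h : (R.triangleDataT B).exact u v w) :
      Triangle.mk (F.map u) (F.map v) (F.map w ≫ α.hom.app X) ∈ distTriang D := by
    obtain ⟨x, y, z, f, κ, ψ, a, b, d, h, h₁, h₂, h₃⟩ :=
      (hB.exact_triangleDataT_iff u v w).1 h
    have h₃' : w ≫ S.map a.hom = d.hom ≫ L.map ψ ≫ (R.suspIsoT B).inv.app x := h₃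
    have nat : F.map (S.map a.hom) ≫ α.hom.app (L.obj x) =
      α.hom.app X ≫ (F.map a.hom)⟦(1 : ℤ)⟧' := α.hom.naturality a.hom
    have nf : F.map (L.map f) ≫ e.hom.app y = e.hom.app x ≫ P.map f := e.hom.naturality f
    have nκ : F.map (L.map κ) ≫ e.hom.app z = e.hom.app y ≫ P.map κ := e.hom.naturality κ
    have nψ : F.map (L.map ψ) ≫ e.hom.app (B.T.obj x) = e.hom.app z ≫ P.map ψ :=
      e.hom.naturality ψ
    refine isomorphic_distinguished _ (c.distinguished_of_isConeSequence hC h) _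
      (Triangle.isoMk _ _ (F.mapIso a ≪≫ e' x) (F.mapIso b ≪≫ e' y)
        (F.mapIso d ≪≫ e' z) ?_ ?_ ?_)
    · change F.map u ≫ F.map b.hom ≫ e.hom.app y = (F.map a.hom ≫ e.hom.app x) ≫ P.map f
      rw [← Category.assoc, ← F.map_comp, h₁, F.map_comp, Category.assoc, Category.assoc]
      exact congrArg (F.map a.hom ≫ ·) nf
    · change F.map v ≫ F.map d.hom ≫ e.hom.app z = (F.map b.hom ≫ e.hom.app y) ≫ P.map κ
      rw [← Category.assoc, ← F.map_comp, h₂, F.map_comp, Category.assoc, Category.assoc]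
      exact congrArg (F.map b.hom ≫ ·) nκ
    · change (F.map w ≫ α.hom.app X) ≫ (F.map a.hom ≫ e.hom.app x)⟦(1 : ℤ)⟧' =
        (F.map d.hom ≫ e.hom.app z) ≫ P.map ψ ≫ c.susp B x
      rw [Functor.map_comp, Category.assoc, ← Category.assoc (α.hom.app X), ← nat, Category.assoc,
        ← Category.assoc, ← F.map_comp, h₃', hα, F.map_comp, F.map_comp, Category.assoc,
        Category.assoc, Category.assoc]
      refine congrArg (F.map d.hom ≫ ·) ((congrArg (F.map (L.map ψ) ≫ ·) (hγ x)).trans ?_)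
      exact (Category.assoc _ _ _).symm.trans ((congrArg (· ≫ _) nψ).trans (Category.assoc _ _ _))
  refine ⟨inferInstance, α, fun {X Y Z} u v w => ⟨key u v w, fun h => ?_⟩⟩
  -- Reflection: an exact triangle on `u` has an image with the same first morphism as the given
  -- distinguished triangle. The resulting isomorphism of third objects lifts, since `F` is fully
  -- faithful.
  obtain ⟨Z', v', w', h'⟩ := hB.exists_exact_triangleDataT u
  obtain ⟨θ, hθ, hθ₂⟩ : ∃ θ : F.obj Z ≅ F.obj Z', F.map v ≫ θ.hom = F.map v' ∧
      F.map w ≫ α.hom.app X = θ.hom ≫ F.map w' ≫ α.hom.app X := by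
    let t := isoTriangleOfIso₁₂ _ _ h (key _ _ _ h') (Iso.refl _) (Iso.refl _)
      ((Category.comp_id _).trans (Category.id_comp _).symm)
    have h₁ := t.hom.comm₂
    have h₂ := t.hom.comm₃
    refine ⟨Triangle.π₃.mapIso t, h₁.trans ?_, ?_⟩
    · exact Category.id_comp _
    · refine Eq.trans ?_ h₂
      exact (Category.comp_id _).symm.trans (congrArg _ ((shiftFunctor D (1 : ℤ)).map_id _).symm)
  obtain ⟨θ', hθ'⟩ : ∃ θ' : Z ≅ Z', F.map θ'.hom = θ.hom := ⟨F.preimageIso θ, by simp⟩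
  have hv : v ≫ θ'.hom = v' := F.map_injective (by rw [F.map_comp, hθ', hθ])
  have hw : w = θ'.hom ≫ w' := F.map_injective (by
    rw [F.map_comp, hθ', ← cancel_mono (α.hom.app X), hθ₂, Category.assoc])
  obtain ⟨x, y, z, f, κ, ψ, a, b, d, h, h₁, h₂, h₃⟩ := (hB.exact_triangleDataT_iff _ _ _).1 h'
  refine (hB.exact_triangleDataT_iff _ _ _).2
    ⟨x, y, z, f, κ, ψ, a, b, θ' ≪≫ d, h, h₁, ?_, ?_⟩
  · rw [← h₂, ← hv, Iso.trans_hom, Category.assoc]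
  · have h₃' : w' ≫ S.map a.hom = d.hom ≫ L.map ψ ≫ (R.suspIsoT B).inv.app x := h₃
    change w ≫ S.map a.hom = (θ'.hom ≫ d.hom) ≫ L.map ψ ≫ (R.suspIsoT B).inv.app x
    rw [hw, Category.assoc, h₃', Category.assoc]

end RelExact.Connecting

end

end TriangleEquivalences

/-! ### The two triangle equivalences of part (1). -/

section PartOne

/-- A triangle equivalence `G` can be cancelled: since `G` is fully faithful, the isomorphism with
the suspensions lifts along it, and exactness can be tested after applying `G`. -/
lemma IsTriangleEquivalence.of_comp {T₁ T₂ T₃ : Type*} [Category T₁] [Category T₂] [Category T₃]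
    {D₁ : TriangleData T₁} {D₂ : TriangleData T₂} {D₃ : TriangleData T₃} {Φ : T₁ ⥤ T₂}
    {F : T₁ ⥤ T₃} {G : T₂ ⥤ T₃} (hF : IsTriangleEquivalence D₁ D₃ F)
    (hG : IsTriangleEquivalence D₂ D₃ G) (e : Φ ⋙ G ≅ F)
    (hD : ∀ {x y z x' y' z' : T₃} (a : x ≅ x') (b : y ≅ y') (c : z ≅ z') {f : x ⟶ y} {g : y ⟶ z}
      {h : z ⟶ D₃.susp.obj x} {f' : x' ⟶ y'} {g' : y' ⟶ z'} {h' : z' ⟶ D₃.susp.obj x'},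
      f ≫ b.hom = a.hom ≫ f' → g ≫ c.hom = b.hom ≫ g' →
      h ≫ D₃.susp.map a.hom = c.hom ≫ h' → (D₃.exact f g h ↔ D₃.exact f' g' h')) :
    IsTriangleEquivalence D₁ D₂ Φ := by
  obtain ⟨hF, α, hα⟩ := hF
  obtain ⟨hG, β, hβ⟩ := hG
  have : (Φ ⋙ G).IsEquivalence := Functor.isEquivalence_of_iso e.symm
  have : Φ.IsEquivalence := Functor.isEquivalence_of_comp_right Φ G
  let γ : (D₁.susp ⋙ Φ) ⋙ G ≅ (Φ ⋙ D₂.susp) ⋙ G :=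
    Functor.isoWhiskerLeft D₁.susp e ≪≫ α ≪≫ Functor.isoWhiskerRight e.symm D₃.susp ≪≫
      Functor.isoWhiskerLeft Φ β.symm
  let δ : D₁.susp ⋙ Φ ≅ Φ ⋙ D₂.susp :=
    ((Functor.FullyFaithful.ofFullyFaithful G).whiskeringRight T₁).preimageIso γ
  have hδ (x : T₁) : G.map (δ.hom.app x) = γ.hom.app x := by
    simp [δ]
  refine ⟨inferInstance, δ, fun {x y z} f g h => (hα f g h).trans (Iff.trans ?_ (hβ _ _ _).symm)⟩
  refine hD (e.symm.app x) (e.symm.app y) (e.symm.app z) ?_ ?_ ?_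
  · exact e.inv.naturality f
  · exact e.inv.naturality g
  · have := e.inv.naturality h
    dsimp at this ⊢
    rw [Functor.map_comp, hδ, ← Category.assoc, ← Category.assoc, ← this]
    have := e.inv_hom_id_app_assoc (D₁.susp.obj x) (α.hom.app x ≫ D₃.susp.map (e.inv.app x))
    simp only [γ, Category.assoc, Iso.trans_hom, NatTrans.comp_app, Functor.isoWhiskerLeft_hom,
      Functor.whiskerLeft_app, Functor.isoWhiskerRight_hom, Functor.whiskerRight_app, Iso.symm_hom,
      Iso.inv_hom_id_app, Functor.comp_obj, Category.comp_id] at this ⊢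
    rw [this]

namespace RelExact

variable {A : Type u} [Category.{v} A] [Preadditive A] [HasZeroObject A] [HasBinaryBiproducts A]
  (R : RelExact A)

/-- The connecting morphisms of the derived category. -/
noncomputable def connecting : R.chB.Connecting R.proj where
  conn hS := R.conn hS
  distinguished hS := R.distinguished hS
  naturality φ hS hS' := R.conn_naturality φ hS hS'

/-- The connecting morphisms of the derived category, on complexes concentrated in degree zero. -/
noncomputable def connectingSingleB : R.Connecting (singleB ⋙ R.proj) where
  conn hS := R.conn (conflation_singleB hS)
  distinguished hS := R.distinguished (conflation_singleB hS)
  naturality φ hS hS' := R.conn_naturality (singleB.mapShortComplex.map φ) (conflation_singleB hS)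
    (conflation_singleB hS')

/-- Both sides are localizations of bounded complexes at `qw`, so the equivalence is uniqueness of
localizations; contractibility of cones makes it a triangle equivalence. -/
lemma exists_triangleEquivalence_chB :
    ∃ Ψ : R.chB.T (bicomplicialChB R.exact) ⥤ R.Db,
      Nonempty (R.chB.projT (bicomplicialChB R.exact) ⋙ Ψ ≅ R.proj) ∧
      IsTriangleEquivalence (R.chB.triangleDataT (bicomplicialChB R.exact))
        (TriangleData.ofPretriangulated R.Db) Ψ := by
  have hB := R.isBicomplicialPair_chB
  have h₁ : (R.chB.projT (bicomplicialChB R.exact)).IsLocalization R.qw := hB.isLocalization_projT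
  let Ψ := (Localization.uniq (R.chB.projT (bicomplicialChB R.exact)) R.proj R.qw)
  let e : R.chB.projT (bicomplicialChB R.exact) ⋙ Ψ.functor ≅ R.proj :=
    Localization.compUniqFunctor _ _ _
  refine ⟨Ψ.functor, ⟨e⟩, R.connecting.isTriangleEquivalence hB (fun K => ?_) Ψ.functor e⟩
  exact R.projHb.map_isZero (isZero_toHb_coneB R.exact K)

namespace IsBicomplicialPair

variable {R} {B : Bicomplicial R.exact} (hB : R.IsBicomplicialPair B) (hR : R.IsThick)

include hB hR

lemma exists_triangleEquivalence :
    ∃ Θ : R.T B ⥤ R.Db, Nonempty (R.projT B ⋙ Θ ≅ singleB ⋙ R.proj) ∧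
      IsTriangleEquivalence (R.triangleDataT B) (TriangleData.ofPretriangulated R.Db) Θ := by
  obtain ⟨Θ, e, hΘ⟩ := hB.exists_comparison hR
  exact ⟨Θ, ⟨e⟩, R.connectingSingleB.isTriangleEquivalence hB
    (fun x => hB.isZero_proj_singleB (hB.trivial_C x)) Θ e⟩

lemma exists_triangleEquivalence_singleB :
    ∃ Φ : R.T B ⥤ R.chB.T (bicomplicialChB R.exact),
      Nonempty (R.projT B ⋙ Φ ≅ singleB ⋙ R.chB.projT (bicomplicialChB R.exact)) ∧
      IsTriangleEquivalence (R.triangleDataT B)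
        (R.chB.triangleDataT (bicomplicialChB R.exact)) Φ := by
  obtain ⟨Θ, ⟨e⟩, hΘ⟩ := hB.exists_triangleEquivalence hR
  obtain ⟨Ψ, ⟨e'⟩, hΨ⟩ := R.exists_triangleEquivalence_chB
  have := hΨ.1
  let i : (Θ ⋙ Ψ.inv) ⋙ Ψ ≅ Θ := Functor.isoWhiskerLeft Θ Ψ.asEquivalence.counitIso
  refine ⟨Θ ⋙ Ψ.inv, ⟨?_⟩, hΘ.of_comp hΨ i ?_⟩
  · exact Functor.isoWhiskerRight e Ψ.inv ≪≫
      Functor.isoWhiskerLeft singleB (Functor.isoWhiskerRight e'.symm Ψ.inv) ≪≫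
      Functor.isoWhiskerLeft (singleB ⋙ R.chB.projT (bicomplicialChB R.exact))
        Ψ.asEquivalence.unitIso.symm
  · intro x y z x' y' z' a b c f g h f' g' h' h₁ h₂ h₃
    exact (distinguished_iff_of_iso (Triangle.isoMk (Triangle.mk f g h) (Triangle.mk f' g' h')
      a b c h₁ h₂ h₃))

end IsBicomplicialPair

end RelExact

end PartOne

/-! ### Functors on derived categories induced by exact functors, in particular by `j`. -/

section ExactFunctors

variable {C : Type u} [Category.{v} C] [Preadditive C]
  {D : Type*} [Category D] [Preadditive D] (F : C ⥤ D) [F.Additive]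

/-- The functor on bounded complexes induced by an additive functor. -/
def mapChB : ChB C ⥤ ChB D :=
  (bounded D).lift ((bounded C).ι ⋙ F.mapHomologicalComplex _) fun K => by
    obtain ⟨a, b, h⟩ := K.property
    exact ⟨a, b, fun n hn => F.map_isZero (h n hn)⟩

/-- The compatibility of the functors induced on bounded complexes and on homotopy categories. -/
noncomputable def mapChBCompToHb : toHb C ⋙ mapHb F ≅ mapChB F ⋙ toHb D :=
  NatIso.ofComponents (fun K => Iso.refl ((toHb D).obj ((mapChB F).obj K))) (fun f => by
    exact (Category.comp_id ((toHb D).map ((mapChB F).map f))).trans (Category.id_comp _).symm)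

lemma StrictlyAcyclic.map {E : ExactStructure C} {E' : ExactStructure D}
    (hF : ∀ S, E.conflation S → E'.conflation (S.map F)) {K : CochainComplex C ℤ}
    (h : StrictlyAcyclic E K) :
    StrictlyAcyclic E' ((F.mapHomologicalComplex (ComplexShape.up ℤ)).obj K) := by
  obtain ⟨Z, i, p, w, h, hd⟩ := h
  exact ⟨fun n => F.obj (Z n), fun n => F.map (i n), fun n => F.map (p n),
    fun n => (F.map_comp _ _).symm.trans ((congrArg F.map (w n)).trans (F.map_zero _ _)), fun n => hF _ (h n),
    fun n => (congrArg F.map (hd n)).trans (F.map_comp _ _)⟩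

lemma acyclicHb_mapHb {E : ExactStructure C} {E' : ExactStructure D}
    (hF : ∀ S, E.conflation S → E'.conflation (S.map F)) {X : Hb C} (h : acyclicHb E X) :
    acyclicHb E' ((mapHb F).obj X) := by
  obtain ⟨K, hK, ⟨e⟩⟩ := h
  exact ⟨_, hK.map F hF, ⟨(F.mapHomotopyCategory (ComplexShape.up ℤ)).mapIso e⟩⟩

variable [HasZeroObject C] [HasBinaryBiproducts C] [HasZeroObject D] [HasBinaryBiproducts D]
  {R : RelExact C} {R' : RelExact D} (hF : ∀ S, R.exact.conflation S → R'.exact.conflation (S.map F))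
  (hF' : ∀ K : ChB C, (∀ n, R.trivial (K.obj.X n)) → IsZero (R'.proj.obj ((mapChB F).obj K)))

include hF hF'

lemma RelExact.exists_mapDb :
    ∃ (Φ : R.Db ⥤ R'.Db) (_ : Φ.CommShift ℤ) (e : R.projHb ⋙ Φ ≅ mapHb F ⋙ R'.projHb),
      NatTrans.CommShift e.hom ℤ ∧ Φ.IsTriangulated :=
  R.exists_lift (mapHb F ⋙ R'.projHb)
    (fun _ hX => (VerdierQuotient.proj R'.image).map_isZero
      (VerdierQuotient.isZero_proj _ (acyclicHb_mapHb F hF hX)))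
    (fun K hK => (hF' K hK).of_iso (R'.projHb.mapIso ((mapChBCompToHb F).app K)))

lemma RelExact.isZero_proj_mapChB {K : ChB C} (hK : IsZero (R.proj.obj K)) :
    IsZero (R'.proj.obj ((mapChB F).obj K)) := by
  obtain ⟨Φ, _, e, -, _⟩ := RelExact.exists_mapDb F hF hF'
  exact (Φ.map_isZero hK).of_iso (R'.projHb.mapIso ((mapChBCompToHb F).symm.app K) ≪≫
    e.symm.app ((toHb C).obj K))

end ExactFunctors

section

variable {C : Type u} [Category.{v} C] [Preadditive C] [HasZeroObject C] [HasBinaryBiproducts C]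
  (R : RelExact C)

lemma RelExact.isZero_proj_singleAt {x : C} (hx : R.trivial x) (m : ℤ) :
    IsZero (R.proj.obj ((singleAt m).obj x)) := by
  classical
  -- A class `w` with only identities and composites need not make every zero object trivial. An
  -- isomorphic complex is used whose other terms are the specified zero object and whose term of
  -- degree `m` is literally `x`.
  let X : ℤ → C := Function.update (fun _ => R.zero) m x
  have hm : X m = x := Function.update_self _ _ _
  have hX (n : ℤ) (hn : n ≠ m) : X n = R.zero := Function.update_of_ne hn _ _
  have hX' (n : ℤ) (hn : n ≠ m) : IsZero (X n) := hX n hn ▸ R.isZero_zero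
  let K : ChB C := ⟨{ X := X, d := 0, shape := fun _ _ _ => rfl }, m, m, fun n hn => hX' n (by omega)⟩
  have hK : IsZero (R.proj.obj K) := R.isZero_proj_of_trivial fun n => by
    by_cases hn : n = m
    · subst hn
      change R.trivial (X n)
      rwa [hm]
    · change R.trivial (X n)
      rw [hX n hn]
      change R.w _
      rw [R.isZero_zero.eq_of_src (R.isZero_zero.to_ R.zero) (𝟙 _)]
      exact R.isMultiplicative.id_mem _
  have h₀ (i : ℤ) (hi : (ComplexShape.up ℤ).Rel m i) : eqToHom hm.symm ≫ K.obj.d m i = 0 :=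
    comp_zero
  let f : ((singleAt m).obj x).obj ⟶ K.obj := HomologicalComplex.mkHomFromSingle (eqToHom hm.symm) h₀
  have hf (n : ℤ) : IsIso (f.f n) := by
    by_cases hn : n = m
    · subst hn
      have : f.f n = _ := HomologicalComplex.mkHomFromSingle_f (eqToHom hm.symm) h₀
      rw [this]
      exact (HomologicalComplex.singleObjXSelf (ComplexShape.up ℤ) n x ≪≫ eqToIso hm.symm).isIso_hom
    · exact (isZero_singleAt_X x hn).isIso (hX' n hn) _
  have hf' : IsIso f := HomologicalComplex.Hom.isIso_of_components f
  exact hK.of_iso (R.proj.mapIso ((bounded C).fullyFaithfulι.preimageIso (asIso f)))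

lemma RelExact.isZero_proj_mapChB_singleAt (m : ℤ) {K : ChB C} (hK : IsZero (R.proj.obj K)) :
    IsZero (R.chB.proj.obj ((mapChB (singleAt m)).obj K)) :=
  RelExact.isZero_proj_mapChB (R := R) (R' := R.chB) (singleAt m) (fun _ hS => conflation_singleAt hS m)
    (fun _ hL => R.chB.isZero_proj_of_trivial fun n =>
      (trivial_chB_iff _).2 (R.isZero_proj_singleAt (hL n) m)) hK

lemma RelExact.exists_mapDb_singleB :
    ∃ (Φ : R.Db ⥤ R.chB.Db) (_ : Φ.CommShift ℤ)
      (e : R.projHb ⋙ Φ ≅ mapHb (singleB (C := C)) ⋙ R.chB.projHb),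
      NatTrans.CommShift e.hom ℤ ∧ Φ.IsTriangulated :=
  RelExact.exists_mapDb (R := R) (R' := R.chB) singleB (fun _ hS => conflation_singleB hS)
    (fun _ hL => R.chB.isZero_proj_of_trivial fun n =>
      (trivial_chB_iff _).2 (R.isZero_proj_singleAt (hL n) 0))

end

/-! ### Exchange of the directions of a double complex, and part (2). -/

section Swap

variable {C : Type u} [Category.{v} C] [Preadditive C]

/-- The differential of bounded complexes, as a natural transformation. -/
def evalBd (q q' : ℤ) : evalB (C := C) q ⟶ evalB q' where
  app K := K.obj.d q q'
  naturality _ _ f := f.hom.comm q q'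

lemma ChB.isZero_of_isZero_X {K : ChB C} (h : ∀ n, IsZero (K.obj.X n)) : IsZero K := by
  rw [IsZero.iff_id_eq_zero]
  exact ChB.hom_ext' fun n => (h n).eq_of_src _ _

lemma ChB.isZero_X {K : ChB C} (h : IsZero K) (n : ℤ) : IsZero (K.obj.X n) :=
  (evalB n).map_isZero h

/-- The bounded double complex obtained by exchanging the two directions. -/
def swapObj (M : ChB (ChB C)) : ChB (ChB C) where
  obj :=
    { X := fun q => (mapChB (evalB q)).obj M
      d := fun q q' => ObjectProperty.homMk
        ((NatTrans.mapHomologicalComplex (evalBd q q') (ComplexShape.up ℤ)).app M.obj)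
      shape := fun q q' h => ChB.hom_ext' fun p => (M.obj.X p).obj.shape q q' h
      d_comp_d' := fun q q' q'' _ _ => ChB.hom_ext' fun p => (M.obj.X p).obj.d_comp_d q q' q'' }
  property := by
    obtain ⟨a, b, h⟩ := M.property
    choose a' b' h' using fun p => (M.obj.X p).property
    -- Each complex `M^p` has its own bounds, but only finitely many are nonzero; sums of absolute
    -- values give bounds valid for all of them.
    refine ⟨-∑ p ∈ Finset.Icc a b, |a' p|, ∑ p ∈ Finset.Icc a b, |b' p|, fun q hq =>
      ChB.isZero_of_isZero_X fun p => ?_⟩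
    by_cases hp : p < a ∨ b < p
    · exact ChB.isZero_X (h p hp) q
    · have hp' : p ∈ Finset.Icc a b := Finset.mem_Icc.2 (by omega)
      have h₁ := Finset.single_le_sum (fun p _ => abs_nonneg (a' p)) hp'
      have h₂ := Finset.single_le_sum (fun p _ => abs_nonneg (b' p)) hp'
      refine h' p q (hq.imp (fun hq => ?_) (fun hq => ?_))
      · exact lt_of_lt_of_le hq ((neg_le_neg h₁).trans (neg_abs_le _))
      · exact lt_of_le_of_lt ((le_abs_self _).trans h₂) hq

/-- The functor which exchanges the two directions of a bounded double complex. -/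
def swap : ChB (ChB C) ⥤ ChB (ChB C) where
  obj := swapObj
  map f := ObjectProperty.homMk
    { f := fun q => (mapChB (evalB q)).map f
      comm' := fun q q' _ => ChB.hom_ext' fun p => (f.hom.f p).hom.comm q q' }
  map_id _ := rfl
  map_comp _ _ := rfl

/-- Exchanging the two directions twice is the identity. -/
def swapCompSwap : swap (C := C) ⋙ swap ≅ 𝟭 _ := Iso.refl _

instance : (swap (C := C)).Additive where
  map_add := rfl

/-- The functor `swap` on the double complexes with a single column. -/
noncomputable def singleAtCompSwap [HasZeroObject C] (m : ℤ) :
    singleAt (A := ChB C) m ⋙ swap ≅ mapChB (singleAt m) :=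
  NatIso.ofComponents (fun K => (bounded _).fullyFaithfulι.preimageIso
    (HomologicalComplex.Hom.isoOfComponents (fun q => (bounded _).fullyFaithfulι.preimageIso
      ((HomologicalComplex.singleMapHomologicalComplex (evalB q) (ComplexShape.up ℤ) m).app K))
      (fun q q' h => by
        refine ObjectProperty.hom_ext _ (HomologicalComplex.to_single_hom_ext ?_)
        change ((HomologicalComplex.singleMapHomologicalComplex (evalB q)
            (ComplexShape.up ℤ) m).hom.app K).f m ≫
              ((HomologicalComplex.single C (ComplexShape.up ℤ) m).map (K.obj.d q q')).f m =
          (((HomologicalComplex.single (ChB C) (ComplexShape.up ℤ) m).obj K).X m).obj.d q q' ≫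
            ((HomologicalComplex.singleMapHomologicalComplex (evalB q')
              (ComplexShape.up ℤ) m).hom.app K).f m
        rw [HomologicalComplex.singleMapHomologicalComplex_hom_app_self,
          HomologicalComplex.singleMapHomologicalComplex_hom_app_self,
          HomologicalComplex.single_map_f_self]
        have := ((HomologicalComplex.singleObjXSelf (ComplexShape.up ℤ) m K).hom).hom.comm q q'
        have key {x y x' y' z z' : C} {a : x ⟶ y} {d' : y ⟶ y'} {d : x ⟶ x'} {a' : x' ⟶ y'}
            (i : z ≅ y) (j : z' ≅ y') (h : a ≫ d' = d ≫ a') :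
            (a ≫ i.inv) ≫ i.hom ≫ d' ≫ j.inv = d ≫ a' ≫ j.inv := by
          rw [Category.assoc, Iso.inv_hom_id_assoc, ← Category.assoc, h, Category.assoc]
        exact key _ _ this)))
    (fun f => by
      refine ChB.hom_ext' fun q => ObjectProperty.hom_ext _ ?_
      exact (HomologicalComplex.singleMapHomologicalComplex (evalB q)
            (ComplexShape.up ℤ) m).hom.naturality f)

lemma degreewise_swap {E : ExactStructure C} {S : ShortComplex (ChB (ChB C))}
    (hS : degreewise E.chB S) : degreewise E.chB (S.map swap) := fun q p => hS p q

variable [HasZeroObject C] [HasBinaryBiproducts C] (R : RelExact C)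

namespace RelExact

lemma isZero_proj_swap_of_rows {M : ChB (ChB C)}
    (h : ∀ q, IsZero (R.proj.obj ((mapChB (evalB q)).obj M))) :
    IsZero (R.chB.proj.obj (swap.obj M)) :=
  R.chB.isZero_proj_of_trivial fun q => (trivial_chB_iff _).2 (h q)

lemma isZero_proj_swap_singleAt (m : ℤ) {K : ChB C} (h : IsZero (R.proj.obj K)) :
    IsZero (R.chB.proj.obj (swap.obj ((singleAt m).obj K))) :=
  (R.isZero_proj_mapChB_singleAt m h).of_iso (R.chB.proj.mapIso ((singleAtCompSwap m).app K))

/-- The connecting morphisms of the derived category, after exchanging the two directions. -/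
noncomputable def connectingSwap : R.chB.chB.Connecting (swap ⋙ R.chB.proj) where
  conn hS := R.chB.conn (degreewise_swap hS)
  distinguished hS := R.chB.distinguished (degreewise_swap hS)
  naturality φ hS hS' := R.chB.conn_naturality (swap.mapShortComplex.map φ) (degreewise_swap hS)
    (degreewise_swap hS')

namespace Connecting

variable {R} {D : Type*} [Category D] [Preadditive D] [HasZeroObject D] [HasShift D ℤ]
  [∀ n : ℤ, (shiftFunctor D n).Additive] [Pretriangulated D] {P : C ⥤ D} (c : R.Connecting P)
  {S : ShortComplex C} (hS : R.exact.conflation S)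

include c hS

lemma isZero_X₁ (h₂ : IsZero (P.obj S.X₂)) (h₃ : IsZero (P.obj S.X₃)) : IsZero (P.obj S.X₁) :=
  (Triangle.isZero₁_iff_isIso₂ _ (c.distinguished hS)).2 (h₂.isIso h₃ _)

lemma isZero_X₃ (h₁ : IsZero (P.obj S.X₁)) (h₂ : IsZero (P.obj S.X₂)) : IsZero (P.obj S.X₃) :=
  (Triangle.isZero₃_iff_isIso₁ _ (c.distinguished hS)).2 (h₁.isIso h₂ _)

lemma isZero_X₂ (h₁ : IsZero (P.obj S.X₁)) (h₃ : IsZero (P.obj S.X₃)) : IsZero (P.obj S.X₂) :=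
  Triangle.isZero₂_of_isZero₁₃ _ (c.distinguished hS) h₁ h₃

omit hS in
lemma isIso_map {B : Bicomplicial R.exact} (hB : R.IsBicomplicialPair B) [P.Additive]
    (hP : ∀ x, R.trivial x → IsZero (P.obj x)) {x y : C} {s : x ⟶ y} (hs : R.w s) :
    IsIso (P.map s) := by
  obtain ⟨w, hS⟩ := B.conflation_cone s
  have h₁ : IsIso (P.map (biprod.snd : B.C.obj x ⊞ y ⟶ y)) :=
    (Triangle.isZero₁_iff_isIso₂ _ (c.distinguished
      (ExactStructure.conflation_inl_snd (E := R.exact) (B.C.obj x) y))).1 (hP _ (hB.trivial_C x))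
  have h₂ : IsIso (P.map (biprod.lift (B.ι.app x) s)) := by
    refine (Triangle.isZero₃_iff_isIso₁ _ (c.distinguished hS)).1
      (hP _ (hB.trivial_X₃_of_w hS (hB.of_postcomp (hB.w_snd (hB.trivial_C x)) ?_)))
    dsimp only
    rwa [biprod.lift_snd]
  have h : P.map s = P.map (biprod.lift (B.ι.app x) s) ≫ P.map biprod.snd := by
    rw [← P.map_comp, biprod.lift_snd]
  rw [h]
  infer_instance

end Connecting

/-- Brutal truncation filters `M` by its terms `M^p`. After the exchange, a single term becomes the
termwise inclusion of a complex that vanishes in the derived category, and this inclusion preserves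
vanishing. -/
lemma isZero_proj_swap_of_supportedIn (n : ℕ) : ∀ {a : ℤ} {M : ChB (ChB C)},
    supportedIn a (a + n) M → (∀ p, IsZero (R.proj.obj (M.obj.X p))) →
      IsZero (R.chB.proj.obj (swap.obj M)) := by
  have h₀ {M : ChB (ChB C)} (hM : IsZero M) : IsZero (R.chB.proj.obj (swap.obj M)) :=
    (swap ⋙ R.chB.proj).map_isZero hM
  induction n with
  | zero =>
    intro a M hM h
    obtain ⟨L, i, q, w, hS, hL⟩ := exists_conflation_to_singleAt R.chB.exact M (by omega) hM
    exact R.connectingSwap.isZero_X₂ hS (h₀ (ChB.isZero_of_isZero_X fun p => hL p (by omega)))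
      (R.isZero_proj_swap_singleAt a (h a))
  | succ n hn =>
    intro a M hM h
    obtain ⟨L, i, q, w, hS, hL⟩ := exists_conflation_to_singleAt R.chB.exact M (by omega) hM
    refine R.connectingSwap.isZero_X₂ hS (hn (a := a + 1) ?_ fun p => ?_)
      (R.isZero_proj_swap_singleAt a (h a))
    · convert hL using 1
      push_cast
      ring
    · by_cases hp : p = a
      · subst hp
        exact R.proj.map_isZero (hL p (by omega))
      · exact R.connecting.isZero_X₁ (hS p) (h p) (R.proj.map_isZero (isZero_singleAt_X _ hp))

/-- The two kinds of generators exchange roles. If `M` is acyclic in the outer direction, each of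
its rows is acyclic, so the exchanged complex has trivial terms. If `M` has trivial terms, the
filtration by these terms applies. -/
lemma isAcyclicClass_swap :
    R.chB.IsAcyclicClass fun M => IsZero (R.chB.proj.obj (swap.obj M)) where
  X₁ hS := R.connectingSwap.isZero_X₁ hS
  X₂ hS := R.connectingSwap.isZero_X₂ hS
  X₃ hS := R.connectingSwap.isZero_X₃ hS
  of_retract r h := by
    let r' := r.map (swap ⋙ R.chB.proj)
    rw [IsZero.iff_id_eq_zero]
    exact r'.retract.symm.trans ((congrArg (· ≫ r'.r) (IsZero.eq_of_tgt h r'.i 0)).trans zero_comp)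
  of_acyclicHb {M} hM := R.isZero_proj_swap_of_rows fun q =>
    R.isZero_proj_of_acyclicHb (acyclicHb_mapHb (E := R.exact.chB) (evalB q) (fun _ hS => hS q) hM)
  of_trivial {M} hM := by
    obtain ⟨a, b, h⟩ := M.property
    exact R.isZero_proj_swap_of_supportedIn (b - a).toNat (a := a)
      (fun n hn => h n (by omega)) fun p => (trivial_chB_iff _).1 (hM p)

lemma isIso_proj_swap {M N : ChB (ChB C)} (f : M ⟶ N) (hf : R.chB.qw f) :
    IsIso (R.chB.proj.map (swap.map f)) :=
  R.connectingSwap.isIso_map R.chB.isBicomplicialPair_chB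
    (fun _ h => R.isAcyclicClass_swap.of_isZero_proj ((trivial_chB_iff _).1 h)) hf

/-- Exchanging the two directions induces an equivalence of the derived category. -/
lemma exists_swapDb : ∃ (S : R.chB.Db ⥤ R.chB.Db) (_ : R.chB.proj ⋙ S ≅ swap ⋙ R.chB.proj),
    S.IsEquivalence := by
  let S := Localization.lift (swap ⋙ R.chB.proj) (fun _ _ f hf => R.isIso_proj_swap f hf)
    R.chB.proj
  let e : R.chB.proj ⋙ S ≅ swap ⋙ R.chB.proj := Localization.fac _ _ _
  let γ : R.chB.proj ⋙ S ⋙ S ≅ R.chB.proj ⋙ 𝟭 _ :=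
    Functor.isoWhiskerRight e S ≪≫ Functor.isoWhiskerLeft swap e ≪≫
      Functor.isoWhiskerRight swapCompSwap R.chB.proj
  let i : S ⋙ S ≅ 𝟭 _ := Localization.liftNatIso R.chB.proj R.chB.qw _ _ _ _ γ
  exact ⟨S, e, (CategoryTheory.Equivalence.mk S S i.symm i).isEquivalence_functor⟩

/-- The inclusion of the complexes concentrated in degree zero is a derived equivalence. -/
theorem exists_derivedEquivalence :
    ∃ (Φ : R.Db ⥤ R.chB.Db) (_ : Φ.CommShift ℤ)
      (e : R.projHb ⋙ Φ ≅ mapHb (singleB (C := C)) ⋙ R.chB.projHb),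
      NatTrans.CommShift e.hom ℤ ∧ Φ.IsTriangulated ∧ Φ.IsEquivalence := by
  obtain ⟨Φ, hΦ, e, he, hΦ'⟩ := R.exists_mapDb_singleB
  refine ⟨Φ, hΦ, e, he, hΦ', ?_⟩
  obtain ⟨Ψ, ⟨e₁⟩, hΨ, -⟩ := R.exists_triangleEquivalence_chB
  obtain ⟨Θ, e₂, hΘ⟩ := R.isBicomplicialPair_chB.exists_comparison R.isThick_chB
  obtain ⟨S, e₃, hS⟩ := R.exists_swapDb
  let L := R.chB.projT (bicomplicialChB R.exact)
  have hL : L.IsLocalization R.qw := R.isBicomplicialPair_chB.isLocalization_projT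
  -- Applying `j` to each term of a complex `K` gives the exchange of the double complex with `K` as
  -- its only column. So `Φ` agrees, after the equivalence `Ψ`, with `Θ` followed by the exchange
  -- `S`; all three of `Ψ`, `Θ`, `S` are equivalences.
  let γ : L ⋙ Ψ ⋙ Φ ≅ L ⋙ Θ ⋙ S :=
    Functor.isoWhiskerRight e₁ Φ ≪≫ Functor.isoWhiskerLeft (toHb C) e ≪≫
      Functor.isoWhiskerRight (mapChBCompToHb singleB) R.chB.projHb ≪≫
      Functor.isoWhiskerRight (singleAtCompSwap 0).symm R.chB.proj ≪≫
      Functor.isoWhiskerLeft singleB e₃.symm ≪≫ Functor.isoWhiskerRight e₂.symm S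
  let i : Ψ ⋙ Φ ≅ Θ ⋙ S := Localization.liftNatIso L R.qw _ _ _ _ γ
  have : (Ψ ⋙ Φ).IsEquivalence := Functor.isEquivalence_of_iso i.symm
  exact Functor.isEquivalence_of_comp_left Ψ Φ

end RelExact

end Swap

end DerivedGW

theorem mainTheorem1 {C : Type u} [Category.{v} C] [Preadditive C] [HasZeroObject C]
    [HasBinaryBiproducts C] (R : DerivedGW.RelExact C) :
    (∀ B : DerivedGW.Bicomplicial R.exact, R.IsBicomplicialPair B → R.IsThick →
      (∃ Φ : R.T B ⥤ R.chB.T (DerivedGW.bicomplicialChB R.exact),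
        Nonempty (R.projT B ⋙ Φ ≅
          DerivedGW.singleB ⋙ R.chB.projT (DerivedGW.bicomplicialChB R.exact)) ∧
        DerivedGW.IsTriangleEquivalence (R.triangleDataT B)
          (R.chB.triangleDataT (DerivedGW.bicomplicialChB R.exact)) Φ) ∧
      ∃ Ψ : R.chB.T (DerivedGW.bicomplicialChB R.exact) ⥤ R.Db,
        Nonempty (R.chB.projT (DerivedGW.bicomplicialChB R.exact) ⋙ Ψ ≅ R.proj) ∧
        DerivedGW.IsTriangleEquivalence
          (R.chB.triangleDataT (DerivedGW.bicomplicialChB R.exact))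
          (DerivedGW.TriangleData.ofPretriangulated R.Db) Ψ) ∧
    (R.IsStrict →
      ∃ (Φ : R.Db ⥤ R.chB.Db) (_ : Φ.CommShift ℤ)
        (e : R.projHb ⋙ Φ ≅
          DerivedGW.mapHb (DerivedGW.singleB (C := C)) ⋙ R.chB.projHb),
        NatTrans.CommShift e.hom ℤ ∧ Φ.IsTriangulated ∧ Φ.IsEquivalence) :=
  ⟨fun _ hB hR => ⟨hB.exists_triangleEquivalence_singleB hR, R.exists_triangleEquivalence_chB⟩,
    fun _ => R.exists_derivedEquivalence⟩
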